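/- **Setting.** Let $n\in\mathbb N$, $c\in\mathbb R$, $f\in C^K(\mathbb R^n;\mathbb R^n)$ for some $K\ge 2$, and let $\bar u:\mathbb R\to\mathbb R^n$ be a $1$-periodic $C^2$ solution of the profile equation $\bar u''+c\bar u'+f(\bar u)=0$, i.e. a periodic standing wave of $u_t-cu_x=u_{xx}+f(u)$. For $\xi\in\mathbb R$ let $$L_\xi:=e^{-i\xi x}\big(\partial_x^2+c\,\partial_x+df(\bar u)\big)e^{i\xi x}$$ be the Bloch operators on $L^2_{\rm per}([0,1];\mathbb C^n)$ with domain $H^2_{\rm per}$; each generates a strongly continuous semigroup $e^{L_\xi t}$. Assume: * (D1) $0$ is a simple eigenvalue of $L_0$, and it is the only point of $\sigma(L_0)$ on the imaginary axis; * (D2) there is $\theta_0>0$ with $\Re\,\sigma(L_\xi)\le-\theta_0|\xi|^2$ for all $\xi\in[-\pi,\pi]$. For $g\in L^2(\mathbb R;\mathbb C^n)$ with Fourier transform $\hat g(\eta)=\int_{\mathbb R} e^{-i\eta x}g(x)\,dx$ (extended to $L^2$ by Plancherel), let $\hat g(\xi,x)=\sum_{j\in\mathbb Z}e^{2\pi ijx}\hat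 g(\xi+2\pi j)$ be its Bloch–Fourier transform. For $r>0$ let $P(\xi)=\frac1{2\pi i}\oint_{|\mu|=r}(\mu-L_\xi)^{-1}d\mu$. For $\varepsilon>0$ let $\phi$ be a smooth cutoff function with $\phi(\xi)=1$ for $|\xi|\le\varepsilon$ and $\phi(\xi)=0$ for $|\xi|\ge2\varepsilon$, and let $$S^{II}(t)g(x):=\frac1{2\pi}\int_{-\pi}^{\pi}e^{i\xi x}\big(1-\phi(\xi)P(\xi)\big)e^{L_\xi t}\hat g(\xi,x)\,d\xi$$ be the high-frequency part of the solution operator of the linearized equation. **Proposition 3.1.** There are $r>0$ such that $\sigma(L_0)\cap\{|\mu|\le r\}\subseteq\{0\}$. For every such $r$ there is $\varepsilon_0>0$ such that the circle $|\mu|=r$ does not meet $\sigma(L_\xi)$ for $|\xi|\le2\varepsilon_0$ (so that $P(\xi)$, the total eigenprojection associated with the eigenvalue of $L_\xi$ bifurcating from $0$ at $\xi=0$, is well defined there), and the following holds. For every $0<\varepsilon\le\varepsilon_0$ and every cutoff function $\phi$ as above there are constants $\theta>0$ and $C>0$ such that, for all $g\in L^2(\mathbb R;\mathbb C^n)$,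 all $t>0$ and all $2\le p\le\infty$, the function $S^{II}(t)g$ is well defined almost everywhere and $$\|S^{II}(t)g\|_{L^p(\mathbb R)}\le C\,t^{-\frac12\left(\frac12-\frac1p\right)}e^{-\theta t}\,\|g\|_{L^2(\mathbb R)}.$$ -/

import Mathlib

open MeasureTheory Set Filter Topology
open scoped ENNReal ContDiff FourierTransform

noncomputable section

namespace ReactionDiffusion

/-- The real state space `ℝⁿ` with its Euclidean norm. -/
abbrev RVec (n : ℕ) : Type := EuclideanSpace ℝ (Fin n)

/-- The complexified state space `ℂⁿ` with its Hermitian norm. -/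
abbrev CVec (n : ℕ) : Type := EuclideanSpace ℂ (Fin n)

/-- `L²(ℝ; ℂⁿ)`. -/
abbrev L2Line (n : ℕ) : Type := Lp (CVec n) 2 (volume : Measure ℝ)

/-- `L²_per([0,1]; ℂⁿ)`: square integrable functions on the circle `ℝ/ℤ`
(whose Haar probability measure is Lebesgue measure on a period cell). -/
abbrev L2Per (n : ℕ) : Type :=
  Lp (CVec n) 2 (AddCircle.haarAddCircle : Measure UnitAddCircle)

/-- `u` is a `1`-periodic standing wave of `u_t - c u_x = u_xx + f(u)`, that is, a classical
`1`-periodic solution of the profile equation `u'' + c u' + f(u) = 0`. -/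
def IsPeriodicStandingWave {n : ℕ} (c : ℝ) (f : RVec n → RVec n) (u : ℝ → RVec n) : Prop :=
  ContDiff ℝ 2 u ∧ Function.Periodic u 1 ∧
    ∀ x, deriv (deriv u) x + c • deriv u x + f (u x) = 0

/-- The complex-linear extension to `ℂⁿ` of a real-linear map of `ℝⁿ`, through its matrix
in the standard basis. -/
def complexify {n : ℕ} (M : RVec n →L[ℝ] RVec n) (v : CVec n) : CVec n :=
  WithLp.toLp 2 fun i => ∑ j, ((M (EuclideanSpace.single j (1 : ℝ)) i : ℝ) : ℂ) * v j

/-- `w = e^{-iξx} ∂ₓ (e^{iξx} v) = (∂ₓ + iξ) v` weakly in `L²_per`. As the exponentials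
`e^{2πikx}` span a dense set of periodic test functions, this is the statement that
`ŵ(k) = i(2πk + ξ) v̂(k)` for the Fourier coefficients; such a `w` in `L²_per` exists if and only
if `v` belongs to the periodic Sobolev space `H¹_per`. -/
def IsBlochDeriv {n : ℕ} (ξ : ℝ) (v w : L2Per n) : Prop :=
  ∀ k : ℤ, fourierCoeff (w : UnitAddCircle → CVec n) k =
    (Complex.I * (2 * Real.pi * k + ξ)) • fourierCoeff (v : UnitAddCircle → CVec n) k

/-- The graph of the Bloch operator `L_ξ = e^{-iξx} (∂ₓ² + c ∂ₓ + df(u)) e^{iξx}` on `L²_per`,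
with domain `H²_per`: `BlochOp c f u ξ v w` says that `v ∈ H²_per` and `L_ξ v = w`. -/
def BlochOp {n : ℕ} (c : ℝ) (f : RVec n → RVec n) (u : ℝ → RVec n) (ξ : ℝ)
    (v w : L2Per n) : Prop :=
  ∃ v₁ v₂ : L2Per n, IsBlochDeriv ξ v v₁ ∧ IsBlochDeriv ξ v₁ v₂ ∧
    ∀ᵐ x : ℝ, w (x : UnitAddCircle) =
      v₂ (x : UnitAddCircle) + (c : ℂ) • v₁ (x : UnitAddCircle) +
        complexify (fderiv ℝ f (u x)) (v (x : UnitAddCircle))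

section UnboundedOperators

variable {H : Type*} [NormedAddCommGroup H] [NormedSpace ℂ H]

/-- `R` is the bounded inverse of `μ - A`, where the unbounded operator `A` is given by its graph:
`R w = v` if and only if `v ∈ dom A` and `μ v - A v = w`. -/
def IsResolventAt (A : H → H → Prop) (μ : ℂ) (R : H →L[ℂ] H) : Prop :=
  ∀ v w, R w = v ↔ A v (μ • v - w)

/-- The spectrum of an unbounded operator given by its graph. -/
def opSpectrum (A : H → H → Prop) : Set ℂ := {μ | ¬ ∃ R, IsResolventAt A μ R}

open Classical in
/-- The resolvent `(μ - A)⁻¹` (set to `0` on the spectrum of `A`). -/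
def opResolvent (A : H → H → Prop) (μ : ℂ) : H →L[ℂ] H :=
  if h : ∃ R, IsResolventAt A μ R then h.choose else 0

/-- `μ` is an (algebraically) simple eigenvalue of `A`: the eigenspace is spanned by one nonzero
vector `v`, and there is no generalized eigenvector `w` with `(A - μ) w = v`. -/
def IsSimpleEigenvalue (A : H → H → Prop) (μ : ℂ) : Prop :=
  ∃ v, v ≠ 0 ∧ A v (μ • v) ∧ (∀ w, A w (μ • w) → ∃ a : ℂ, w = a • v) ∧
    ¬ ∃ w, A w (μ • w + v)

/-- `T t = e^{tA}` for `t ≥ 0`: the family `T` is a strongly continuous semigroup of bounded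
operators on `[0,∞)` whose infinitesimal generator, with its natural domain, is `A`. This
determines `T t` for all `t ≥ 0`. -/
structure IsSemigroupGeneratedBy (A : H → H → Prop) (T : ℝ → H →L[ℂ] H) : Prop where
  zero : T 0 = ContinuousLinearMap.id ℂ H
  add : ∀ s t, 0 ≤ s → 0 ≤ t → T (s + t) = (T s).comp (T t)
  continuousOn : ∀ v, ContinuousOn (fun t => T t v) (Ici 0)
  generator : ∀ v w, A v w ↔
    Tendsto (fun s : ℝ => ((s⁻¹ : ℝ) : ℂ) • (T s v - v)) (𝓝[>] 0) (𝓝 w)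

/-- The circle `|μ| = r` isolates `0` from the rest of the spectrum of `A`. -/
def IsolatesZero (A : H → H → Prop) (r : ℝ) : Prop :=
  0 < r ∧ ∀ μ ∈ opSpectrum A, ‖μ‖ ≤ r → μ = 0

/-- The total (Riesz) eigenprojection `(2πi)⁻¹ ∮_{|μ| = r} (μ - A)⁻¹ dμ` onto the eigenspaces of
the eigenvalues inside the circle `|μ| = r`. -/
def totalEigenprojection (A : H → H → Prop) (r : ℝ) : H →L[ℂ] H :=
  (2 * Real.pi * Complex.I)⁻¹ • ∮ μ in C(0, r), opResolvent A μ

end UnboundedOperators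

/-- The Fourier transform `ĝ(η) = ∫ e^{-iηx} g(x) dx` of `g ∈ L²(ℝ; ℂⁿ)`, expressed through
Mathlib's unitary transform `𝓕 g (ν) = ∫ e^{-2πiνx} g(x) dx`. -/
def fourierHat {n : ℕ} (g : L2Line n) (η : ℝ) : CVec n :=
  (𝓕 g : L2Line n) (η / (2 * Real.pi))

/-- The function `x ↦ e^{2πijx} a` in `L²_per`. -/
def mode {n : ℕ} (j : ℤ) (a : CVec n) : L2Per n :=
  ContinuousMap.toLp 2 (AddCircle.haarAddCircle : Measure UnitAddCircle) ℂ
    (⟨fun x => fourier j x • a, by fun_prop⟩ : C(UnitAddCircle, CVec n))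

/-- The Bloch-Fourier transform `ĝ(ξ, ·) = ∑_j e^{2πij·} ĝ(ξ + 2πj) ∈ L²_per`
(the series converges in `L²_per` for almost every `ξ`). -/
def blochTransform {n : ℕ} (g : L2Line n) (ξ : ℝ) : L2Per n :=
  ∑' j : ℤ, mode j (fourierHat g (ξ + 2 * Real.pi * j))

/-- `φ` is a smooth cutoff function, equal to `1` for `|ξ| ≤ ε` and to `0` for `|ξ| ≥ 2ε`. -/
def IsCutoff (ε : ℝ) (φ : ℝ → ℝ) : Prop :=
  ContDiff ℝ ∞ φ ∧ (∀ ξ, |ξ| ≤ ε → φ ξ = 1) ∧ ∀ ξ, 2 * ε ≤ |ξ| → φ ξ = 0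

/-- `h = S^{II}(t) g`, the high-frequency part of the solution operator applied to `g`:
`h(x) = (2π)⁻¹ ∫_{-π}^{π} e^{iξx} ((1 - φ(ξ)P(ξ)) e^{L_ξ t} ĝ(ξ,·))(x) dξ` for almost every `x`,
where `P(ξ)` is the total eigenprojection of `L_ξ` for the circle of radius `r`, `T ξ` is the
semigroup generated by `L_ξ`, and `V` is a jointly measurable representative of the
`L²_per`-valued function under the integral. These requirements determine `h` up to null sets. -/
def IsHighFrequencyPart {n : ℕ} (c : ℝ) (f : RVec n → RVec n) (u : ℝ → RVec n)
    (r : ℝ) (φ : ℝ → ℝ) (t : ℝ) (g : L2Line n) (h : ℝ → CVec n) : Prop :=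
  ∃ (T : ℝ → ℝ → L2Per n →L[ℂ] L2Per n) (V : ℝ → UnitAddCircle → CVec n),
    (∀ ξ ∈ Icc (-Real.pi) Real.pi, IsSemigroupGeneratedBy (BlochOp c f u ξ) (T ξ)) ∧
    AEStronglyMeasurable (Function.uncurry V)
      ((volume.restrict (Icc (-Real.pi) Real.pi)).prod AddCircle.haarAddCircle) ∧
    (∀ᵐ ξ ∂volume.restrict (Icc (-Real.pi) Real.pi),
      V ξ =ᵐ[AddCircle.haarAddCircle]
        (T ξ t (blochTransform g ξ) - (φ ξ : ℂ) •
          totalEigenprojection (BlochOp c f u ξ) r (T ξ t (blochTransform g ξ)) : L2Per n)) ∧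
    (∀ᵐ x : ℝ, IntegrableOn (fun ξ => V ξ (x : UnitAddCircle)) (Icc (-Real.pi) Real.pi)) ∧
    ∀ᵐ x : ℝ, h x = ((2 * Real.pi : ℝ) : ℂ)⁻¹ •
      ∫ ξ in (-Real.pi)..Real.pi,
        Complex.exp (Complex.I * ξ * x) • V ξ (x : UnitAddCircle)

end ReactionDiffusion

end

/-! In the basis of vector-valued exponentials `e^{2πikx} e_j` the Bloch operator is `L_ξ = D_ξ + B`
(`blochOp_eq_perturbedDiag`). Here `D_ξ` is diagonal with entries `-(2πk+ξ)² + ic(2πk+ξ)`, whose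
real parts are nonpositive and tend to `-∞`, while `B`, multiplication by `df(ū)`, is bounded and
independent of `ξ`. Semigroups and spectra can therefore be studied for such sums on an abstract
Hilbert space.

Semigroup: the variation of constants equation is solvable (`exists_isDuhamel`), and its solution is
the semigroup generated by `D_ξ + B`. It grows at most like `e^{‖B‖t}`, is compact for `t > 0`, and
depends on `ξ` continuously in operator norm.

Decay: the spectrum of `L_ξ` consists of eigenvalues, and the nonzero eigenvalues of `e^{L_ξ}` are
exponentials of eigenvalues of `L_ξ` (`IsSemigroupGeneratedBy.exists_eigenvector`). By (D2) those of
`e^{L_ξ}` lie in the open unit disk for `ξ ≠ 0`; by (D1) and (D2) the same holds for `e^{L_0}(1 -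
P(0))`. A compact operator of this kind has a power of norm below `1/2`, an inequality which
persists for nearby `ξ`. Compactness of `ε ≤ |ξ| ≤ π` then gives `‖e^{L_ξ t}(1 - φP)‖ ≤ C e^{-θt}`
uniformly on the Brillouin zone (`exists_decay_highFrequency`).

Estimate: Plancherel for the Bloch transform and for its inverse turns the decay into the case `p =
2`. For `p = ∞`, Cauchy–Schwarz against `∑ e^{-2t(2πk+ξ)²} ≲ t^{-1/2}` shows that the diagonal
semigroup maps `ℓ²` coefficients to `ℓ¹` with norm of order `t^{-1/4}` for `t ≤ 1`, and the Duhamel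
integral keeps this rate (`IsDuhamel.sum_norm_repr_le`). Smoothing on a final time interval of
length `min t 1`, after decay on the rest, bounds the integrand uniformly in `x` by a multiple of
`‖ĝ(ξ,·)‖`, which is integrated in `ξ`. Interpolation gives the remaining `p`. The `ℓ¹` bound also
yields the representatives that make the integral meaningful pointwise. -/

noncomputable section

namespace ReactionDiffusion

/-! ### Diagonal operators in a Hilbert basis -/

section Diagonal

variable {ι H : Type*} [NormedAddCommGroup H] [InnerProductSpace ℂ H]
  (b : HilbertBasis ι ℂ H)

theorem hasSum_norm_sq_repr (v : H) : HasSum (fun i => ‖b.repr v i‖ ^ 2) (‖v‖ ^ 2) := by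
  have h := lp.hasSum_norm (p := 2) (by norm_num) (b.repr v)
  simpa [b.repr.norm_map] using h

theorem exists_repr_eq {a : ι → ℂ} (ha : Summable fun i => ‖a i‖ ^ 2) :
    ∃ v, ∀ i, b.repr v i = a i := by
  have hm : Memℓp a 2 := memℓp_gen (by simpa using ha)
  exact ⟨b.repr.symm ⟨a, hm⟩, fun i => by simp⟩

theorem ext_repr {v w : H} (h : ∀ i, b.repr v i = b.repr w i) : v = w :=
  b.repr.injective (lp.ext (funext h))

/-- Comparison of norms through coefficients. -/
theorem norm_le_of_repr_le {C : ℝ} (hC : 0 ≤ C) {v w : H}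
    (h : ∀ i, ‖b.repr w i‖ ≤ C * ‖b.repr v i‖) : ‖w‖ ≤ C * ‖v‖ := by
  have h1 := hasSum_norm_sq_repr b w
  have h2 := (hasSum_norm_sq_repr b v).mul_left (C ^ 2)
  have h3 : ‖w‖ ^ 2 ≤ C ^ 2 * ‖v‖ ^ 2 := by
    refine hasSum_le (fun i => ?_) h1 h2
    rw [← mul_pow]
    exact pow_le_pow_left₀ (norm_nonneg _) (h i) 2
  rw [← mul_pow] at h3
  exact le_of_sq_le_sq₀ h3 (by positivity)
where
  le_of_sq_le_sq₀ {x y : ℝ} (h : x ^ 2 ≤ y ^ 2) (hy : 0 ≤ y) : x ≤ y := abs_le_of_sq_le_sq' h hy |>.2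

theorem exists_diagonal {m : ι → ℂ} (hm : ∃ C, ∀ i, ‖m i‖ ≤ C) :
    ∃ M : H →L[ℂ] H, ∀ v i, b.repr (M v) i = m i * b.repr v i := by
  obtain ⟨C, hC⟩ := hm
  have hC0 : ∀ i, ‖m i‖ ≤ |C| := fun i => (hC i).trans (le_abs_self C)
  have key : ∀ v : H, ∃ w, ∀ i, b.repr w i = m i * b.repr v i := by
    intro v
    refine exists_repr_eq b ?_
    refine Summable.of_nonneg_of_le (fun i => by positivity) (fun i => ?_)
      ((hasSum_norm_sq_repr b v).summable.mul_left (|C| ^ 2))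
    rw [norm_mul, mul_pow]
    gcongr
    exact hC0 i
  choose M hM using key
  refine ⟨LinearMap.mkContinuous ⟨⟨M, fun v w => ?_⟩, fun a v => ?_⟩ |C| fun v => ?_, fun v i => hM v i⟩
  · refine ext_repr b fun i => ?_
    simp [hM, mul_add]
  · refine ext_repr b fun i => ?_
    simp [hM, mul_left_comm]
  · refine norm_le_of_repr_le b (abs_nonneg C) fun i => ?_
    simp only [LinearMap.coe_mk, AddHom.coe_mk, hM, norm_mul]
    gcongr
    exact hC0 i

open Classical in
/-- The operator which multiplies the coefficients in a Hilbert basis by the bounded family `m`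
(set to `0` if `m` is unbounded). -/
def diagOp (m : ι → ℂ) : H →L[ℂ] H :=
  if hm : ∃ C, ∀ i, ‖m i‖ ≤ C then (exists_diagonal b hm).choose else 0

theorem repr_diagOp {m : ι → ℂ} {C : ℝ} (hm : ∀ i, ‖m i‖ ≤ C) (v : H) (i : ι) :
    b.repr (diagOp b m v) i = m i * b.repr v i := by
  have h : ∃ C, ∀ i, ‖m i‖ ≤ C := ⟨C, hm⟩
  rw [diagOp, dif_pos h]
  exact (exists_diagonal b h).choose_spec v i

theorem norm_diagOp_apply_le {m : ι → ℂ} {C : ℝ} (hC : 0 ≤ C) (hm : ∀ i, ‖m i‖ ≤ C) (v : H) :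
    ‖diagOp b m v‖ ≤ C * ‖v‖ := by
  refine norm_le_of_repr_le b hC fun i => ?_
  rw [repr_diagOp b hm, norm_mul]
  gcongr
  exact hm i

theorem norm_diagOp_sub_apply_le {m m' : ι → ℂ} {C C₁ C₂ : ℝ} (hC : 0 ≤ C)
    (hm : ∀ i, ‖m i‖ ≤ C₁) (hm' : ∀ i, ‖m' i‖ ≤ C₂) (h : ∀ i, ‖m i - m' i‖ ≤ C) (v : H) :
    ‖diagOp b m v - diagOp b m' v‖ ≤ C * ‖v‖ := by
  refine norm_le_of_repr_le b hC fun i => ?_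
  rw [map_sub, lp.coeFn_sub, Pi.sub_apply, repr_diagOp b hm, repr_diagOp b hm', ← sub_mul, norm_mul]
  gcongr
  exact h i

/-- The diagonal operators with finitely many nonzero entries are compact. -/
theorem isCompactOperator_diagOp_of_finite {m : ι → ℂ} (s : Finset ι) (hs : ∀ i ∉ s, m i = 0) :
    IsCompactOperator (diagOp b m) := by
  have hm : ∀ i, ‖m i‖ ≤ ∑ j ∈ s, ‖m j‖ := by
    intro i
    by_cases hi : i ∈ s
    · exact Finset.single_le_sum (f := fun j => ‖m j‖) (fun j _ => norm_nonneg _) hi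
    · rw [hs i hi, norm_zero]; positivity
  let W : Submodule ℂ H := Submodule.span ℂ (b '' (s : Set ι))
  have : FiniteDimensional ℂ W :=
    FiniteDimensional.span_of_finite ℂ (s.finite_toSet.image b)
  have hW : ∀ v, diagOp b m v ∈ W := by
    intro v
    classical
    have : diagOp b m v = ∑ i ∈ s, (m i * b.repr v i) • b i := by
      refine ext_repr b fun i => ?_
      rw [repr_diagOp b hm, map_sum, lp.coeFn_sum, Finset.sum_apply]
      simp only [map_smul, lp.coeFn_smul, Pi.smul_apply, b.repr_self, smul_eq_mul, lp.single_apply]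
      rw [Finset.sum_eq_single i]
      · simp
      · intro j _ hj
        rw [Pi.single_eq_of_ne hj.symm, mul_zero]
      · intro hi
        simp [hs i hi]
    rw [this]
    exact Submodule.sum_mem _ fun i hi =>
      Submodule.smul_mem _ _ (Submodule.subset_span ⟨i, hi, rfl⟩)
  have : ProperSpace W := FiniteDimensional.proper ℂ W
  let f : H →L[ℂ] W := (diagOp b m).codRestrict W hW
  have hf : IsCompactOperator f :=
    isCompactOperator_of_locallyCompactSpace_dom f
  exact hf.clm_comp W.subtypeL

/-- A bounded operator whose coefficients are uniformly small outside finite sets is compact. -/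
theorem isCompactOperator_of_tail_small [CompleteSpace H] (K : H →L[ℂ] H)
    (h : ∀ ε > 0, ∃ (s : Finset ι) (C : ℝ), C ≤ ε ∧ 0 ≤ C ∧
      ∀ v w, (∀ i ∈ s, b.repr w i = 0) → (∀ i ∉ s, b.repr w i = b.repr (K v) i) →
        ‖w‖ ≤ C * ‖v‖) :
    IsCompactOperator K := by
  classical
  choose! s C hC hC0 hs using fun n : ℕ => h (1 / ((n : ℝ) + 1)) (by positivity)
  let m : ℕ → ι → ℂ := fun n i => if i ∈ s n then 1 else 0
  have hm : ∀ n i, ‖m n i‖ ≤ 1 := fun n i => by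
    simp only [m]; split_ifs <;> simp
  refine isCompactOperator_of_tendsto (l := atTop) (F := fun n => (diagOp b (m n)).comp K) ?_ ?_
  · rw [tendsto_iff_norm_sub_tendsto_zero]
    refine squeeze_zero (fun _ => norm_nonneg _) (fun n => ?_)
      tendsto_one_div_add_atTop_nhds_zero_nat
    refine (ContinuousLinearMap.opNorm_le_bound _ (hC0 n) fun v => ?_).trans (hC n)
    rw [← norm_neg]
    refine hs n v _ (fun i hi => ?_) fun i hi => ?_ <;>
    simp [repr_diagOp b (hm n), m, hi]
  · refine Eventually.of_forall fun n => ?_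
    exact (isCompactOperator_diagOp_of_finite b (s n) (fun i hi => by simp [m, hi])).comp_clm K

theorem isCompactOperator_diagOp [CompleteSpace H] {m : ι → ℂ} {C : ℝ} (hm : ∀ i, ‖m i‖ ≤ C)
    (hfin : ∀ ε > 0, {i | ε < ‖m i‖}.Finite) : IsCompactOperator (diagOp b m) := by
  refine isCompactOperator_of_tail_small b _ fun ε hε => ⟨(hfin ε hε).toFinset, ε, le_rfl, hε.le, ?_⟩
  intro v w hw hw'
  refine norm_le_of_repr_le b hε.le fun i => ?_
  by_cases hi : i ∈ (hfin ε hε).toFinset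
  · rw [hw i hi, norm_zero]; positivity
  · rw [hw' i hi, repr_diagOp b hm, norm_mul]
    gcongr
    simpa using hi

end Diagonal

/-! ### Diagonal semigroups and the variation of constants equation -/

section Semigroup

variable {ι H : Type*} [NormedAddCommGroup H] [InnerProductSpace ℂ H]
  (b : HilbertBasis ι ℂ H) (d : ι → ℂ)

/-- The semigroup `e^{tD}` (`t ≥ 0`, constant for `t ≤ 0`) of the diagonal operator `D` with
entries `d`. -/
def diagSemigroup (t : ℝ) : H →L[ℂ] H := diagOp b fun i => Complex.exp ((max t 0 : ℝ) * d i)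

variable {d}

theorem norm_exp_mul_le_one (hd : ∀ i, (d i).re ≤ 0) (t : ℝ) (i : ι) :
    ‖Complex.exp ((max t 0 : ℝ) * d i)‖ ≤ 1 := by
  rw [Complex.norm_exp, Complex.re_ofReal_mul]
  exact Real.exp_le_one_iff.2 (mul_nonpos_of_nonneg_of_nonpos (le_max_right _ _) (hd i))

theorem repr_diagSemigroup (hd : ∀ i, (d i).re ≤ 0) {t : ℝ} (ht : 0 ≤ t) (v : H) (i : ι) :
    b.repr (diagSemigroup b d t v) i = Complex.exp (t * d i) * b.repr v i := by
  rw [diagSemigroup, repr_diagOp b (norm_exp_mul_le_one hd t), max_eq_left ht]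

theorem norm_diagSemigroup_le (hd : ∀ i, (d i).re ≤ 0) (t : ℝ) (v : H) :
    ‖diagSemigroup b d t v‖ ≤ ‖v‖ := by
  simpa [diagSemigroup] using norm_diagOp_apply_le b zero_le_one (norm_exp_mul_le_one hd t) v

theorem diagSemigroup_zero (hd : ∀ i, (d i).re ≤ 0) (v : H) : diagSemigroup b d 0 v = v :=
  ext_repr b fun i => by simp [repr_diagSemigroup b hd le_rfl]

theorem diagSemigroup_add (hd : ∀ i, (d i).re ≤ 0) {s t : ℝ} (hs : 0 ≤ s) (ht : 0 ≤ t) (v : H) :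
    diagSemigroup b d (s + t) v = diagSemigroup b d s (diagSemigroup b d t v) :=
  ext_repr b fun i => by
    rw [repr_diagSemigroup b hd (add_nonneg hs ht), repr_diagSemigroup b hd hs,
      repr_diagSemigroup b hd ht, ← mul_assoc, ← Complex.exp_add]
    push_cast
    ring_nf

theorem continuous_diagSemigroup_apply (hd : ∀ i, (d i).re ≤ 0) (v : H) :
    Continuous fun t => diagSemigroup b d t v := by
  rw [continuous_iff_continuousAt]
  intro t₀
  have hbd : ∀ t i, ‖Complex.exp ((max t 0 : ℝ) * d i)‖ ≤ 1 := norm_exp_mul_le_one hd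
  have h1 : ∀ t, HasSum (fun i => ‖(Complex.exp ((max t 0 : ℝ) * d i) -
      Complex.exp ((max t₀ 0 : ℝ) * d i)) * b.repr v i‖ ^ 2)
      (‖diagSemigroup b d t v - diagSemigroup b d t₀ v‖ ^ 2) := by
    intro t
    have := hasSum_norm_sq_repr b (diagSemigroup b d t v - diagSemigroup b d t₀ v)
    simpa [diagSemigroup, repr_diagOp b (hbd t), repr_diagOp b (hbd t₀), sub_mul] using this
  have h2 : Tendsto (fun t => ‖diagSemigroup b d t v - diagSemigroup b d t₀ v‖ ^ 2) (𝓝 t₀) (𝓝 0) := by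
    simp_rw [← (h1 _).tsum_eq]
    rw [show 𝓝 (0 : ℝ) = 𝓝 (∑' _ : ι, (0 : ℝ)) by rw [tsum_zero]]
    -- Both exponentials have modulus at most one, so their difference has square at most `4`.
    refine tendsto_tsum_of_dominated_convergence (bound := fun i => 4 * ‖b.repr v i‖ ^ 2)
      ((hasSum_norm_sq_repr b v).summable.mul_left 4) (fun i => ?_)
      (Eventually.of_forall fun t i => ?_)
    · have : Continuous fun t : ℝ => ‖(Complex.exp ((max t 0 : ℝ) * d i) -
          Complex.exp ((max t₀ 0 : ℝ) * d i)) * b.repr v i‖ ^ 2 := by fun_prop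
      simpa using this.tendsto t₀
    · rw [norm_pow, norm_norm, norm_mul, mul_pow]
      gcongr
      have := norm_sub_le (Complex.exp ((max t 0 : ℝ) * d i)) (Complex.exp ((max t₀ 0 : ℝ) * d i))
      nlinarith [hbd t i, hbd t₀ i, norm_nonneg (Complex.exp ((max t 0 : ℝ) * d i) -
          Complex.exp ((max t₀ 0 : ℝ) * d i))]
  rw [ContinuousAt, tendsto_iff_norm_sub_tendsto_zero]
  simpa using h2.sqrt

theorem continuous_diagSemigroup (hd : ∀ i, (d i).re ≤ 0) :
    Continuous fun p : ℝ × H => diagSemigroup b d p.1 p.2 := by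
  rw [continuous_iff_continuousAt]
  rintro ⟨t, v⟩
  rw [ContinuousAt, tendsto_iff_norm_sub_tendsto_zero]
  have h : ContinuousAt (fun p : ℝ × H => ‖p.2 - v‖ +
      ‖diagSemigroup b d p.1 v - diagSemigroup b d t v‖) (t, v) := by
    have := (continuous_diagSemigroup_apply b hd v).comp (continuous_fst (X := ℝ) (Y := H))
    exact ((continuous_snd.sub continuous_const).norm.add
      (this.sub continuous_const).norm).continuousAt
  refine squeeze_zero (fun _ => norm_nonneg _) (fun p => ?_) (by simpa [ContinuousAt] using h)
  calc _ = ‖diagSemigroup b d p.1 (p.2 - v) +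
        (diagSemigroup b d p.1 v - diagSemigroup b d t v)‖ := by rw [map_sub]; abel_nf
    _ ≤ _ := (norm_add_le _ _).trans (by gcongr; exact norm_diagSemigroup_le b hd _ _)

/-- Grönwall's inequality in integral form. -/
theorem le_mul_exp_of_le_add_integral {w : ℝ → ℝ} {α β τ : ℝ} (hβ : 0 ≤ β)
    (hw : Continuous w) (hτ : 0 ≤ τ)
    (h : ∀ t ∈ Icc 0 τ, w t ≤ α + β * ∫ s in 0..t, w s) :
    w τ ≤ α * Real.exp (β * τ) := by
  have hder : ∀ t, HasDerivAt (fun t => α + β * ∫ s in 0..t, w s) (β * w t) t := fun t =>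
    ((intervalIntegral.integral_hasDerivAt_right (hw.intervalIntegrable _ _)
      (hw.stronglyMeasurableAtFilter _ _) hw.continuousAt).const_mul β).const_add α
  have key := le_gronwallBound_of_liminf_deriv_right_le (f := fun t => α + β * ∫ s in 0..t, w s)
    (f' := fun t => β * w t) (δ := α) (K := β) (ε := 0) (a := 0) (b := τ)
    (fun t _ => (hder t).continuousAt.continuousWithinAt)
    (fun t _ r hr => (hder t).hasDerivWithinAt.liminf_right_slope_le hr)
    (by simp) (fun t ht => by
      rw [add_zero]
      exact mul_le_mul_of_nonneg_left (h t ⟨ht.1, ht.2.le⟩) hβ) τ ⟨hτ, le_rfl⟩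
  rw [gronwallBound_ε0, sub_zero] at key
  exact (h τ ⟨hτ, le_rfl⟩).trans key

theorem integral_exp_neg_mul_sub_le {l : ℝ} (hl : 0 < l) (t : ℝ) :
    ∫ s in (0 : ℝ)..t, Real.exp (-l * (t - s)) ≤ 1 / l := by
  have hder : ∀ s ∈ uIcc 0 t, HasDerivAt
      (fun s => Real.exp (-l * (t - s)) / l) (Real.exp (-l * (t - s))) s := by
    intro s _
    have h3 : HasDerivAt (fun s => -l * (t - s)) l s := by
      simpa using ((hasDerivAt_id s).const_sub t).const_mul (-l)
    simpa [hl.ne'] using h3.exp.div_const l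
  rw [intervalIntegral.integral_eq_sub_of_hasDerivAt hder
    (by apply Continuous.intervalIntegrable; fun_prop)]
  have : 0 ≤ Real.exp (-l * (t - 0)) / l := by positivity
  simp only [sub_self, mul_zero, Real.exp_zero]
  linarith

variable (d) in
/-- `T` solves the variation of constants equation of `D + B`, where `D` is the diagonal operator
with entries `d`. -/
structure IsDuhamel (B : H →L[ℂ] H) (T : ℝ → H →L[ℂ] H) : Prop where
  continuous : ∀ v, Continuous fun t => T t v
  eq : ∀ t, 0 ≤ t → ∀ v,
    T t v = diagSemigroup b d t v + ∫ s in (0 : ℝ)..t, diagSemigroup b d (t - s) (B (T s v))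

theorem continuous_diagSemigroup_comp (hd : ∀ i, (d i).re ≤ 0) (B : H →L[ℂ] H) {w : ℝ → H}
    (hw : Continuous w) :
    Continuous (Function.uncurry fun t s : ℝ => diagSemigroup b d (t - s) (B (w s))) :=
  (continuous_diagSemigroup b hd).comp
    ((continuous_fst.sub continuous_snd).prodMk (B.continuous.comp (hw.comp continuous_snd)))

/-- With the weight `e^{-lt}` the Volterra integral operator has norm at most `1/2` on bounded
continuous functions, so a single Neumann series solves the equation for all times at once. The
solution operator comes out linear and bounded in the initial value. -/
theorem exists_isDuhamel [CompleteSpace H] (hd : ∀ i, (d i).re ≤ 0) (B : H →L[ℂ] H) :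
    ∃ T, IsDuhamel b d B T := by
  -- The weighted kernel integrates to at most `‖B‖ / l`, which is at most `1/2`; the summand `1`
  -- keeps `l` positive when `B = 0`.
  set l : ℝ := 2 * ‖B‖ + 1 with hl
  have hl0 : 0 < l := by positivity
  -- the Volterra operator on bounded continuous functions
  let F : BoundedContinuousFunction ℝ H → ℝ → H := fun w t =>
    ∫ s in (0 : ℝ)..max t 0, Real.exp (-l * (max t 0 - s)) • diagSemigroup b d (max t 0 - s) (B (w s))
  have hker : ∀ w : BoundedContinuousFunction ℝ H, Continuous (Function.uncurry fun t s : ℝ =>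
      Real.exp (-l * (max t 0 - s)) • diagSemigroup b d (max t 0 - s) (B (w s))) := by
    intro w
    have h1 := (continuous_diagSemigroup_comp b hd B w.continuous).comp
      (((continuous_fst (X := ℝ) (Y := ℝ)).max continuous_const).prodMk continuous_snd :
        Continuous fun p : ℝ × ℝ => (max p.1 0, p.2))
    exact (by fun_prop : Continuous fun p : ℝ × ℝ => Real.exp (-l * (max p.1 0 - p.2))).smul h1
  have hkers : ∀ (w : BoundedContinuousFunction ℝ H) (t : ℝ), Continuous fun s : ℝ =>
      Real.exp (-l * (max t 0 - s)) • diagSemigroup b d (max t 0 - s) (B (w s)) := fun w t =>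
    (hker w).comp (Continuous.prodMk_right t)
  have hFc : ∀ w, Continuous (F w) := fun w =>
    intervalIntegral.continuous_parametric_intervalIntegral_of_continuous (hker w)
      (by fun_prop)
  have hFb : ∀ w t, ‖F w t‖ ≤ (1 / 2) * ‖w‖ := by
    intro w t
    have ht : (0 : ℝ) ≤ max t 0 := le_max_right _ _
    have h1 : ‖F w t‖ ≤ ∫ s in (0 : ℝ)..max t 0,
        Real.exp (-l * (max t 0 - s)) * (‖B‖ * ‖w‖) := by
      refine intervalIntegral.norm_integral_le_of_norm_le ht (Eventually.of_forall fun s _ => ?_)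
        (by apply Continuous.intervalIntegrable; fun_prop)
      rw [norm_smul, Real.norm_of_nonneg (Real.exp_nonneg _)]
      gcongr
      exact (norm_diagSemigroup_le b hd _ _).trans
        ((B.le_opNorm _).trans (by gcongr; exact w.norm_coe_le_norm s))
    rw [intervalIntegral.integral_mul_const] at h1
    refine h1.trans ((mul_le_mul_of_nonneg_right (integral_exp_neg_mul_sub_le hl0 _)
      (by positivity)).trans ?_)
    rw [← mul_assoc]
    gcongr
    rw [div_mul_eq_mul_div, div_le_div_iff₀ hl0 two_pos]
    linarith
  let V : BoundedContinuousFunction ℝ H →L[ℂ] BoundedContinuousFunction ℝ H :=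
    LinearMap.mkContinuous
      { toFun := fun w => BoundedContinuousFunction.ofNormedAddCommGroup (F w) (hFc w) _ (hFb w)
        map_add' := fun v w => by
          ext t
          simp only [F, BoundedContinuousFunction.coe_ofNormedAddCommGroup,
            BoundedContinuousFunction.coe_add, Pi.add_apply, map_add, smul_add]
          exact intervalIntegral.integral_add ((hkers v t).intervalIntegrable _ _)
            ((hkers w t).intervalIntegrable _ _)
        map_smul' := fun a w => by
          ext t
          simp only [F, BoundedContinuousFunction.coe_ofNormedAddCommGroup,
            BoundedContinuousFunction.coe_smul, map_smul, RingHom.id_apply]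
          simp_rw [smul_comm _ a]
          exact intervalIntegral.integral_smul a _ } (1 / 2) fun w =>
      BoundedContinuousFunction.norm_ofNormedAddCommGroup_le _ (by positivity) (hFb w)
  have hV : ∀ w t, V w t = F w t := fun w t => rfl
  have hVn : ‖V‖ < 1 := (LinearMap.mkContinuous_norm_le _ (by norm_num) _).trans_lt (by norm_num)
  let U := (Units.oneSub V hVn)
  -- the free evolution
  have hSb : ∀ (v : H) (t : ℝ), ‖Real.exp (-l * max t 0) • diagSemigroup b d t v‖ ≤ 1 * ‖v‖ := by
    intro v t
    rw [norm_smul, Real.norm_of_nonneg (Real.exp_nonneg _)]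
    gcongr
    · exact Real.exp_le_one_iff.2 (by nlinarith [le_max_right t 0])
    · exact norm_diagSemigroup_le b hd _ _
  have hSc : ∀ v, Continuous fun t : ℝ => Real.exp (-l * max t 0) • diagSemigroup b d t v := fun v =>
    (by fun_prop : Continuous fun t : ℝ => Real.exp (-l * max t 0)).smul
      (continuous_diagSemigroup_apply b hd v)
  let S : H →L[ℂ] BoundedContinuousFunction ℝ H :=
    LinearMap.mkContinuous
      { toFun := fun v => BoundedContinuousFunction.ofNormedAddCommGroup _ (hSc v) _ (hSb v)
        map_add' := fun v w => by ext t; simp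
        map_smul' := fun a w => by ext t; simp [smul_comm _ a] } 1 fun v =>
      BoundedContinuousFunction.norm_ofNormedAddCommGroup_le _ (by positivity) (hSb v)
  have hS : ∀ v t, S v t = Real.exp (-l * max t 0) • diagSemigroup b d t v := fun v t => rfl
  let Y : H →L[ℂ] BoundedContinuousFunction ℝ H := (↑U⁻¹ : _ →L[ℂ] _).comp S
  have hY : ∀ v, Y v = S v + V (Y v) := by
    intro v
    have h1 : (↑U * ↑U⁻¹ : BoundedContinuousFunction ℝ H →L[ℂ] BoundedContinuousFunction ℝ H) = 1 :=
      U.mul_inv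
    have h2 := congrArg (fun A => A (S v)) h1
    simp only [U, Units.val_oneSub, mul_apply_eq_comp, one_apply_eq_self,
      sub_apply] at h2
    exact sub_eq_iff_eq_add.1 h2
  -- The exponential factor undoes the weight.
  refine ⟨fun t => Real.exp (l * max t 0) • (BoundedContinuousFunction.evalCLM ℂ t).comp Y,
    fun v => ?_, fun t ht v => ?_⟩
  · simp only [smul_apply, ContinuousLinearMap.comp_apply]
    exact (by fun_prop : Continuous fun t : ℝ => Real.exp (l * max t 0)).smul (Y v).continuous
  · have h1 := congrArg (fun w : BoundedContinuousFunction ℝ H => w t) (hY v)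
    simp only [BoundedContinuousFunction.coe_add, Pi.add_apply, hV, hS, F, max_eq_left ht] at h1
    simp only [smul_apply, ContinuousLinearMap.comp_apply, max_eq_left ht,
      BoundedContinuousFunction.evalCLM_apply]
    rw [h1, smul_add, smul_smul, ← Real.exp_add, ← intervalIntegral.integral_smul]
    congr 1
    · simp
    · refine intervalIntegral.integral_congr fun s hs => ?_
      rw [uIcc_of_le ht] at hs
      simp only [max_eq_left hs.1]
      rw [ContinuousLinearMap.map_smul_of_tower, ContinuousLinearMap.map_smul_of_tower, smul_smul,
        ← Real.exp_add]
      ring_nf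

end Semigroup

/-! ### The semigroup generated by a bounded perturbation of a diagonal operator -/

section Generator

/-- The unbounded operator `D + B` given by its graph, where `D` is the diagonal operator with
entries `d` and `B` is bounded. -/
def perturbedDiag {ι H : Type*} [NormedAddCommGroup H] [InnerProductSpace ℂ H]
    (b : HilbertBasis ι ℂ H) (d : ι → ℂ) (B : H →L[ℂ] H) (v w : H) : Prop :=
  ∀ i, b.repr w i = d i * b.repr v i + b.repr (B v) i

variable {ι H : Type*} [NormedAddCommGroup H] [InnerProductSpace ℂ H]
  {b : HilbertBasis ι ℂ H} {d d' : ι → ℂ} {B : H →L[ℂ] H} {T T' : ℝ → H →L[ℂ] H}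

theorem continuous_diagSemigroup_sub (hd : ∀ i, (d i).re ≤ 0) (B : H →L[ℂ] H) {w : ℝ → H}
    (hw : Continuous w) (t : ℝ) : Continuous fun s => diagSemigroup b d (t - s) (B (w s)) :=
  Continuous.uncurry_left t (continuous_diagSemigroup_comp b hd B hw)

/-- Mean value inequality: the left half-plane is convex and the derivative of `exp` has modulus at
most one there. -/
theorem norm_exp_sub_exp_le {z w : ℂ} (hz : z.re ≤ 0) (hw : w.re ≤ 0) :
    ‖Complex.exp z - Complex.exp w‖ ≤ ‖z - w‖ := by
  have := (convex_halfSpace_re_le 0).norm_image_sub_le_of_norm_deriv_le (𝕜 := ℂ)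
    (f := Complex.exp) (C := 1) (fun x _ => Complex.differentiableAt_exp)
    (fun x hx => by
      rw [Complex.deriv_exp, Complex.norm_exp]
      exact Real.exp_le_one_iff.2 hx) (show w ∈ {c : ℂ | c.re ≤ 0} from hw) hz
  simpa using this

namespace IsDuhamel

theorem zero (hd : ∀ i, (d i).re ≤ 0) (h : IsDuhamel b d B T) :
    T 0 = ContinuousLinearMap.id ℂ H := by
  ext v
  simp [h.eq 0 le_rfl, diagSemigroup_zero b hd]

theorem norm_apply_le (hd : ∀ i, (d i).re ≤ 0) (h : IsDuhamel b d B T) {t : ℝ} (ht : 0 ≤ t)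
    (v : H) : ‖T t v‖ ≤ Real.exp (‖B‖ * t) * ‖v‖ := by
  rw [mul_comm]
  refine le_mul_exp_of_le_add_integral (w := fun t => ‖T t v‖) (norm_nonneg B)
    (h.continuous v).norm ht fun s hs => ?_
  rw [h.eq s hs.1 v, ← intervalIntegral.integral_const_mul]
  refine (norm_add_le _ _).trans (add_le_add (norm_diagSemigroup_le b hd s v) ?_)
  refine intervalIntegral.norm_integral_le_of_norm_le hs.1 (Eventually.of_forall fun r _ => ?_)
    (((h.continuous v).norm.const_mul _).intervalIntegrable _ _)
  exact (norm_diagSemigroup_le b hd _ _).trans (B.le_opNorm _)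

theorem norm_le (hd : ∀ i, (d i).re ≤ 0) (h : IsDuhamel b d B T) {t : ℝ} (ht : 0 ≤ t) :
    ‖T t‖ ≤ Real.exp (‖B‖ * t) :=
  ContinuousLinearMap.opNorm_le_bound _ (Real.exp_nonneg _) (h.norm_apply_le hd ht)

/-- As functions of the first time, the two sides have a difference that solves the variation of
constants equation with zero initial value; Grönwall's inequality makes it vanish. -/
theorem add_apply [CompleteSpace H] (hd : ∀ i, (d i).re ≤ 0) (h : IsDuhamel b d B T) {s t : ℝ}
    (hs : 0 ≤ s) (ht : 0 ≤ t) (v : H) : T (s + t) v = T s (T t v) := by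
  have hc : Continuous fun r => T (r + t) v := (h.continuous v).comp (by fun_prop)
  have key : ∀ r, 0 ≤ r → T (r + t) v - T r (T t v) =
      ∫ q in (0 : ℝ)..r, diagSemigroup b d (r - q) (B (T (q + t) v - T q (T t v))) := by
    intro r hr
    have hcont := continuous_diagSemigroup_sub (b := b) hd B (h.continuous v) (r + t)
    have h1 : ∫ q in (0 : ℝ)..t, diagSemigroup b d (r + t - q) (B (T q v)) =
        diagSemigroup b d r (∫ q in (0 : ℝ)..t, diagSemigroup b d (t - q) (B (T q v))) := by
      rw [← ContinuousLinearMap.intervalIntegral_comp_comm _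
        ((continuous_diagSemigroup_sub hd B (h.continuous v) t).intervalIntegrable _ _)]
      refine intervalIntegral.integral_congr fun q hq => ?_
      rw [uIcc_of_le ht] at hq
      rw [← diagSemigroup_add b hd hr (sub_nonneg.2 hq.2), add_sub_assoc]
    have h2 : ∫ q in t..(r + t), diagSemigroup b d (r + t - q) (B (T q v)) =
        ∫ q in (0 : ℝ)..r, diagSemigroup b d (r - q) (B (T (q + t) v)) := by
      have := intervalIntegral.integral_comp_add_right
        (fun q => diagSemigroup b d (r + t - q) (B (T q v))) (a := 0) (b := r) t
      rw [zero_add] at this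
      rw [← this]
      refine intervalIntegral.integral_congr fun q _ => ?_
      rw [add_sub_add_right_eq_sub]
    rw [h.eq (r + t) (add_nonneg hr ht) v, h.eq r hr (T t v),
      ← intervalIntegral.integral_add_adjacent_intervals (hcont.intervalIntegrable 0 t)
        (hcont.intervalIntegrable t (r + t)), h1, h2, diagSemigroup_add b hd hr ht]
    have e : diagSemigroup b d r (T t v) = diagSemigroup b d r (diagSemigroup b d t v) +
        diagSemigroup b d r (∫ q in (0 : ℝ)..t, diagSemigroup b d (t - q) (B (T q v))) := by
      rw [← map_add, ← h.eq t ht v]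
    rw [e]
    simp_rw [map_sub]
    rw [intervalIntegral.integral_sub
      ((continuous_diagSemigroup_sub hd B hc r).intervalIntegrable _ _)
      ((continuous_diagSemigroup_sub hd B (h.continuous (T t v)) r).intervalIntegrable _ _)]
    abel
  have := le_mul_exp_of_le_add_integral (w := fun r => ‖T (r + t) v - T r (T t v)‖) (α := 0)
    (norm_nonneg B) (hc.sub (h.continuous _)).norm hs fun r hr => by
      rw [key r hr.1, zero_add, ← intervalIntegral.integral_const_mul]
      refine intervalIntegral.norm_integral_le_of_norm_le hr.1
        (Eventually.of_forall fun q _ => ?_)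
        (((hc.sub (h.continuous _)).norm.const_mul _).intervalIntegrable _ _)
      exact (norm_diagSemigroup_le b hd _ _).trans (B.le_opNorm _)
  rw [zero_mul] at this
  exact sub_eq_zero.1 (norm_le_zero_iff.1 this)

/-- The expression is the average over `[0, s]` of an integrand that is jointly continuous in `(s,
r)` and equals `B v` at the origin. -/
theorem tendsto_inv_smul_integral [CompleteSpace H] (hd : ∀ i, (d i).re ≤ 0)
    (h : IsDuhamel b d B T) (v : H) :
    Tendsto (fun s : ℝ => ((s⁻¹ : ℝ) : ℂ) •
      ∫ r in (0 : ℝ)..s, diagSemigroup b d (s - r) (B (T r v))) (𝓝[>] 0) (𝓝 (B v)) := by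
  have hc := continuous_diagSemigroup_comp b hd B (h.continuous v)
  rw [Metric.tendsto_nhds]
  intro ε hε
  have h0 := Metric.continuousAt_iff.1 (hc.continuousAt (x := ((0 : ℝ), (0 : ℝ)))) (ε / 2) (half_pos hε)
  obtain ⟨δ, hδ, hb⟩ := h0
  have hval : Function.uncurry (fun t s : ℝ => diagSemigroup b d (t - s) (B (T s v)))
      ((0 : ℝ), (0 : ℝ)) = B v := by
    simp [diagSemigroup_zero b hd, h.zero hd]
  rw [hval] at hb
  filter_upwards [Ioo_mem_nhdsGT hδ] with s hs
  have hci := (continuous_diagSemigroup_sub hd B (h.continuous v) s : Continuous fun r =>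
    diagSemigroup b d (s - r) (B (T r v)))
  have hs0 : s ≠ 0 := hs.1.ne'
  have e1 : ((s⁻¹ : ℝ) : ℂ) • (∫ r in (0 : ℝ)..s, diagSemigroup b d (s - r) (B (T r v))) - B v =
      ((s⁻¹ : ℝ) : ℂ) • ∫ r in (0 : ℝ)..s, (diagSemigroup b d (s - r) (B (T r v)) - B v) := by
    rw [intervalIntegral.integral_sub (hci.intervalIntegrable _ _) (by simp), smul_sub]
    congr 1
    rw [intervalIntegral.integral_const, sub_zero, Complex.coe_smul, smul_smul,
      inv_mul_cancel₀ hs0, one_smul]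
  rw [dist_eq_norm, e1, norm_smul, Complex.norm_real, Real.norm_of_nonneg (inv_nonneg.2 hs.1.le)]
  have e2 : ‖∫ r in (0 : ℝ)..s, (diagSemigroup b d (s - r) (B (T r v)) - B v)‖ ≤
      ε / 2 * |s - 0| := by
    refine intervalIntegral.norm_integral_le_of_norm_le_const fun r hr => ?_
    rw [uIoc_of_le hs.1.le] at hr
    rw [← dist_eq_norm]
    refine (hb (x := (s, r)) ?_).le
    rw [Prod.dist_eq, max_lt_iff]
    simp only [Real.dist_eq, sub_zero, abs_lt]
    exact ⟨⟨by linarith [hs.1], hs.2⟩, by linarith [hr.1], by linarith [hr.2, hs.2]⟩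
  rw [sub_zero, abs_of_pos hs.1] at e2
  calc s⁻¹ * _ ≤ s⁻¹ * (ε / 2 * s) := by gcongr; exact inv_nonneg.2 hs.1.le
    _ = ε / 2 := by field_simp
    _ < ε := half_lt_self hε

end IsDuhamel

/-- Convergence in norm forces convergence of each coefficient. Conversely `‖s⁻¹(e^{sd} - 1)‖ ≤ ‖d‖`
when `Re d ≤ 0`, so the squared coefficients of the error are dominated by four times those of `w =
D v`, and dominated convergence applies to the Parseval sum. -/
theorem tendsto_diagSemigroup_iff (hd : ∀ i, (d i).re ≤ 0) (v w : H) :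
    Tendsto (fun s : ℝ => ((s⁻¹ : ℝ) : ℂ) • (diagSemigroup b d s v - v)) (𝓝[>] 0) (𝓝 w) ↔
      ∀ i, b.repr w i = d i * b.repr v i := by
  have hco : ∀ s : ℝ, 0 < s → ∀ i, b.repr (((s⁻¹ : ℝ) : ℂ) • (diagSemigroup b d s v - v)) i =
      ((s⁻¹ : ℝ) : ℂ) * (Complex.exp (s * d i) - 1) * b.repr v i := by
    intro s hs i
    simp only [map_smul, map_sub, lp.coeFn_smul, lp.coeFn_sub, Pi.smul_apply, Pi.sub_apply,
      smul_eq_mul, repr_diagSemigroup b hd hs.le]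
    ring
  have hlim : ∀ i, Tendsto (fun s : ℝ => ((s⁻¹ : ℝ) : ℂ) * (Complex.exp (s * d i) - 1))
      (𝓝[>] 0) (𝓝 (d i)) := by
    intro i
    have h1 : HasDerivAt (fun s : ℝ => Complex.exp (s * d i)) (d i) 0 := by
      have := ((Complex.ofRealCLM.hasDerivAt (x := 0)).mul_const (d i)).cexp
      simpa using this
    have h2 := h1.hasDerivWithinAt (s := Ioi 0)
    rw [hasDerivWithinAt_iff_tendsto_slope' (by simp)] at h2
    refine h2.congr fun s => ?_
    simp [slope_def_module]
  constructor
  · intro h i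
    have h1 : Tendsto (fun s : ℝ => b.repr (((s⁻¹ : ℝ) : ℂ) • (diagSemigroup b d s v - v)) i)
        (𝓝[>] 0) (𝓝 (b.repr w i)) := by
      simp only [b.repr_apply_apply]
      exact ((continuous_const.inner continuous_id).tendsto w).comp h
    refine tendsto_nhds_unique h1 (((hlim i).mul_const (b.repr v i)).congr' ?_)
    filter_upwards [self_mem_nhdsWithin] with s hs
    exact (hco s hs i).symm
  · intro hw
    have h1 : ∀ s : ℝ, 0 < s → HasSum (fun i => ‖(((s⁻¹ : ℝ) : ℂ) * (Complex.exp (s * d i) - 1) - d i)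
        * b.repr v i‖ ^ 2) (‖((s⁻¹ : ℝ) : ℂ) • (diagSemigroup b d s v - v) - w‖ ^ 2) := by
      intro s hs
      have := hasSum_norm_sq_repr b (((s⁻¹ : ℝ) : ℂ) • (diagSemigroup b d s v - v) - w)
      refine this.congr_fun ?_
      intro i
      rw [map_sub, lp.coeFn_sub, Pi.sub_apply, hco s hs, hw, ← sub_mul]
    have h2 : Tendsto (fun s : ℝ => ‖((s⁻¹ : ℝ) : ℂ) • (diagSemigroup b d s v - v) - w‖ ^ 2)
        (𝓝[>] 0) (𝓝 0) := by
      have h3 : Tendsto (fun s : ℝ => ∑' i, ‖(((s⁻¹ : ℝ) : ℂ) * (Complex.exp (s * d i) - 1) - d i)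
        * b.repr v i‖ ^ 2) (𝓝[>] 0) (𝓝 (∑' _ : ι, (0 : ℝ))) := by
        refine tendsto_tsum_of_dominated_convergence (bound := fun i => 4 * ‖b.repr w i‖ ^ 2)
          ((hasSum_norm_sq_repr b w).summable.mul_left 4) (fun i => ?_) ?_
        · have := ((((hlim i).sub_const (d i)).mul_const (b.repr v i)).norm.pow 2)
          simpa using this
        · filter_upwards [self_mem_nhdsWithin] with s hs i
          have hs' : (0 : ℝ) < s := hs
          rw [norm_pow, norm_norm, hw, norm_mul, norm_mul, mul_pow, mul_pow, ← mul_assoc]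
          gcongr
          have h4 : ‖((s⁻¹ : ℝ) : ℂ) * (Complex.exp (s * d i) - 1)‖ ≤ ‖d i‖ := by
            have h5 := norm_exp_sub_exp_le (z := s * d i) (w := 0)
              (by rw [Complex.re_ofReal_mul]; exact mul_nonpos_of_nonneg_of_nonpos hs'.le (hd i))
              (by simp)
            rw [Complex.exp_zero, sub_zero, norm_mul, Complex.norm_real,
              Real.norm_of_nonneg hs'.le] at h5
            rw [norm_mul, Complex.norm_real, Real.norm_of_nonneg (inv_nonneg.2 hs'.le)]
            rwa [inv_mul_le_iff₀ hs']
          have h6 := (norm_sub_le (((s⁻¹ : ℝ) : ℂ) * (Complex.exp (s * d i) - 1)) (d i)).trans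
            (add_le_add_left h4 _)
          calc _ ≤ (‖d i‖ + ‖d i‖) ^ 2 := by gcongr
            _ = _ := by ring
      rw [tsum_zero] at h3
      refine h3.congr' ?_
      filter_upwards [self_mem_nhdsWithin] with s hs
      exact (h1 s hs).tsum_eq
    rw [tendsto_iff_norm_sub_tendsto_zero]
    simpa using h2.sqrt

namespace IsDuhamel

/-- A solution of the variation of constants equation is the semigroup generated by `D + B`. -/
theorem isSemigroupGeneratedBy [CompleteSpace H] (hd : ∀ i, (d i).re ≤ 0)
    (h : IsDuhamel b d B T) : IsSemigroupGeneratedBy (perturbedDiag b d B) T where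
  zero := h.zero hd
  add s t hs ht := by
    ext v
    exact h.add_apply hd hs ht v
  continuousOn v := (h.continuous v).continuousOn
  generator v w := by
    -- The Duhamel term of the difference quotient converges to `B v` for every `v`. Hence the
    -- quotient of `T` converges exactly when that of the diagonal semigroup does, and `D + B` has
    -- the domain of `D`.
    have h1 := h.tendsto_inv_smul_integral hd v
    have h2 : ∀ s : ℝ, 0 < s → ((s⁻¹ : ℝ) : ℂ) • (T s v - v) =
        ((s⁻¹ : ℝ) : ℂ) • (diagSemigroup b d s v - v) +
        ((s⁻¹ : ℝ) : ℂ) • ∫ r in (0 : ℝ)..s, diagSemigroup b d (s - r) (B (T r v)) := by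
      intro s hs
      rw [h.eq s hs.le v, ← smul_add]
      congr 1
      abel
    have h3 : perturbedDiag b d B v w ↔ ∀ i, b.repr (w - B v) i = d i * b.repr v i := by
      refine forall_congr' fun i => ?_
      rw [map_sub, lp.coeFn_sub, Pi.sub_apply, sub_eq_iff_eq_add]
    rw [h3, ← tendsto_diagSemigroup_iff hd]
    constructor
    · intro h4
      have h5 := h4.add h1
      rw [sub_add_cancel] at h5
      refine h5.congr' ?_
      filter_upwards [self_mem_nhdsWithin] with s hs using (h2 s hs).symm
    · intro h4
      refine (h4.sub h1).congr' ?_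
      filter_upwards [self_mem_nhdsWithin] with s hs
      rw [h2 s hs, add_sub_cancel_right]

end IsDuhamel

end Generator

/-! ### Uniqueness, dependence on the diagonal, compactness and smoothing -/

section Estimates

variable {ι H : Type*} [NormedAddCommGroup H] [InnerProductSpace ℂ H]
  {b : HilbertBasis ι ℂ H} {d d' : ι → ℂ} {B : H →L[ℂ] H} {T T' : ℝ → H →L[ℂ] H}

theorem IsSemigroupGeneratedBy.map_generator {X : Type*} [NormedAddCommGroup X] [NormedSpace ℂ X]
    {A : X → X → Prop} {T : ℝ → X →L[ℂ] X} (h : IsSemigroupGeneratedBy A T) {v w : X} (hv : A v w)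
    {s : ℝ} (hs : 0 ≤ s) : A (T s v) (T s w) := by
  rw [h.generator] at hv ⊢
  refine (((T s).continuous.tendsto w).comp hv).congr' ?_
  filter_upwards [self_mem_nhdsWithin] with r hr
  have hr' : (0 : ℝ) ≤ r := le_of_lt hr
  have e : T r (T s v) = T s (T r v) := by
    rw [← ContinuousLinearMap.comp_apply, ← h.add r s hr' hs, add_comm, h.add s r hs hr',
      ContinuousLinearMap.comp_apply]
  simp [e]

theorem IsSemigroupGeneratedBy.hasDerivWithinAt {X : Type*} [NormedAddCommGroup X]
    [NormedSpace ℂ X] {A : X → X → Prop} {T : ℝ → X →L[ℂ] X} (h : IsSemigroupGeneratedBy A T)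
    {v w : X} (hv : A v w) {s : ℝ} (hs : 0 ≤ s) :
    HasDerivWithinAt (fun t => T t v) (T s w) (Ici s) s := by
  have h1 := h.map_generator hv hs
  rw [h.generator] at h1
  rw [← hasDerivWithinAt_Ioi_iff_Ici, hasDerivWithinAt_iff_tendsto_slope' (by simp)]
  have h2 : Tendsto (fun r : ℝ => r - s) (𝓝[>] s) (𝓝[>] 0) := by
    refine tendsto_nhdsWithin_iff.2 ⟨?_, ?_⟩
    · have : Tendsto (fun r : ℝ => r - s) (𝓝 s) (𝓝 (s - s)) :=
        (continuous_id.sub continuous_const).tendsto s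
      rw [sub_self] at this
      exact this.mono_left nhdsWithin_le_nhds
    · filter_upwards [self_mem_nhdsWithin] with r hr
      exact sub_pos.2 (mem_Ioi.1 hr)
  refine (h1.comp h2).congr' ?_
  filter_upwards [self_mem_nhdsWithin] with r hr
  have hr' : s ≤ r := le_of_lt hr
  have e : T (r - s) (T s v) = T r v := by
    rw [← ContinuousLinearMap.comp_apply, ← h.add _ s (sub_nonneg.2 hr') hs, sub_add_cancel]
  simp only [Function.comp_apply, e, slope_def_module]
  exact Complex.coe_smul _ _

/-- The diagonal part is dissipative, as each of its coefficients contributes `Re d i` times a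
square; only `B` can make the energy grow. -/
theorem re_inner_le_of_perturbedDiag (hd : ∀ i, (d i).re ≤ 0) {v w : H}
    (h : perturbedDiag b d B v w) : (inner ℂ v w).re ≤ ‖B‖ * ‖v‖ ^ 2 := by
  have h1 : HasSum (fun i => inner ℂ (b.repr v i) (b.repr (w - B v) i)) (inner ℂ v (w - B v)) := by
    rw [← b.repr.inner_map_map]
    exact lp.hasSum_inner _ _
  have h2 := Complex.hasSum_re h1
  have h3 : (inner ℂ v (w - B v)).re ≤ 0 := by
    refine h2.nonpos fun i => ?_
    rw [map_sub, lp.coeFn_sub, Pi.sub_apply, h i, add_sub_cancel_right, RCLike.inner_apply,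
      mul_assoc, RCLike.mul_conj]
    have : (d i * (‖b.repr v i‖ : ℂ) ^ 2).re = (d i).re * ‖b.repr v i‖ ^ 2 := by
      rw [← Complex.ofReal_pow, Complex.re_mul_ofReal]
    exact this.trans_le (mul_nonpos_of_nonpos_of_nonneg (hd i) (by positivity))
  rw [inner_sub_right, Complex.sub_re] at h3
  have h4 : (inner ℂ v (B v)).re ≤ ‖v‖ * (‖B‖ * ‖v‖) :=
    (Complex.re_le_norm _).trans ((norm_inner_le_norm _ _).trans (by gcongr; exact B.le_opNorm v))
  nlinarith

theorem perturbedDiag_sub {v w v' w' : H} (h : perturbedDiag b d B v w)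
    (h' : perturbedDiag b d B v' w') : perturbedDiag b d B (v - v') (w - w') := fun i => by
  simp only [map_sub, lp.coeFn_sub, Pi.sub_apply, h i, h' i]
  ring

theorem hasDerivWithinAt_norm_sq {w : ℝ → H} {w' : H} {s : Set ℝ} {t : ℝ}
    (h : HasDerivWithinAt w w' s t) :
    HasDerivWithinAt (fun t => ‖w t‖ ^ 2) (2 * (inner ℂ (w t) w').re) s t := by
  let _ : InnerProductSpace ℝ H := InnerProductSpace.complexToReal
  exact h.norm_sq

/-- A semigroup is determined by its generator. -/
theorem IsSemigroupGeneratedBy.eq_of_perturbedDiag (hd : ∀ i, (d i).re ≤ 0)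
    (h : IsSemigroupGeneratedBy (perturbedDiag b d B) T)
    (h' : IsSemigroupGeneratedBy (perturbedDiag b d B) T') {t : ℝ} (ht : 0 ≤ t) : T t = T' t := by
  -- Basis vectors lie in the domain and span a dense subspace. On them the squared norm of the
  -- difference vanishes at time zero and satisfies `y' ≤ 2‖B‖ y`.
  refine ContinuousLinearMap.ext_on (s := range b) ?_ ?_
  · exact Submodule.dense_iff_topologicalClosure_eq_top.2 b.dense_span
  rintro _ ⟨i, rfl⟩
  have hv : perturbedDiag b d B (b i) (d i • b i + B (b i)) := by
    classical
    intro j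
    simp only [map_add, map_smul, lp.coeFn_add, lp.coeFn_smul, Pi.add_apply, Pi.smul_apply,
      b.repr_self, lp.single_apply, smul_eq_mul]
    rcases eq_or_ne j i with rfl | hj
    · simp
    · simp [Pi.single_eq_of_ne hj]
  set w := d i • b i + B (b i)
  have hderiv : ∀ s ∈ Ico 0 t, HasDerivWithinAt (fun s => ‖T s (b i) - T' s (b i)‖ ^ 2)
      (2 * (inner ℂ (T s (b i) - T' s (b i)) (T s w - T' s w)).re) (Ici s) s := fun s hs =>
    hasDerivWithinAt_norm_sq ((h.hasDerivWithinAt hv hs.1).sub (h'.hasDerivWithinAt hv hs.1))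
  have key := le_gronwallBound_of_liminf_deriv_right_le
    (f := fun s => ‖T s (b i) - T' s (b i)‖ ^ 2)
    (f' := fun s => 2 * (inner ℂ (T s (b i) - T' s (b i)) (T s w - T' s w)).re) (δ := 0)
    (K := 2 * ‖B‖) (ε := 0) (a := 0) (b := t)
    ((((h.continuousOn _).sub (h'.continuousOn _)).norm.pow 2).mono Icc_subset_Ici_self)
    (fun s hs r hr => (hderiv s hs).liminf_right_slope_le hr)
    (by simp [h.zero, h'.zero]) (fun s hs => by
      rw [add_zero, mul_assoc]
      have := re_inner_le_of_perturbedDiag hd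
        (perturbedDiag_sub (h.map_generator hv hs.1) (h'.map_generator hv hs.1))
      exact mul_le_mul_of_nonneg_left this zero_le_two) t ⟨ht, le_rfl⟩
  rw [gronwallBound_ε0_δ0] at key
  have h0 : ‖T t (b i) - T' t (b i)‖ = 0 := by nlinarith [norm_nonneg (T t (b i) - T' t (b i))]
  exact sub_eq_zero.1 (norm_eq_zero.1 h0)

namespace IsDuhamel

/-- The parameter `δ` controls the difference of the free semigroups, which enters both the initial
term and the Duhamel integrand; the remaining term contains the difference itself and is absorbed by
Grönwall. This yields continuity in the Floquet exponent. -/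
theorem norm_sub_le (hd : ∀ i, (d i).re ≤ 0) (hd' : ∀ i, (d' i).re ≤ 0)
    (h : IsDuhamel b d B T) (h' : IsDuhamel b d' B T') {δ τ : ℝ} (hδ : 0 ≤ δ) (hτ : 0 ≤ τ)
    (hdd : ∀ t ∈ Icc 0 τ, ∀ i, ‖Complex.exp (t * d i) - Complex.exp (t * d' i)‖ ≤ δ) :
    ‖T τ - T' τ‖ ≤ δ * ((1 + τ * (‖B‖ * Real.exp (‖B‖ * τ))) * Real.exp (‖B‖ * τ)) := by
  refine ContinuousLinearMap.opNorm_le_bound _ (by positivity) fun v => ?_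
  have hS : ∀ t ∈ Icc 0 τ, ∀ x, ‖diagSemigroup b d t x - diagSemigroup b d' t x‖ ≤ δ * ‖x‖ := by
    intro t ht x
    refine norm_diagOp_sub_apply_le b hδ (norm_exp_mul_le_one hd t) (norm_exp_mul_le_one hd' t)
      (fun i => ?_) x
    rw [max_eq_left ht.1]
    exact hdd t ht i
  have hcv := h.continuous v
  have hcv' := h'.continuous v
  have hc := hcv.sub hcv'
  have key := le_mul_exp_of_le_add_integral (w := fun t => ‖T t v - T' t v‖)
    (α := δ * ‖v‖ + τ * (δ * (‖B‖ * (Real.exp (‖B‖ * τ) * ‖v‖)))) (norm_nonneg B)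
    hc.norm hτ fun t ht => by
      have e : T t v - T' t v = (diagSemigroup b d t v - diagSemigroup b d' t v) +
          (∫ s in (0 : ℝ)..t, (diagSemigroup b d (t - s) (B (T s v)) -
            diagSemigroup b d' (t - s) (B (T s v)))) +
          ∫ s in (0 : ℝ)..t, diagSemigroup b d' (t - s) (B (T s v - T' s v)) := by
        rw [h.eq t ht.1 v, h'.eq t ht.1 v, intervalIntegral.integral_sub
          ((continuous_diagSemigroup_sub hd B hcv t).intervalIntegrable _ _)
          ((continuous_diagSemigroup_sub hd' B hcv t).intervalIntegrable _ _)]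
        simp_rw [map_sub]
        rw [intervalIntegral.integral_sub
          ((continuous_diagSemigroup_sub hd' B hcv t).intervalIntegrable _ _)
          ((continuous_diagSemigroup_sub hd' B hcv' t).intervalIntegrable _ _)]
        abel
      rw [e, ← intervalIntegral.integral_const_mul]
      refine (norm_add₃_le).trans (add_le_add (add_le_add (hS t ht v) ?_) ?_)
      · have h1 : ‖∫ s in (0 : ℝ)..t, (diagSemigroup b d (t - s) (B (T s v)) -
            diagSemigroup b d' (t - s) (B (T s v)))‖ ≤
            δ * (‖B‖ * (Real.exp (‖B‖ * τ) * ‖v‖)) * |t - 0| := by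
          refine intervalIntegral.norm_integral_le_of_norm_le_const fun s hs => ?_
          rw [uIoc_of_le ht.1] at hs
          refine (hS (t - s) ⟨by linarith [hs.2], by linarith [hs.1, ht.2]⟩ _).trans ?_
          gcongr
          refine (B.le_opNorm _).trans ?_
          gcongr
          refine (h.norm_apply_le hd hs.1.le v).trans ?_
          gcongr
          linarith [hs.2, ht.2]
        rw [sub_zero, abs_of_nonneg ht.1, mul_comm] at h1
        refine h1.trans ?_
        gcongr
        exact ht.2
      · refine intervalIntegral.norm_integral_le_of_norm_le ht.1
          (Eventually.of_forall fun q _ => ?_) ((hc.norm.const_mul _).intervalIntegrable _ _)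
        exact (norm_diagSemigroup_le b hd' _ _).trans (B.le_opNorm _)
  refine key.trans (le_of_eq ?_)
  ring

/-- The semigroup consists of compact operators if the real parts of the diagonal entries tend
to `-∞`. -/
theorem isCompactOperator [CompleteSpace H] (hd : ∀ i, (d i).re ≤ 0)
    (hfin : ∀ κ : ℝ, {i | -κ < (d i).re}.Finite) (h : IsDuhamel b d B T) {t : ℝ} (ht : 0 < t) :
    IsCompactOperator (T t) := by
  classical
  refine isCompactOperator_of_tail_small b _ fun ε hε => ?_
  set M := ‖B‖ * Real.exp (‖B‖ * t) with hM
  -- On the modes with `Re d ≤ -κ` the free term is at most `e^{-κt}`, and the Duhamel integral at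
  -- most `M ∫ e^{-κ(t-s)} ds ≤ M / κ`. Both are small for large `κ`, and only finitely many modes
  -- are left out.
  have hlim : Tendsto (fun κ : ℝ => Real.exp (-κ * t) + 1 / κ * M) atTop (𝓝 (0 + 0 * M)) := by
    refine Tendsto.add ?_ (Tendsto.mul_const _ ?_)
    · refine Real.tendsto_exp_atBot.comp ?_
      simp only [neg_mul]
      exact tendsto_neg_atTop_atBot.comp (tendsto_id.atTop_mul_const ht)
    · exact (tendsto_inv_atTop_zero (𝕜 := ℝ)).congr fun x => (one_div x).symm
  rw [zero_mul, add_zero] at hlim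
  obtain ⟨κ, hκε, hκ⟩ := ((hlim.eventually (ge_mem_nhds hε)).and (eventually_gt_atTop 0)).exists
  refine ⟨(hfin κ).toFinset, _, hκε, by positivity, fun v w hw hw' => ?_⟩
  let m : ι → ℂ := fun i => if i ∈ (hfin κ).toFinset then 0 else 1
  have hm : ∀ i, ‖m i‖ ≤ 1 := fun i => by simp only [m]; split_ifs <;> simp
  have hwm : w = diagOp b m (T t v) := by
    refine ext_repr b fun i => ?_
    rw [repr_diagOp b hm]
    by_cases hi : i ∈ (hfin κ).toFinset
    · rw [hw i hi]; simp only [m, if_pos hi, zero_mul]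
    · rw [hw' i hi]; simp only [m, if_neg hi, one_mul]
  have hS : ∀ s, 0 ≤ s → ∀ x, ‖diagOp b m (diagSemigroup b d s x)‖ ≤ Real.exp (-κ * s) * ‖x‖ := by
    intro s hs x
    refine norm_le_of_repr_le b (Real.exp_nonneg _) fun i => ?_
    rw [repr_diagOp b hm, repr_diagSemigroup b hd hs, ← mul_assoc, norm_mul]
    gcongr
    by_cases hi : i ∈ (hfin κ).toFinset
    · simp only [m, if_pos hi, zero_mul, norm_zero]; positivity
    · simp only [m, if_neg hi, one_mul, Complex.norm_exp, Complex.re_ofReal_mul]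
      rw [Real.exp_le_exp, mul_comm]
      have : (d i).re ≤ -κ := by simpa using hi
      gcongr
  have hcont := continuous_diagSemigroup_sub (b := b) hd B (h.continuous v) t
  rw [hwm, h.eq t ht.le v, map_add, ← ContinuousLinearMap.intervalIntegral_comp_comm _
        (hcont.intervalIntegrable _ _), add_mul]
  refine (norm_add_le _ _).trans (add_le_add (hS t ht.le v) ?_)
  have h1 : ‖∫ s in (0 : ℝ)..t, diagOp b m (diagSemigroup b d (t - s) (B (T s v)))‖ ≤
      ∫ s in (0 : ℝ)..t, Real.exp (-κ * (t - s)) * (M * ‖v‖) := by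
    refine intervalIntegral.norm_integral_le_of_norm_le ht.le (Eventually.of_forall fun s hs => ?_)
      (by apply Continuous.intervalIntegrable; fun_prop)
    refine (hS (t - s) (by linarith [hs.2]) _).trans ?_
    gcongr
    refine (B.le_opNorm _).trans ?_
    rw [hM, mul_assoc]
    gcongr
    refine (h.norm_apply_le hd hs.1.le v).trans ?_
    gcongr
    exact hs.2
  rw [intervalIntegral.integral_mul_const] at h1
  refine h1.trans ?_
  rw [mul_assoc (1 / κ)]
  exact mul_le_mul_of_nonneg_right (integral_exp_neg_mul_sub_le hκ t)
    (by positivity : 0 ≤ M * ‖v‖)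

/-- Smoothing from `ℓ²` to `ℓ¹` of the coefficients. -/
theorem sum_norm_repr_le [CompleteSpace H] (hd : ∀ i, (d i).re ≤ 0) {C : ℝ} (hC : 0 ≤ C)
    (hC' : ∀ t ∈ Ioc (0 : ℝ) 1, ∀ s : Finset ι,
      ∑ i ∈ s, Real.exp (2 * t * (d i).re) ≤ (C * t ^ (-(1 / 4 : ℝ))) ^ 2)
    (h : IsDuhamel b d B T) {t : ℝ} (ht : t ∈ Ioc (0 : ℝ) 1) (s : Finset ι) (v : H) :
    ∑ i ∈ s, ‖b.repr (T t v) i‖ ≤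
      C * (1 + 2 * (‖B‖ * Real.exp ‖B‖)) * t ^ (-(1 / 4 : ℝ)) * ‖v‖ := by
  -- The free smoothing estimate is Cauchy–Schwarz against the weights `e^{r Re d}`.
  have hS : ∀ r ∈ Ioc (0 : ℝ) 1, ∀ x, ∑ i ∈ s, ‖b.repr (diagSemigroup b d r x) i‖ ≤
      C * r ^ (-(1 / 4 : ℝ)) * ‖x‖ := by
    intro r hr x
    have h1 : ∑ i ∈ s, ‖b.repr (diagSemigroup b d r x) i‖ =
        ∑ i ∈ s, Real.exp (r * (d i).re) * ‖b.repr x i‖ := by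
      refine Finset.sum_congr rfl fun i _ => ?_
      rw [repr_diagSemigroup b hd hr.1.le, norm_mul, Complex.norm_exp, Complex.re_ofReal_mul]
    rw [h1]
    refine abs_le_of_sq_le_sq' ?_ (by have := hr.1; positivity) |>.2
    refine (Finset.sum_mul_sq_le_sq_mul_sq s _ _).trans ?_
    rw [mul_pow (C * _)]
    gcongr
    · refine le_trans (le_of_eq ?_) (hC' r hr s)
      refine Finset.sum_congr rfl fun i _ => ?_
      rw [← Real.exp_nat_mul]
      congr 1
      push_cast
      ring
    · exact sum_le_hasSum s (fun i _ => by positivity) (hasSum_norm_sq_repr b x)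
  have hcont := continuous_diagSemigroup_sub (b := b) hd B (h.continuous v) t
  set M := ‖B‖ * Real.exp ‖B‖ with hM
  have hcoef : ∀ i, Continuous fun x : H => b.repr x i := fun i => by
    simp only [b.repr_apply_apply]
    exact continuous_const.inner continuous_id
  have hint : ∀ i, ‖b.repr (∫ r in (0 : ℝ)..t, diagSemigroup b d (t - r) (B (T r v))) i‖ ≤
      ∫ r in (0 : ℝ)..t, ‖b.repr (diagSemigroup b d (t - r) (B (T r v))) i‖ := by
    intro i
    have h1 := ContinuousLinearMap.intervalIntegral_comp_comm (μ := volume) (innerSL ℂ (b i))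
      (hcont.intervalIntegrable 0 t)
    simp only [innerSL_apply_apply] at h1
    simp only [b.repr_apply_apply]
    rw [← h1]
    exact intervalIntegral.norm_integral_le_integral_norm ht.1.le
  have hcr : ∀ i, Continuous fun r => ‖b.repr (diagSemigroup b d (t - r) (B (T r v))) i‖ :=
    fun i => ((hcoef i).comp hcont).norm
  have h2 : ∑ i ∈ s, ‖b.repr (∫ r in (0 : ℝ)..t, diagSemigroup b d (t - r) (B (T r v))) i‖ ≤
      ∫ r in (0 : ℝ)..t, C * (t - r) ^ (-(1 / 4 : ℝ)) * (M * ‖v‖) := by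
    refine (Finset.sum_le_sum fun i _ => hint i).trans ?_
    refine (intervalIntegral.integral_finsetSum fun i _ =>
      (hcr i).intervalIntegrable 0 t).symm.trans_le ?_
    refine intervalIntegral.integral_mono_on_of_le_Ioo ht.1.le ?_ ?_ fun r hr => ?_
    · exact (continuous_finsetSum s fun i _ => hcr i).intervalIntegrable _ _
    · refine IntervalIntegrable.mul_const (IntervalIntegrable.const_mul ?_ C) _
      have := (intervalIntegral.intervalIntegrable_rpow' (a := t) (b := 0)
        (r := -(1 / 4 : ℝ)) (by norm_num)).comp_sub_left t
      simpa using this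
    · refine (hS (t - r) ⟨by linarith [hr.2], by linarith [hr.1, ht.2]⟩ _).trans ?_
      have : 0 ≤ t - r := by linarith [hr.2]
      gcongr
      refine (B.le_opNorm _).trans ?_
      rw [hM, mul_assoc]
      gcongr
      refine (h.norm_apply_le hd hr.1.le v).trans ?_
      gcongr
      nlinarith [norm_nonneg B, hr.2, ht.2]
  have h3 : ∫ r in (0 : ℝ)..t, C * (t - r) ^ (-(1 / 4 : ℝ)) * (M * ‖v‖) ≤
      C * (2 * M) * t ^ (-(1 / 4 : ℝ)) * ‖v‖ := by
    rw [intervalIntegral.integral_mul_const, intervalIntegral.integral_const_mul,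
      intervalIntegral.integral_comp_sub_left (fun r => r ^ (-(1 / 4 : ℝ))) t, sub_self, sub_zero,
      integral_rpow (Or.inl (by norm_num)), Real.zero_rpow (by norm_num), sub_zero]
    -- The singularity `(t-r)^{-1/4}` is integrable, with integral `(4/3) t^{3/4}`. Since `t ≤ 1`,
    -- this is at most `2 t^{-1/4}`, the rate of the free term.
    have h4 : t ^ (-(1 / 4 : ℝ) + 1) / (-(1 / 4 : ℝ) + 1) ≤ 2 * t ^ (-(1 / 4 : ℝ)) := by
      rw [div_le_iff₀ (by norm_num)]
      have := Real.rpow_le_rpow_of_exponent_ge ht.1 ht.2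
        (show -(1 / 4 : ℝ) ≤ -(1 / 4 : ℝ) + 1 by norm_num)
      have h5 : 0 ≤ t ^ (-(1 / 4 : ℝ)) := Real.rpow_nonneg ht.1.le _
      linarith
    calc _ ≤ C * (2 * t ^ (-(1 / 4 : ℝ))) * (M * ‖v‖) := by gcongr
      _ = _ := by ring
  rw [h.eq t ht.1.le v]
  calc _ ≤ ∑ i ∈ s, (‖b.repr (diagSemigroup b d t v) i‖ +
        ‖b.repr (∫ r in (0 : ℝ)..t, diagSemigroup b d (t - r) (B (T r v))) i‖) := by
        refine Finset.sum_le_sum fun i _ => ?_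
        rw [map_add, lp.coeFn_add, Pi.add_apply]
        exact norm_add_le _ _
    _ ≤ C * t ^ (-(1 / 4 : ℝ)) * ‖v‖ + C * (2 * M) * t ^ (-(1 / 4 : ℝ)) * ‖v‖ := by
        rw [Finset.sum_add_distrib]
        exact add_le_add (hS t ht v) (h2.trans h3)
    _ = _ := by ring

end IsDuhamel

end Estimates

/-! ### Idempotence of Riesz contour integrals -/

section Riesz

theorem circleIntegral_swap {E : Type*} [NormedAddCommGroup E] [NormedSpace ℂ E]
    {F : ℂ → ℂ → E} {r ρ : ℝ} (hr : 0 ≤ r) (hρ : 0 ≤ ρ)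
    (hF : ContinuousOn (Function.uncurry F) (Metric.sphere 0 r ×ˢ Metric.sphere 0 ρ)) :
    ∮ z in C(0, r), ∮ w in C(0, ρ), F z w = ∮ w in C(0, ρ), ∮ z in C(0, r), F z w := by
  have hc : Continuous (Function.uncurry fun θ φ : ℝ =>
      deriv (circleMap 0 r) θ • deriv (circleMap 0 ρ) φ • F (circleMap 0 r θ) (circleMap 0 ρ φ)) := by
    have h1 : Continuous fun p : ℝ × ℝ => F (circleMap 0 r p.1) (circleMap 0 ρ p.2) :=
      hF.comp_continuous (f := fun p : ℝ × ℝ => (circleMap 0 r p.1, circleMap 0 ρ p.2))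
        (by fun_prop)
        fun p => ⟨circleMap_mem_sphere 0 hr p.1, circleMap_mem_sphere 0 hρ p.2⟩
    simp only [deriv_circleMap]
    exact (((continuous_circleMap 0 r).comp continuous_fst).mul continuous_const).smul
      ((((continuous_circleMap 0 ρ).comp continuous_snd).mul continuous_const).smul h1)
  simp only [circleIntegral, ← intervalIntegral.integral_smul]
  rw [intervalIntegral_intervalIntegral_swap]
  · refine intervalIntegral.integral_congr fun φ _ => intervalIntegral.integral_congr fun θ _ => ?_
    exact smul_comm _ _ _
  · rw [uIoc_of_le Real.two_pi_pos.le]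
    exact (hc.continuousOn.integrableOn_compact (isCompact_Icc.prod isCompact_Icc)).mono_set
      (prod_mono Ioc_subset_Icc_self Ioc_subset_Icc_self)

/-- Provides the second, slightly larger contour needed to multiply two contour integrals without
meeting the singularity of `(ν - μ)⁻¹`. -/
theorem exists_annulus_subset {U : Set ℂ} (hU : IsOpen U) {r : ℝ} (hr : 0 < r)
    (hs : Metric.sphere 0 r ⊆ U) :
    ∃ ρ, r < ρ ∧ Metric.closedBall (0 : ℂ) ρ \ Metric.ball 0 r ⊆ U := by
  obtain ⟨δ, hδ, h⟩ := (isCompact_sphere (0 : ℂ) r).exists_thickening_subset_open hU hs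
  refine ⟨r + δ / 2, by linarith, fun z hz => h ?_⟩
  have h1 : ‖z‖ ≤ r + δ / 2 := by simpa using hz.1
  have h2 : r ≤ ‖z‖ := by simpa using hz.2
  have hz0 : ‖z‖ ≠ 0 := (hr.trans_le h2).ne'
  refine Metric.mem_thickening_iff.2 ⟨((r / ‖z‖ : ℝ) : ℂ) * z, ?_, ?_⟩
  · rw [mem_sphere_zero_iff_norm, norm_mul, Complex.norm_real, Real.norm_of_nonneg (by positivity)]
    field_simp
  · have : z - ((r / ‖z‖ : ℝ) : ℂ) * z = ((1 - r / ‖z‖ : ℝ) : ℂ) * z := by push_cast; ring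
    rw [dist_eq_norm, this, norm_mul, Complex.norm_real, Real.norm_of_nonneg
      (sub_nonneg.2 ((div_le_one (hr.trans_le h2)).2 h2)), sub_mul, one_mul, div_mul_cancel₀ _ hz0]
    linarith

/-- A contour integral of a solution of the resolvent identity is idempotent. -/
theorem circleIntegral_resolvent_mul_self {𝔸 : Type*} [NormedRing 𝔸] [NormedAlgebra ℂ 𝔸]
    [CompleteSpace 𝔸] {R : ℂ → 𝔸} {U : Set ℂ} (hU : IsOpen U) {r : ℝ} (hr : 0 < r)
    (hs : Metric.sphere 0 r ⊆ U) (hR : DifferentiableOn ℂ R U)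
    (hid : ∀ μ ∈ U, ∀ ν ∈ U, R μ - R ν = (ν - μ) • (R μ * R ν)) :
    ((2 * Real.pi * Complex.I)⁻¹ • ∮ μ in C(0, r), R μ) *
      ((2 * Real.pi * Complex.I)⁻¹ • ∮ μ in C(0, r), R μ) =
      (2 * Real.pi * Complex.I)⁻¹ • ∮ μ in C(0, r), R μ := by
  obtain ⟨ρ, hrρ, hρ⟩ := exists_annulus_subset hU hr hs
  have hρ0 : 0 < ρ := hr.trans hrρ
  have hsρ : Metric.sphere (0 : ℂ) ρ ⊆ U := fun z hz => hρ <| by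
    rw [mem_sphere_zero_iff_norm] at hz
    simp [hz, hrρ.le]
  set c : ℂ := (2 * Real.pi * Complex.I)⁻¹ with hc
  have hc0 : (2 * Real.pi * Complex.I : ℂ) ≠ 0 := Complex.two_pi_I_ne_zero
  have hRc := hR.continuousOn
  -- Cauchy's theorem on the annulus moves one of the two factors to the larger circle.
  have hcirc : ∮ μ in C(0, ρ), R μ = ∮ μ in C(0, r), R μ :=
    Complex.circleIntegral_eq_of_differentiable_on_annulus_off_countable hr hrρ.le countable_empty
      (hRc.mono hρ) fun z hz => hR.differentiableAt (hU.mem_nhds (hρ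
        ⟨Metric.ball_subset_closedBall hz.1.1, fun h => hz.1.2 (Metric.ball_subset_closedBall h)⟩))
  have hne : ∀ μ ∈ Metric.sphere (0 : ℂ) r, ∀ ν ∈ Metric.sphere (0 : ℂ) ρ, ν - μ ≠ 0 := by
    intro μ hμ ν hν h
    rw [mem_sphere_zero_iff_norm] at hμ hν
    rw [sub_eq_zero.1 h] at hν
    linarith
  have hIr : CircleIntegrable R 0 r := (hRc.mono hs).circleIntegrable hr.le
  have hIρ : CircleIntegrable R 0 ρ := (hRc.mono hsρ).circleIntegrable hρ0.le
  have hinvρ : ∀ μ ∈ Metric.sphere (0 : ℂ) r,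
      ContinuousOn (fun ν : ℂ => (ν - μ)⁻¹) (Metric.sphere 0 ρ) := fun μ hμ =>
    (continuousOn_id.sub continuousOn_const).inv₀ fun ν hν => hne μ hμ ν hν
  -- inner integrals
  have h1 : ∀ μ ∈ Metric.sphere (0 : ℂ) r, R μ * ∮ ν in C(0, ρ), R ν =
      (2 * Real.pi * Complex.I : ℂ) • R μ - ∮ ν in C(0, ρ), (ν - μ)⁻¹ • R ν := by
    intro μ hμ
    have e1 : R μ * ∮ ν in C(0, ρ), R ν = ∮ ν in C(0, ρ), R μ * R ν := by
      have := ContinuousLinearMap.intervalIntegral_comp_comm (μ := volume)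
        (ContinuousLinearMap.mul ℂ 𝔸 (R μ)) hIρ.out
      simp only [circleIntegral, ContinuousLinearMap.mul_apply', mul_smul_comm] at this ⊢
      exact this.symm
    have e2 : ∮ ν in C(0, ρ), R μ * R ν =
        ∮ ν in C(0, ρ), ((ν - μ)⁻¹ • R μ - (ν - μ)⁻¹ • R ν) := by
      refine circleIntegral.integral_congr hρ0.le fun ν hν => ?_
      rw [← smul_sub, hid μ (hs hμ) ν (hsρ hν), smul_smul, inv_mul_cancel₀ (hne μ hμ ν hν), one_smul]
    have hμb : μ ∈ Metric.ball (0 : ℂ) ρ := by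
      rw [mem_sphere_zero_iff_norm] at hμ
      rwa [mem_ball_zero_iff, hμ]
    rw [e1, e2, circleIntegral.integral_sub, circleIntegral.integral_smul_const,
      circleIntegral.integral_sub_inv_of_mem_ball hμb]
    · exact ((hinvρ μ hμ).smul continuousOn_const).circleIntegrable hρ0.le
    · exact ((hinvρ μ hμ).smul (hRc.mono hsρ)).circleIntegrable hρ0.le
  -- After exchanging the integrals, `μ ↦ (ν - μ)⁻¹` is holomorphic inside the small circle, because
  -- `ν` lies outside it.
  have h2 : ∮ μ in C(0, r), ∮ ν in C(0, ρ), (ν - μ)⁻¹ • R ν = 0 := by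
    rw [circleIntegral_swap hr.le hρ0.le]
    · rw [circleIntegral.integral_congr hρ0.le (g := fun _ => 0)]
      · simp [circleIntegral]
      intro ν hν
      simp only
      rw [circleIntegral.integral_smul_const]
      have : ∮ μ in C(0, r), (ν - μ)⁻¹ = 0 := by
        have hne' : ∀ μ ∈ Metric.closedBall (0 : ℂ) r, ν - μ ≠ 0 := by
          intro μ hμ h
          rw [mem_sphere_zero_iff_norm] at hν
          rw [mem_closedBall_zero_iff, ← sub_eq_zero.1 h, hν] at hμ
          linarith
        refine Complex.circleIntegral_eq_zero_of_differentiable_on_off_countable hr.le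
          countable_empty ((continuousOn_const.sub continuousOn_id).inv₀ hne') fun μ hμ => ?_
        exact ((differentiableAt_const _).sub differentiableAt_id).inv
          (hne' μ (Metric.ball_subset_closedBall hμ.1))
      rw [this, zero_smul]
    · refine ContinuousOn.smul ?_ ((hRc.mono hsρ).comp continuousOn_snd fun p hp => hp.2)
      exact (continuousOn_snd.sub continuousOn_fst).inv₀ fun p hp => hne _ hp.1 _ hp.2
  have h3 : (∮ μ in C(0, r), R μ) * ∮ ν in C(0, ρ), R ν =
      ∮ μ in C(0, r), R μ * ∮ ν in C(0, ρ), R ν := by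
    have := ContinuousLinearMap.intervalIntegral_comp_comm (μ := volume)
      ((ContinuousLinearMap.mul ℂ 𝔸).flip (∮ ν in C(0, ρ), R ν)) hIr.out
    simp only [circleIntegral, ContinuousLinearMap.flip_apply, ContinuousLinearMap.mul_apply',
      smul_mul_assoc] at this ⊢
    exact this.symm
  have h4 : (∮ μ in C(0, r), R μ) * (∮ ν in C(0, r), R ν) =
      (2 * Real.pi * Complex.I : ℂ) • ∮ μ in C(0, r), R μ := by
    nth_rw 2 [← hcirc]
    rw [h3, circleIntegral.integral_congr hr.le h1, circleIntegral.integral_sub, h2, sub_zero,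
      circleIntegral.integral_smul]
    · exact (continuousOn_const.smul (hRc.mono hs)).circleIntegrable hr.le
    · have hcc : ContinuousOn (fun μ => R μ * ∮ ν in C(0, ρ), R ν) (Metric.sphere 0 r) :=
        (hRc.mono hs).mul continuousOn_const
      refine ContinuousOn.circleIntegrable hr.le (((continuousOn_const.smul (hRc.mono hs)).sub
        hcc).congr (f := fun μ => (2 * Real.pi * Complex.I : ℂ) • R μ - R μ * ∮ ν in C(0, ρ), R ν)
        fun μ hμ => ?_)
      simp only [h1 μ hμ, sub_sub_cancel]
  rw [smul_mul_smul_comm, h4, smul_smul, mul_assoc, hc, inv_mul_cancel₀ hc0, mul_one]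

end Riesz

/-! ### Resolvents, eigenvectors and commutation with the semigroup -/

section Resolvent

variable {H : Type*} [NormedAddCommGroup H] [NormedSpace ℂ H] {A : H → H → Prop}

theorem IsResolventAt.unique {μ : ℂ} {R R' : H →L[ℂ] H} (h : IsResolventAt A μ R)
    (h' : IsResolventAt A μ R') : R = R' := by
  ext w
  exact (h (R' w) w).2 ((h' (R' w) w).1 rfl)

theorem IsResolventAt.opResolvent_eq {μ : ℂ} {R : H →L[ℂ] H} (h : IsResolventAt A μ R) :
    opResolvent A μ = R := by
  have h' : ∃ R, IsResolventAt A μ R := ⟨R, h⟩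
  rw [opResolvent, dif_pos h']
  exact h'.choose_spec.unique h

theorem isResolventAt_opResolvent {μ : ℂ} (h : μ ∉ opSpectrum A) :
    IsResolventAt A μ (opResolvent A μ) := by
  obtain ⟨R, hR⟩ := not_not.1 h
  rwa [hR.opResolvent_eq]

theorem mem_opSpectrum_of_eigenvector {μ : ℂ} {v : H} (hv : v ≠ 0) (h : A v (μ • v)) :
    μ ∈ opSpectrum A := by
  rintro ⟨R, hR⟩
  exact hv (((hR v 0).2 (by rwa [sub_zero])).symm.trans (map_zero R))

theorem IsResolventAt.apply_eigenvector {μ ν : ℂ} {v : H} {R : H →L[ℂ] H}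
    (hR : IsResolventAt A μ R) (hμν : μ ≠ ν) (h : A v (ν • v)) : R v = (μ - ν)⁻¹ • v := by
  have h1 : R ((μ - ν) • v) = v := (hR v _).2 (by rwa [sub_smul, sub_sub_cancel])
  rw [map_smul] at h1
  rw [← h1, smul_smul, inv_mul_cancel₀ (sub_ne_zero.2 hμν), one_smul, h1]

theorem IsResolventAt.commute_semigroup {T : ℝ → H →L[ℂ] H} (hT : IsSemigroupGeneratedBy A T)
    {μ : ℂ} {R : H →L[ℂ] H} (hR : IsResolventAt A μ R) {t : ℝ} (ht : 0 ≤ t) :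
    Commute R (T t) := by
  ext w
  refine (hR _ _).2 ?_
  have := hT.map_generator ((hR (R w) w).1 rfl) ht
  rwa [map_sub, map_smul] at this

theorem commute_totalEigenprojection [CompleteSpace H] {r : ℝ} (hr : 0 ≤ r)
    (hs : ContinuousOn (opResolvent A) (Metric.sphere 0 r)) {T : H →L[ℂ] H}
    (hT : ∀ μ ∈ Metric.sphere (0 : ℂ) r, Commute (opResolvent A μ) T) :
    Commute (totalEigenprojection A r) T := by
  refine Commute.smul_left ?_ _
  have hI : CircleIntegrable (opResolvent A) 0 r := hs.circleIntegrable hr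
  have h1 := ContinuousLinearMap.intervalIntegral_comp_comm (μ := volume)
      (ContinuousLinearMap.mul ℂ (H →L[ℂ] H) T) hI.out
  have h2 := ContinuousLinearMap.intervalIntegral_comp_comm (μ := volume)
      ((ContinuousLinearMap.mul ℂ (H →L[ℂ] H)).flip T) hI.out
  simp only [ContinuousLinearMap.flip_apply, ContinuousLinearMap.mul_apply',
    smul_mul_assoc, mul_smul_comm] at h1 h2
  rw [commute_iff_eq, circleIntegral, ← h1, ← h2]
  refine intervalIntegral.integral_congr fun θ _ => ?_
  rw [(hT _ (circleMap_mem_sphere 0 hr θ)).eq]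

/-- On the kernel the resolvent acts as `μ⁻¹`, whose residue at `0` is one. -/
theorem totalEigenprojection_apply_of_mem_ker [CompleteSpace H] {r : ℝ} (hr : 0 < r)
    (hs : ContinuousOn (opResolvent A) (Metric.sphere 0 r))
    (hρ : ∀ μ ∈ Metric.sphere (0 : ℂ) r, μ ∉ opSpectrum A) {v : H} (hv : A v 0) :
    totalEigenprojection A r v = v := by
  have hI : CircleIntegrable (opResolvent A) 0 r := hs.circleIntegrable hr.le
  have h1 := ContinuousLinearMap.intervalIntegral_comp_comm (μ := volume)
      (ContinuousLinearMap.apply ℂ H v) hI.out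
  simp only [ContinuousLinearMap.apply_apply, smul_apply] at h1
  have h2 : ∮ μ in C(0, r), opResolvent A μ v = ∮ μ in C(0, r), (μ - 0)⁻¹ • v := by
    refine circleIntegral.integral_congr hr.le fun μ hμ => ?_
    refine (isResolventAt_opResolvent (hρ μ hμ)).apply_eigenvector ?_ (by rwa [zero_smul])
    rintro rfl
    simp [hr.ne] at hμ
  rw [totalEigenprojection, smul_apply, circleIntegral, ← h1]
  change _ • ∮ μ in C(0, r), opResolvent A μ v = v
  rw [h2, circleIntegral.integral_smul_const, circleIntegral.integral_sub_center_inv 0 hr.ne',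
    smul_smul, inv_mul_cancel₀ Complex.two_pi_I_ne_zero, one_smul]

theorem opResolvent_sub {μ ν : ℂ} (hμ : μ ∉ opSpectrum A) (hν : ν ∉ opSpectrum A) :
    opResolvent A μ - opResolvent A ν = (ν - μ) • (opResolvent A μ * opResolvent A ν) := by
  have h1 := isResolventAt_opResolvent hμ
  have h2 := isResolventAt_opResolvent hν
  ext w
  set R := opResolvent A μ
  set R' := opResolvent A ν
  have h4 : R (w + (μ - ν) • R' w) = R' w := by
    refine (h1 _ _).2 ?_
    have := (h2 (R' w) w).1 rfl
    convert this using 1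
    module
  rw [map_add, map_smul] at h4
  simp only [sub_apply, smul_apply, mul_apply_eq_comp]
  rw [eq_sub_of_add_eq h4]
  module

end Resolvent

/-! ### Spectral theory through a bounded operator pencil -/

section Pencil

variable {ι H : Type*} [NormedAddCommGroup H] [InnerProductSpace ℂ H]
  {b : HilbertBasis ι ℂ H} {d : ι → ℂ} {B : H →L[ℂ] H}

/-- The resolvent `(1 - D)⁻¹` of the diagonal operator with entries `d`. -/
def diagResolvent (b : HilbertBasis ι ℂ H) (d : ι → ℂ) : H →L[ℂ] H :=
  diagOp b fun i => (1 - d i)⁻¹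

/-- The bounded operator `(μ - D - B) (1 - D)⁻¹`. -/
def pencil (b : HilbertBasis ι ℂ H) (d : ι → ℂ) (B : H →L[ℂ] H) (μ : ℂ) : H →L[ℂ] H :=
  1 - (B + (1 - μ) • 1) * diagResolvent b d

theorem one_le_norm_one_sub {z : ℂ} (hz : z.re ≤ 0) : 1 ≤ ‖1 - z‖ := by
  have := (1 - z).re_le_norm
  rw [Complex.sub_re, Complex.one_re] at this
  linarith

theorem one_sub_ne_zero_of_re_nonpos {z : ℂ} (hz : z.re ≤ 0) : 1 - z ≠ 0 :=
  norm_pos_iff.1 (one_pos.trans_le (one_le_norm_one_sub hz))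

theorem norm_inv_one_sub_le {z : ℂ} (hz : z.re ≤ 0) : ‖(1 - z)⁻¹‖ ≤ 1 := by
  rw [norm_inv]
  exact inv_le_one_of_one_le₀ (one_le_norm_one_sub hz)

theorem repr_diagResolvent (hd : ∀ i, (d i).re ≤ 0) (v : H) (i : ι) :
    b.repr (diagResolvent b d v) i = (1 - d i)⁻¹ * b.repr v i :=
  repr_diagOp b (fun i => norm_inv_one_sub_le (hd i)) v i

theorem diagResolvent_injective (hd : ∀ i, (d i).re ≤ 0) :
    Function.Injective (diagResolvent b d) := fun v w h => ext_repr b fun i => by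
  have := congrArg (fun x => b.repr x i) h
  simp only [repr_diagResolvent hd] at this
  exact mul_left_cancel₀ (inv_ne_zero (one_sub_ne_zero_of_re_nonpos (hd i))) this

/-- The substitution `v = (1 - D)⁻¹ y` turns the unbounded equation `(μ - D - B) v = w` into the
bounded one `pencil b d B μ y = w`. The shift by `1` makes `1 - D` invertible, since the real parts
of `d` are nonpositive. -/
theorem perturbedDiag_diagResolvent_iff (hd : ∀ i, (d i).re ≤ 0) (μ : ℂ) (y w : H) :
    perturbedDiag b d B (diagResolvent b d y) (μ • diagResolvent b d y - w) ↔
      pencil b d B μ y = w := by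
  have key : ∀ i, b.repr (pencil b d B μ y) i = μ * b.repr (diagResolvent b d y) i -
      d i * b.repr (diagResolvent b d y) i - b.repr (B (diagResolvent b d y)) i := by
    intro i
    have h1 : b.repr y i = (1 - d i) * b.repr (diagResolvent b d y) i := by
      rw [repr_diagResolvent hd, ← mul_assoc,
        mul_inv_cancel₀ (one_sub_ne_zero_of_re_nonpos (hd i)), one_mul]
    simp only [pencil, sub_apply, add_apply, smul_apply, mul_apply_eq_comp, one_apply_eq_self,
      map_sub, map_add, map_smul, lp.coeFn_sub, lp.coeFn_add, lp.coeFn_smul, Pi.sub_apply,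
      Pi.add_apply, Pi.smul_apply, smul_eq_mul, h1]
    ring
  constructor
  · intro h
    refine ext_repr b fun i => ?_
    have := h i
    rw [map_sub, lp.coeFn_sub, Pi.sub_apply, map_smul, lp.coeFn_smul, Pi.smul_apply,
      smul_eq_mul] at this
    rw [key]
    linear_combination this
  · rintro rfl i
    rw [map_sub, lp.coeFn_sub, Pi.sub_apply, map_smul, lp.coeFn_smul, Pi.smul_apply, smul_eq_mul,
      key]
    ring

theorem exists_diagResolvent_eq (hd : ∀ i, (d i).re ≤ 0) {v w : H} (h : perturbedDiag b d B v w) :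
    ∃ y, diagResolvent b d y = v := by
  -- This is `(1 - D) v`, with `D v = w - B v`.
  refine ⟨v - w + B v, ext_repr b fun i => ?_⟩
  rw [repr_diagResolvent hd, map_add, map_sub, lp.coeFn_add, lp.coeFn_sub, Pi.add_apply,
    Pi.sub_apply, h i, inv_mul_eq_iff_eq_mul₀ (one_sub_ne_zero_of_re_nonpos (hd i))]
  ring

theorem isResolventAt_of_isUnit (hd : ∀ i, (d i).re ≤ 0) {μ : ℂ} (h : IsUnit (pencil b d B μ)) :
    IsResolventAt (perturbedDiag b d B) μ (diagResolvent b d * Ring.inverse (pencil b d B μ)) := by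
  intro v w
  rw [mul_apply_eq_comp]
  constructor
  · rintro rfl
    rw [perturbedDiag_diagResolvent_iff hd, ← mul_apply_eq_comp, Ring.mul_inverse_cancel _ h,
      one_apply_eq_self]
  · intro hv
    obtain ⟨y, rfl⟩ := exists_diagResolvent_eq hd hv
    rw [perturbedDiag_diagResolvent_iff hd] at hv
    rw [← hv, ← mul_apply_eq_comp (Ring.inverse _), Ring.inverse_mul_cancel _ h, one_apply_eq_self]

theorem isCompactOperator_diagResolvent [CompleteSpace H] (hd : ∀ i, (d i).re ≤ 0)
    (hfin : ∀ κ : ℝ, {i | -κ < (d i).re}.Finite) : IsCompactOperator (diagResolvent b d) := by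
  refine isCompactOperator_diagOp b (fun i => norm_inv_one_sub_le (hd i)) fun ε hε => ?_
  refine (hfin (1 / ε)).subset fun i hi => ?_
  have h1 := one_le_norm_one_sub (hd i)
  have hi' : ε < ‖1 - d i‖⁻¹ := by simpa [norm_inv] using hi
  rw [lt_inv_comm₀ hε (by linarith), ← one_div] at hi'
  have h2 := (1 - d i).re_le_norm
  rw [Complex.sub_re, Complex.one_re] at h2
  simp only [mem_ofPred_eq]
  linarith

/-- The pencil is the identity minus a compact operator, so by the Fredholm alternative it has a
kernel vector as soon as it is not invertible; the injective `(1 - D)⁻¹` carries this vector to an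
eigenvector. -/
theorem exists_eigenvector_of_not_isUnit [CompleteSpace H] (hd : ∀ i, (d i).re ≤ 0)
    (hfin : ∀ κ : ℝ, {i | -κ < (d i).re}.Finite) {μ : ℂ} (h : ¬ IsUnit (pencil b d B μ)) :
    ∃ v, v ≠ 0 ∧ perturbedDiag b d B v (μ • v) := by
  have hK : IsCompactOperator ((B + (1 - μ) • 1) * diagResolvent b d : H →L[ℂ] H) :=
    by
    rw [ContinuousLinearMap.mul_def, ContinuousLinearMap.coe_comp]
    exact (isCompactOperator_diagResolvent hd hfin).clm_comp (B + (1 - μ) • 1)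
  rcases hK.hasEigenvalue_or_mem_resolventSet one_ne_zero with h1 | h1
  · obtain ⟨y, hy⟩ := h1.exists_hasEigenvector
    have hy1 : ((B + (1 - μ) • 1) * diagResolvent b d : H →L[ℂ] H) y = y := by
      simpa using hy.apply_eq_smul
    refine ⟨diagResolvent b d y, fun h0 => hy.2 (diagResolvent_injective hd (h0.trans (map_zero _).symm)), ?_⟩
    have := (perturbedDiag_diagResolvent_iff (B := B) hd μ y 0).2 (by
      rw [pencil, sub_apply, one_apply_eq_self, hy1, sub_self])
    rwa [sub_zero] at this
  · rw [spectrum.mem_resolventSet_iff, map_one] at h1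
    exact absurd h1 h

theorem notMem_opSpectrum_iff [CompleteSpace H] (hd : ∀ i, (d i).re ≤ 0)
    (hfin : ∀ κ : ℝ, {i | -κ < (d i).re}.Finite) {μ : ℂ} :
    μ ∉ opSpectrum (perturbedDiag b d B) ↔ IsUnit (pencil b d B μ) := by
  constructor
  · intro h
    by_contra h'
    obtain ⟨v, hv, hv'⟩ := exists_eigenvector_of_not_isUnit hd hfin h'
    exact h (mem_opSpectrum_of_eigenvector hv hv')
  · intro h
    exact not_not.2 ⟨_, isResolventAt_of_isUnit hd h⟩

theorem exists_eigenvector_of_mem_opSpectrum [CompleteSpace H] (hd : ∀ i, (d i).re ≤ 0)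
    (hfin : ∀ κ : ℝ, {i | -κ < (d i).re}.Finite) {μ : ℂ}
    (h : μ ∈ opSpectrum (perturbedDiag b d B)) :
    ∃ v, v ≠ 0 ∧ perturbedDiag b d B v (μ • v) :=
  exists_eigenvector_of_not_isUnit hd hfin fun h' => (notMem_opSpectrum_iff hd hfin).2 h' h

/-- The resolvent in terms of the bounded pencil. -/
theorem opResolvent_perturbedDiag [CompleteSpace H] (hd : ∀ i, (d i).re ≤ 0)
    (hfin : ∀ κ : ℝ, {i | -κ < (d i).re}.Finite) (μ : ℂ) :
    opResolvent (perturbedDiag b d B) μ =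
      diagResolvent b d * Ring.inverse (pencil b d B μ) := by
  by_cases h : IsUnit (pencil b d B μ)
  · exact (isResolventAt_of_isUnit hd h).opResolvent_eq
  · rw [Ring.inverse_non_unit _ h, mul_zero, opResolvent, dif_neg]
    exact fun h' => h ((notMem_opSpectrum_iff hd hfin).1 (not_not.2 h'))

theorem differentiable_pencil : Differentiable ℂ (pencil b d B) := by
  unfold pencil
  fun_prop

theorem isOpen_compl_opSpectrum [CompleteSpace H] (hd : ∀ i, (d i).re ≤ 0)
    (hfin : ∀ κ : ℝ, {i | -κ < (d i).re}.Finite) :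
    IsOpen (opSpectrum (perturbedDiag b d B))ᶜ := by
  have : (opSpectrum (perturbedDiag b d B))ᶜ = pencil b d B ⁻¹' {x | IsUnit x} := by
    ext μ
    exact notMem_opSpectrum_iff hd hfin
  rw [this]
  exact Units.isOpen.preimage differentiable_pencil.continuous

theorem differentiableOn_opResolvent [CompleteSpace H] (hd : ∀ i, (d i).re ≤ 0)
    (hfin : ∀ κ : ℝ, {i | -κ < (d i).re}.Finite) :
    DifferentiableOn ℂ (opResolvent (perturbedDiag b d B)) (opSpectrum (perturbedDiag b d B))ᶜ := by
  intro μ hμ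
  rw [funext (opResolvent_perturbedDiag hd hfin)]
  refine DifferentiableAt.differentiableWithinAt ?_
  have h : IsUnit (pencil b d B μ) := (notMem_opSpectrum_iff hd hfin).1 hμ
  exact ((differentiableAt_inverse h).comp μ (differentiable_pencil μ)).const_mul _

theorem totalEigenprojection_mul_self [CompleteSpace H] (hd : ∀ i, (d i).re ≤ 0)
    (hfin : ∀ κ : ℝ, {i | -κ < (d i).re}.Finite) {r : ℝ} (hr : 0 < r)
    (hs : ∀ μ ∈ Metric.sphere (0 : ℂ) r, μ ∉ opSpectrum (perturbedDiag b d B)) :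
    totalEigenprojection (perturbedDiag b d B) r * totalEigenprojection (perturbedDiag b d B) r =
      totalEigenprojection (perturbedDiag b d B) r :=
  circleIntegral_resolvent_mul_self (isOpen_compl_opSpectrum hd hfin) hr hs
    (differentiableOn_opResolvent hd hfin) fun _ hμ _ hν => opResolvent_sub hμ hν

/-- A simple eigenvalue `0` is isolated. -/
theorem exists_isolatesZero [CompleteSpace H] (hd : ∀ i, (d i).re ≤ 0)
    (hfin : ∀ κ : ℝ, {i | -κ < (d i).re}.Finite)
    (h : IsSimpleEigenvalue (perturbedDiag b d B) 0) :
    ∃ r, IsolatesZero (perturbedDiag b d B) r := by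
  obtain ⟨v, hv0, hv, hspan, hgen⟩ := h
  rw [zero_smul] at hv
  have hvv : inner ℂ v v ≠ 0 := inner_self_ne_zero.2 hv0
  -- a rank one perturbation which moves the eigenvalue away from `0`
  let B' : H →L[ℂ] H := B - (innerSL ℂ v).smulRight v
  have hB' : ∀ x y, perturbedDiag b d B' x y ↔ perturbedDiag b d B x (y + inner ℂ v x • v) := by
    intro x y
    refine forall_congr' fun i => ?_
    simp only [B', map_add, map_smul, map_sub, sub_apply, ContinuousLinearMap.smulRight_apply,
      innerSL_apply_apply, lp.coeFn_add, lp.coeFn_sub, lp.coeFn_smul, Pi.add_apply, Pi.sub_apply,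
      Pi.smul_apply]
    constructor <;> intro h <;> linear_combination h
  have hsmul : ∀ (a : ℂ) x y, perturbedDiag b d B x y → perturbedDiag b d B (a • x) (a • y) := by
    intro a x y hxy i
    simp only [map_smul, lp.coeFn_smul, Pi.smul_apply, smul_eq_mul, hxy i]
    ring
  -- A kernel vector `x` of the perturbed operator satisfies `(D + B) x = ⟨v, x⟩ v`. If `⟨v, x⟩ =
  -- 0`, then `x` is a multiple of `v` orthogonal to `v`; otherwise a multiple of `x` is a
  -- generalized eigenvector. Simplicity rules out both.
  have h0 : (0 : ℂ) ∉ opSpectrum (perturbedDiag b d B') := by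
    intro h0
    obtain ⟨x, hx0, hx⟩ := exists_eigenvector_of_mem_opSpectrum hd hfin h0
    rw [zero_smul, hB', zero_add] at hx
    by_cases ha : inner ℂ v x = 0
    · rw [ha, zero_smul] at hx
      obtain ⟨a, rfl⟩ := hspan x (by rwa [zero_smul])
      rw [inner_smul_right, mul_eq_zero, or_iff_left hvv] at ha
      exact hx0 (by rw [ha, zero_smul])
    · refine hgen ⟨(inner ℂ v x)⁻¹ • x, ?_⟩
      rw [zero_smul, zero_add]
      have := hsmul (inner ℂ v x)⁻¹ _ _ hx
      rwa [smul_smul, inv_mul_cancel₀ ha, one_smul] at this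
  set R := opResolvent (perturbedDiag b d B') 0
  have hR : IsResolventAt (perturbedDiag b d B') 0 R := isResolventAt_opResolvent h0
  have hRv : R v = (inner ℂ v v)⁻¹ • v := by
    refine (hR _ _).2 ?_
    rw [hB', zero_smul, inner_smul_right, inv_mul_cancel₀ hvv, one_smul, zero_sub,
      neg_add_cancel]
    simpa using hsmul (inner ℂ v v)⁻¹ _ _ hv
  have hpos : 0 < ‖v‖ ^ 2 := by positivity
  -- The first bound makes `μ R` a contraction by `1/2`. The second keeps `μ` away from `-‖v‖²`, the
  -- eigenvalue to which the perturbation moves `v`, so that `1 + μ ⟨v, v⟩⁻¹` does not vanish.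
  refine ⟨min (1 / (2 * (‖R‖ + 1))) (‖v‖ ^ 2 / 2), by positivity, fun μ hμ hμr => ?_⟩
  by_contra hμ0
  obtain ⟨x, hx0, hx⟩ := exists_eigenvector_of_mem_opSpectrum hd hfin hμ
  have hRx : R (-(μ • x) + inner ℂ v x • v) = x := by
    refine (hR _ _).2 ?_
    rw [hB']
    convert hx using 1
    module
  rw [map_add, map_neg, map_smul, map_smul, hRv] at hRx
  -- the defect of `x` from a multiple of `v` is contracted
  set a : ℂ := inner ℂ v x * (inner ℂ v v)⁻¹ with ha
  have hx1 : x + μ • R x = a • v := by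
    rw [ha]
    linear_combination (norm := module) (-1 : ℂ) • hRx
  have hden : 1 + μ * (inner ℂ v v)⁻¹ ≠ 0 := by
    intro h1
    have h2 : μ = -(inner ℂ v v) := by
      field_simp at h1
      linear_combination h1
    have h3 : ‖μ‖ = ‖v‖ ^ 2 := by
      rw [h2, norm_neg, inner_self_eq_norm_sq_to_K]
      simp
    have h4 := hμr.trans (min_le_right _ _)
    linarith
  set z := x - (a / (1 + μ * (inner ℂ v v)⁻¹)) • v with hz
  have hz1 : z = -(μ • R z) := by
    rw [← add_eq_zero_iff_eq_neg, hz, map_sub, map_smul, hRv]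
    have : a • v = ((a / (1 + μ * (inner ℂ v v)⁻¹)) * (1 + μ * (inner ℂ v v)⁻¹)) • v := by
      rw [div_mul_cancel₀ _ hden]
    rw [← sub_eq_zero.2 hx1, this]
    module
  have hz2 : ‖z‖ ≤ 1 / 2 * ‖z‖ := by
    calc ‖z‖ = ‖μ‖ * ‖R z‖ := by rw [← norm_smul, ← norm_neg (μ • R z), ← hz1]
      _ ≤ 1 / (2 * (‖R‖ + 1)) * (‖R‖ * ‖z‖) := by
          gcongr
          · exact hμr.trans (min_le_left _ _)
          · exact R.le_opNorm z
      _ = 1 / (2 * (‖R‖ + 1)) * ‖R‖ * ‖z‖ := by ring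
      _ ≤ 1 / 2 * ‖z‖ := by
          gcongr
          rw [div_mul_eq_mul_div, div_le_div_iff₀ (by positivity) two_pos]
          nlinarith [norm_nonneg R]
  have hz3 : z = 0 := norm_le_zero_iff.1 (by linarith [norm_nonneg z])
  have hx2 : x = (a / (1 + μ * (inner ℂ v v)⁻¹)) • v := sub_eq_zero.1 hz3
  have hx3 : perturbedDiag b d B x 0 := by
    rw [hx2]
    simpa using hsmul (a / (1 + μ * (inner ℂ v v)⁻¹)) _ _ hv
  have hx4 : μ • x = 0 := by
    refine ext_repr b fun i => ?_
    rw [hx i, ← hx3 i]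
  exact (smul_ne_zero hμ0 hx0) hx4

end Pencil

/-! ### Continuous dependence of spectrum and eigenprojection on the parameter -/

section Family

variable {ι H : Type*} [NormedAddCommGroup H] [InnerProductSpace ℂ H] [CompleteSpace H]
  {b : HilbertBasis ι ℂ H} {d : ℝ → ι → ℂ} {B : H →L[ℂ] H}

theorem continuous_pencil (hG : Continuous fun ξ => diagResolvent b (d ξ)) :
    Continuous fun p : ℝ × ℂ => pencil b (d p.1) B p.2 := by
  unfold pencil
  have := hG.comp (continuous_fst (X := ℝ) (Y := ℂ))
  exact continuous_const.sub ((continuous_const.add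
    ((continuous_const.sub continuous_snd).smul continuous_const)).mul this)

/-- Invertibility of the pencil is an open condition in `(ξ, μ)`, and the circle is compact. -/
theorem eventually_sphere_notMem_opSpectrum (hd : ∀ ξ i, (d ξ i).re ≤ 0)
    (hfin : ∀ ξ, ∀ κ : ℝ, {i | -κ < (d ξ i).re}.Finite)
    (hG : Continuous fun ξ => diagResolvent b (d ξ)) {r : ℝ} {ξ₀ : ℝ}
    (h : ∀ μ ∈ Metric.sphere (0 : ℂ) r, μ ∉ opSpectrum (perturbedDiag b (d ξ₀) B)) :
    ∀ᶠ ξ in 𝓝 ξ₀, ∀ μ ∈ Metric.sphere (0 : ℂ) r, μ ∉ opSpectrum (perturbedDiag b (d ξ) B) := by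
  refine (isCompact_sphere (0 : ℂ) r).eventually_forall_of_forall_eventually fun μ hμ => ?_
  simp only [notMem_opSpectrum_iff (hd _) (hfin _)] at h ⊢
  exact (continuous_pencil hG).continuousAt.eventually (Units.isOpen.mem_nhds (h μ hμ))

theorem continuousOn_totalEigenprojection (hd : ∀ ξ i, (d ξ i).re ≤ 0)
    (hfin : ∀ ξ, ∀ κ : ℝ, {i | -κ < (d ξ i).re}.Finite)
    (hG : Continuous fun ξ => diagResolvent b (d ξ)) {r : ℝ} (hr : 0 ≤ r) {s : Set ℝ}
    (h : ∀ ξ ∈ s, ∀ μ ∈ Metric.sphere (0 : ℂ) r, μ ∉ opSpectrum (perturbedDiag b (d ξ) B)) :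
    ContinuousOn (fun ξ => totalEigenprojection (perturbedDiag b (d ξ) B) r) s := by
  rw [continuousOn_iff_continuous_domRestrict]
  refine Continuous.const_smul (M := ℂ) (g := fun ξ : s => ∮ μ in C(0, r),
    opResolvent (perturbedDiag b (d ξ) B) μ) ?_ _
  refine intervalIntegral.continuous_parametric_intervalIntegral_of_continuous'
    (X := s) (f := fun ξ θ => deriv (circleMap 0 r) θ •
      opResolvent (perturbedDiag b (d ξ) B) (circleMap 0 r θ)) ?_ _ _
  simp only [deriv_circleMap, opResolvent_perturbedDiag (hd _) (hfin _)]
  have h1 : Continuous fun p : s × ℝ => (circleMap 0 r p.2) :=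
    (continuous_circleMap 0 r).comp continuous_snd
  have h2 : Continuous fun p : s × ℝ => diagResolvent b (d p.1) :=
    hG.comp (continuous_subtype_val.comp continuous_fst)
  have h3 : Continuous fun p : s × ℝ => pencil b (d p.1) B (circleMap 0 r p.2) :=
    (continuous_pencil (B := B) hG).comp
      (g := fun p : ℝ × ℂ => pencil b (d p.1) B p.2)
      (f := fun p : s × ℝ => ((p.1 : ℝ), circleMap 0 r p.2))
      ((continuous_subtype_val.comp continuous_fst).prodMk h1)
  have h4 : Continuous fun p : s × ℝ =>
      Ring.inverse (pencil b (d p.1) B (circleMap 0 r p.2)) := by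
    rw [continuous_iff_continuousAt]
    intro p
    obtain ⟨u, hu⟩ : IsUnit (pencil b (d p.1) B (circleMap 0 r p.2)) :=
      (notMem_opSpectrum_iff (hd _) (hfin _)).1
        (h p.1 p.1.2 _ (circleMap_mem_sphere 0 hr p.2))
    have hinv : Tendsto (Ring.inverse : (H →L[ℂ] H) → H →L[ℂ] H) (𝓝 u) (𝓝 (Ring.inverse (u : H →L[ℂ] H))) :=
      NormedRing.inverse_continuousAt u
    rw [hu] at hinv
    exact hinv.comp (h3.tendsto p)
  have h5 : Continuous fun p : s × ℝ => (circleMap 0 r p.2 * Complex.I) :=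
    h1.mul continuous_const
  exact h5.smul (h2.mul h4)

end Family

/-! ### Spectral mapping and decay from a single time -/

section SpectralMapping

/-- A continuous function on a period which does not vanish at the endpoint has a nonzero Fourier
coefficient. -/
theorem exists_integral_exp_mul_ne_zero {φ : ℝ → ℂ} (hφ : Continuous φ) (h01 : φ 0 = φ 1)
    (h0 : φ 0 ≠ 0) :
    ∃ k : ℤ, ∫ x in (0 : ℝ)..1, Complex.exp (-(2 * Real.pi * Complex.I * k) * x) * φ x ≠ 0 := by
  by_contra! h
  let F : C(UnitAddCircle, ℂ) := ⟨AddCircle.liftIco 1 0 φ,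
    AddCircle.liftIco_zero_continuous h01 hφ.continuousOn⟩
  have hF : ∀ x ∈ Ico (0 : ℝ) 1, F (x : UnitAddCircle) = φ x := fun x hx =>
    AddCircle.liftIco_zero_coe_apply hx
  have hc : fourierCoeff F = 0 := by
    funext k
    rw [fourierCoeff_eq_intervalIntegral _ _ 0, zero_add, Pi.zero_apply, ← h k, one_div, inv_one,
      one_smul]
    rw [intervalIntegral.integral_of_le zero_le_one, intervalIntegral.integral_of_le zero_le_one,
      ← integral_Ico_eq_integral_Ioc, ← integral_Ico_eq_integral_Ioc]
    refine setIntegral_congr_fun measurableSet_Ico fun x hx => ?_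
    simp only [hF x hx, fourier_coe_apply, smul_eq_mul]
    congr 2
    push_cast
    ring
  have h1 := has_pointwise_sum_fourier_series_of_summable (f := F)
    (by rw [hc]; exact summable_zero) ((0 : ℝ) : UnitAddCircle)
  rw [hc] at h1
  simp only [Pi.zero_apply, zero_smul] at h1
  have h2 := h1.unique hasSum_zero
  rw [hF 0 ⟨le_rfl, zero_lt_one⟩] at h2
  exact h0 h2

variable {H : Type*} [NormedAddCommGroup H] [InnerProductSpace ℂ H] [CompleteSpace H]
  {A : H → H → Prop} {T : ℝ → H →L[ℂ] H}

/-- The spectral mapping theorem for the point spectrum of a semigroup. -/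
theorem IsSemigroupGeneratedBy.exists_eigenvector (h : IsSemigroupGeneratedBy A T)
    (hc : ∀ v, Continuous fun t => T t v) {lam : ℂ} (hlam : lam ≠ 0) {v : H} (hv0 : v ≠ 0)
    (hv : T 1 v = lam • v) :
    ∃ (μ : ℂ) (w : H), w ≠ 0 ∧ Complex.exp μ = lam ∧ A w (μ • w) ∧
      ∀ P : H →L[ℂ] H, (∀ t, 0 ≤ t → Commute P (T t)) → P v = 0 → P w = 0 := by
  have hexp : Complex.exp (Complex.log lam) = lam := Complex.exp_log hlam
  have hg : ∀ a : ℂ, Continuous fun s : ℝ => Complex.exp (-a * s) • T s v := fun a =>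
    (by fun_prop : Continuous fun s : ℝ => Complex.exp (-a * s)).smul (hc v)
  -- The orbit `e^{-s log λ} T s v` is `1`-periodic for `s ≥ 0` and starts at `v ≠ 0`, so one of its
  -- Fourier coefficients is nonzero. This coefficient is the eigenvector `w`, and its frequency
  -- selects the branch of the logarithm.
  obtain ⟨k, hk⟩ := exists_integral_exp_mul_ne_zero
    (φ := fun s => inner ℂ v (Complex.exp (-Complex.log lam * s) • T s v))
    (continuous_const.inner (hg _)) (by
      simp only [Complex.ofReal_zero, Complex.ofReal_one, mul_zero, mul_one, Complex.exp_zero,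
        one_smul, h.zero, ContinuousLinearMap.id_apply, hv, smul_smul, Complex.exp_neg, hexp,
        inv_mul_cancel₀ hlam])
    (by simpa [h.zero] using hv0)
  set μ : ℂ := Complex.log lam + 2 * Real.pi * Complex.I * k with hμ
  have hexpμ : Complex.exp μ = lam := by
    rw [hμ, Complex.exp_add, hexp, mul_comm (2 * (Real.pi : ℂ) * Complex.I),
      Complex.exp_int_mul_two_pi_mul_I, mul_one]
  let G : ℝ → H := fun s => Complex.exp (-μ * s) • T s v
  have hG : Continuous G := hg μ
  have hGper : ∀ s, 0 ≤ s → G (s + 1) = G s := by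
    intro s hs
    have : T (s + 1) v = lam • T s v := by
      rw [h.add s 1 hs zero_le_one, ContinuousLinearMap.comp_apply, hv, map_smul]
    simp only [G, this, smul_smul]
    congr 1
    rw [← hexpμ, ← Complex.exp_add]
    congr 1
    push_cast
    ring
  set w := ∫ s in (0 : ℝ)..1, G s with hw
  -- The integral of a periodic function over a period is invariant under shifts, so `T t` acts on
  -- `w` as multiplication by `e^{μt}`.
  have hshift : ∀ t, 0 ≤ t → ∫ s in (0 : ℝ)..1, G (s + t) = w := by
    intro t ht
    have h1 : ∫ s in (1 : ℝ)..(1 + t), G s = ∫ s in (0 : ℝ)..t, G s := by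
      have := intervalIntegral.integral_comp_add_right (a := 0) (b := t) G 1
      rw [zero_add, add_comm t] at this
      rw [← this]
      refine intervalIntegral.integral_congr fun s hs => hGper s ?_
      rw [uIcc_of_le ht] at hs
      exact hs.1
    rw [intervalIntegral.integral_comp_add_right, zero_add, hw,
      ← intervalIntegral.integral_add_adjacent_intervals (hG.intervalIntegrable t 1)
        (hG.intervalIntegrable 1 (1 + t)), h1, add_comm,
      intervalIntegral.integral_add_adjacent_intervals (hG.intervalIntegrable _ _)
        (hG.intervalIntegrable _ _)]
  have hTw : ∀ t, 0 ≤ t → T t w = Complex.exp (μ * t) • w := by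
    intro t ht
    rw [hw, ← ContinuousLinearMap.intervalIntegral_comp_comm _ (hG.intervalIntegrable 0 1), ← hw,
      ← hshift t ht, ← intervalIntegral.integral_smul]
    refine intervalIntegral.integral_congr fun s hs => ?_
    rw [uIcc_of_le zero_le_one] at hs
    simp only [G, map_smul, smul_smul, ← Complex.exp_add]
    rw [add_comm s t, h.add t s ht hs.1, ContinuousLinearMap.comp_apply]
    congr 2
    push_cast
    ring
  refine ⟨μ, w, ?_, hexpμ, ?_, fun P hP hPv => ?_⟩
  · intro hw0
    apply hk
    have h1 := ContinuousLinearMap.intervalIntegral_comp_comm (μ := volume) (innerSL ℂ v)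
      (hG.intervalIntegrable 0 1)
    rw [← hw, hw0, map_zero] at h1
    rw [← h1]
    refine intervalIntegral.integral_congr fun s _ => ?_
    simp only [G, innerSL_apply_apply, inner_smul_right, ← mul_assoc, ← Complex.exp_add]
    congr 2
    rw [hμ]
    ring
  · rw [h.generator]
    have h1 : HasDerivAt (fun s : ℝ => Complex.exp (μ * s)) μ 0 := by
      have := ((Complex.ofRealCLM.hasDerivAt (x := 0)).const_mul μ).cexp
      simpa using this
    have h2 := h1.hasDerivWithinAt (s := Ioi 0)
    rw [hasDerivWithinAt_iff_tendsto_slope' (by simp)] at h2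
    refine (h2.smul_const w).congr' ?_
    filter_upwards [self_mem_nhdsWithin] with s hs
    rw [hTw s (le_of_lt hs)]
    simp [slope_def_module, sub_smul, smul_sub, mul_smul]
  · rw [hw, ← ContinuousLinearMap.intervalIntegral_comp_comm _ (hG.intervalIntegrable 0 1)]
    have : ∀ s ∈ uIcc (0 : ℝ) 1, P (G s) = 0 := by
      intro s hs
      rw [uIcc_of_le zero_le_one] at hs
      have h1 : P (T s v) = T s (P v) := by
        rw [← mul_apply_eq_comp, (hP s hs.1).eq, mul_apply_eq_comp]
      simp only [G, map_smul, h1, hPv, map_zero, smul_zero]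
    rw [intervalIntegral.integral_congr this]
    simp

/-- A compact operator with all eigenvalues in the open unit disk has small powers. -/
theorem exists_norm_pow_lt_half {S : H →L[ℂ] H} (hS : IsCompactOperator S)
    (hev : ∀ (lam : ℂ) (v : H), v ≠ 0 → S v = lam • v → ‖lam‖ < 1) :
    ∃ N : ℕ, 1 ≤ N ∧ ‖S ^ N‖ < 1 / 2 := by
  rcases subsingleton_or_nontrivial H with hH | hH
  · exact ⟨1, le_rfl, by rw [show S ^ 1 = 0 from Subsingleton.elim _ _, norm_zero]; norm_num⟩
  -- Nonzero spectral values of a compact operator are eigenvalues, so the spectral radius is below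
  -- one; Gelfand's formula then bounds the powers.
  have h1 : spectralRadius ℂ S < ((1 : NNReal) : ℝ≥0∞) := by
    refine spectrum.spectralRadius_lt_of_forall_lt S fun z hz => ?_
    rcases eq_or_ne z 0 with rfl | hz0
    · simp
    · obtain ⟨v, hv⟩ := ((hS.hasEigenvalue_iff_mem_spectrum hz0).2 hz).exists_hasEigenvector
      exact hev z v hv.2 hv.apply_eq_smul
  obtain ⟨q, hq1, hq2⟩ := exists_between h1
  have h2 := (spectrum.pow_nnnorm_pow_one_div_tendsto_nhds_spectralRadius S).eventually
    (gt_mem_nhds hq1)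
  have h3 := (ENNReal.tendsto_pow_atTop_nhds_zero_of_lt_one hq2).eventually
    (gt_mem_nhds (show (0 : ℝ≥0∞) < ((1 / 2 : NNReal) : ℝ≥0∞) by simp))
  obtain ⟨N, ⟨hN1, hN2⟩, hN3⟩ := ((h2.and h3).and (eventually_ge_atTop 1)).exists
  refine ⟨N, hN3, ?_⟩
  have hN0 : (N : ℝ) ≠ 0 := by positivity
  have h4 : (‖S ^ N‖₊ : ℝ≥0∞) < q ^ N := by
    have := ENNReal.rpow_lt_rpow hN1 (show (0 : ℝ) < N by positivity)
    rwa [← ENNReal.rpow_mul, one_div, inv_mul_cancel₀ hN0, ENNReal.rpow_one,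
      ENNReal.rpow_natCast] at this
  have h5 := h4.trans hN2
  rw [ENNReal.coe_lt_coe] at h5
  exact_mod_cast h5

/-- Exponential decay of a semigroup on the range of a commuting projection, from decay at one
time. -/
theorem norm_semigroup_mul_le (h : IsSemigroupGeneratedBy A T) {Q : H →L[ℂ] H}
    (hQ : ∀ t, 0 ≤ t → Commute Q (T t)) (hQQ : Q * Q = Q) {β q : ℝ} (hβ : 0 ≤ β)
    (hTβ : ∀ t, 0 ≤ t → ‖T t‖ ≤ Real.exp (β * t)) (hQq : ‖Q‖ ≤ q) {N : ℕ} (hN : 1 ≤ N)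
    (hhalf : ‖T N * Q‖ ≤ 1 / 2) {t : ℝ} (ht : 0 ≤ t) :
    ‖T t * Q‖ ≤ 2 * (Real.exp (β * N) * q) * Real.exp (-(Real.log 2 / N) * t) := by
  have hN0 : (0 : ℝ) < N := by exact_mod_cast hN
  have hstep : ∀ (m : ℕ) (s : ℝ), 0 ≤ s → T (m * N + s) * Q = T s * Q * (T N * Q) ^ m := by
    intro m
    induction m with
    | zero => intro s _; simp
    | succ m ih =>
      intro s hs
      have e : ((m + 1 : ℕ) : ℝ) * N + s = m * N + (s + N) := by push_cast; ring
      rw [e, ih (s + N) (by positivity), h.add s N hs hN0.le, pow_succ', ← mul_assoc]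
      congr 1
      change T s * T N * Q = T s * Q * (T N * Q)
      rw [mul_assoc, mul_assoc, ← mul_assoc Q, (hQ N hN0.le).eq, mul_assoc, hQQ]
  set m := ⌊t / N⌋₊ with hm
  have h1 : (m : ℝ) * N ≤ t := by
    rw [← le_div_iff₀ hN0]
    exact Nat.floor_le (by positivity)
  have h2 : t < (m + 1) * N := by
    rw [← div_lt_iff₀ hN0]
    exact Nat.lt_floor_add_one _
  have e : t = m * N + (t - m * N) := by ring
  have h3 : ‖T (t - m * N) * Q‖ ≤ Real.exp (β * N) * q := by
    refine (norm_mul_le _ _).trans ?_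
    gcongr
    refine (hTβ _ (sub_nonneg.2 h1)).trans ?_
    gcongr
    linarith
  -- As `m ≥ t/N - 1`, one has `2^{-m} ≤ 2 · 2^{-t/N}`, the source of the factor `2` and of the rate
  -- `log 2 / N`.
  have h4 : ‖(T N * Q) ^ m‖ ≤ 2 * Real.exp (-(Real.log 2 / N) * t) ∨ m = 0 := by
    rcases Nat.eq_zero_or_pos m with hm0 | hm0
    · exact Or.inr hm0
    left
    refine (norm_pow_le' _ hm0).trans ((pow_le_pow_left₀ (norm_nonneg _) hhalf m).trans ?_)
    have e1 : ((1 : ℝ) / 2) ^ m = Real.exp (-(Real.log 2 * m)) := by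
      rw [Real.exp_neg, mul_comm, Real.exp_nat_mul, Real.exp_log two_pos, one_div, inv_pow]
    have e2 : 2 * Real.exp (-(Real.log 2 / N) * t) =
        Real.exp (Real.log 2 - Real.log 2 / N * t) := by
      rw [sub_eq_add_neg, Real.exp_add, Real.exp_log two_pos, neg_mul]
    rw [e1, e2, Real.exp_le_exp]
    have h5 : t / N ≤ m + 1 := ((div_lt_iff₀ hN0).2 h2).le
    have h6 : 0 ≤ Real.log 2 := Real.log_nonneg one_le_two
    have h7 : Real.log 2 / N * t = Real.log 2 * (t / N) := by ring
    rw [h7]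
    nlinarith
  rcases h4 with h4 | hm0
  · rw [e, hstep m _ (sub_nonneg.2 h1), ← e]
    refine (norm_mul_le _ _).trans ?_
    calc _ ≤ Real.exp (β * N) * q * (2 * Real.exp (-(Real.log 2 / N) * t)) := by
          gcongr
          exact (norm_nonneg _).trans h3
      _ = _ := by ring
  · rw [hm0] at h3 h2
    simp only [Nat.cast_zero, zero_mul, sub_zero, zero_add, one_mul] at h3 h2
    refine h3.trans ?_
    have h5 : 1 / 2 ≤ Real.exp (-(Real.log 2 / N) * t) := by
      rw [one_div, ← Real.exp_log two_pos, ← Real.exp_neg, Real.exp_le_exp, Real.log_exp]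
      have h6 : 0 ≤ Real.log 2 := Real.log_nonneg one_le_two
      have h7 : t / N ≤ 1 := ((div_lt_one hN0).2 h2).le
      have h8 : Real.log 2 / N * t = Real.log 2 * (t / N) := by ring
      rw [neg_mul, h8]
      nlinarith
    have h9 : 0 ≤ Real.exp (β * N) * q := (norm_nonneg _).trans h3
    nlinarith

end SpectralMapping

/-! ### Decay that is locally uniform in the parameter -/

section UniformDecay

theorem IsSemigroupGeneratedBy.pow {X : Type*} [NormedAddCommGroup X] [NormedSpace ℂ X]
    {A : X → X → Prop} {T : ℝ → X →L[ℂ] X} (h : IsSemigroupGeneratedBy A T) (N : ℕ) :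
    T 1 ^ N = T N := by
  induction N with
  | zero => simp [h.zero]; rfl
  | succ N ih =>
    rw [pow_succ, ih, Nat.cast_succ, h.add _ _ N.cast_nonneg zero_le_one]
    rfl

variable {ι H : Type*} [NormedAddCommGroup H] [InnerProductSpace ℂ H] [CompleteSpace H]
  {b : HilbertBasis ι ℂ H} {d : ℝ → ι → ℂ} {B : H →L[ℂ] H} {T : ℝ → ℝ → H →L[ℂ] H}

/-- Spectral mapping puts the eigenvalues of the compact operator `T ξ₀ 1` into the open unit disk,
so `‖T ξ₀ N‖ < 1/2` for some `N`. This persists for nearby `ξ` by norm continuity, and the growth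
bound on `[0, N]` does not depend on `ξ`. -/
theorem exists_decay_nhds (hd : ∀ ξ i, (d ξ i).re ≤ 0)
    (hfin : ∀ ξ, ∀ κ : ℝ, {i | -κ < (d ξ i).re}.Finite)
    (hT : ∀ ξ, IsDuhamel b (d ξ) B (T ξ)) (hTc : ∀ t, 0 ≤ t → Continuous fun ξ => T ξ t) {ξ₀ : ℝ}
    (hσ : ∀ μ ∈ opSpectrum (perturbedDiag b (d ξ₀) B), μ.re < 0) :
    ∃ C θ : ℝ, 0 < C ∧ 0 < θ ∧ ∀ᶠ ξ in 𝓝 ξ₀, ∀ t, 0 ≤ t → ‖T ξ t‖ ≤ C * Real.exp (-θ * t) := by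
  have hsg := fun ξ => (hT ξ).isSemigroupGeneratedBy (hd ξ)
  obtain ⟨N, hN, hN2⟩ := exists_norm_pow_lt_half
    ((hT ξ₀).isCompactOperator (hd ξ₀) (hfin ξ₀) one_pos) fun lam v hv0 hv => by
      rcases eq_or_ne lam 0 with rfl | hlam
      · simp
      obtain ⟨μ, w, hw0, rfl, hw, -⟩ :=
        (hsg ξ₀).exists_eigenvector (hT ξ₀).continuous hlam hv0 hv
      rw [Complex.norm_exp, Real.exp_lt_one_iff]
      exact hσ μ (mem_opSpectrum_of_eigenvector hw0 hw)
  rw [(hsg ξ₀).pow] at hN2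
  have hN0 : (0 : ℝ) < N := by exact_mod_cast hN
  refine ⟨2 * (Real.exp (‖B‖ * N) * 1), Real.log 2 / N, by positivity,
    div_pos (Real.log_pos one_lt_two) hN0, ?_⟩
  filter_upwards [(hTc N N.cast_nonneg).norm.continuousAt.eventually (gt_mem_nhds hN2)]
    with ξ hξ t ht
  have := norm_semigroup_mul_le (hsg ξ) (Q := 1) (fun t _ => Commute.one_left _) (one_mul 1)
    (norm_nonneg B) (fun t ht => (hT ξ).norm_le (hd ξ) ht) ContinuousLinearMap.norm_id_le hN
    (by rw [mul_one]; exact hξ.le) ht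
  rwa [mul_one] at this

theorem exists_decay_of_isCompact (hd : ∀ ξ i, (d ξ i).re ≤ 0)
    (hfin : ∀ ξ, ∀ κ : ℝ, {i | -κ < (d ξ i).re}.Finite)
    (hT : ∀ ξ, IsDuhamel b (d ξ) B (T ξ)) (hTc : ∀ t, 0 ≤ t → Continuous fun ξ => T ξ t)
    {s : Set ℝ} (hs : IsCompact s)
    (hσ : ∀ ξ ∈ s, ∀ μ ∈ opSpectrum (perturbedDiag b (d ξ) B), μ.re < 0) :
    ∃ C θ : ℝ, 0 < C ∧ 0 < θ ∧ ∀ ξ ∈ s, ∀ t, 0 ≤ t → ‖T ξ t‖ ≤ C * Real.exp (-θ * t) := by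
  refine hs.induction_on (p := fun s => ∃ C θ : ℝ, 0 < C ∧ 0 < θ ∧ ∀ ξ ∈ s, ∀ t, 0 ≤ t →
    ‖T ξ t‖ ≤ C * Real.exp (-θ * t)) ?_ ?_ ?_ ?_
  · exact ⟨1, 1, one_pos, one_pos, by simp⟩
  · rintro s t hst ⟨C, θ, hC, hθ, h⟩
    exact ⟨C, θ, hC, hθ, fun ξ hξ => h ξ (hst hξ)⟩
  · rintro s t ⟨C, θ, hC, hθ, h⟩ ⟨C', θ', hC', hθ', h'⟩
    refine ⟨max C C', min θ θ', lt_max_of_lt_left hC, lt_min hθ hθ', fun ξ hξ t ht => ?_⟩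
    rcases hξ with hξ | hξ
    · refine (h ξ hξ t ht).trans ?_
      gcongr
      · exact le_max_left _ _
      · exact min_le_left _ _
    · refine (h' ξ hξ t ht).trans ?_
      gcongr
      · exact le_max_right _ _
      · exact min_le_right _ _
  · intro ξ hξ
    obtain ⟨C, θ, hC, hθ, h⟩ := exists_decay_nhds hd hfin hT hTc (hσ ξ hξ)
    exact ⟨_, mem_nhdsWithin_of_mem_nhds h, C, θ, hC, hθ, fun ξ hξ => hξ⟩

theorem commute_totalEigenprojection_semigroup {d : ι → ℂ} {T : ℝ → H →L[ℂ] H}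
    (hd : ∀ i, (d i).re ≤ 0) (hfin : ∀ κ : ℝ, {i | -κ < (d i).re}.Finite)
    (hT : IsSemigroupGeneratedBy (perturbedDiag b d B) T) {r : ℝ} (hr : 0 ≤ r)
    (hs : ∀ μ ∈ Metric.sphere (0 : ℂ) r, μ ∉ opSpectrum (perturbedDiag b d B)) {t : ℝ}
    (ht : 0 ≤ t) : Commute (totalEigenprojection (perturbedDiag b d B) r) (T t) :=
  commute_totalEigenprojection hr ((differentiableOn_opResolvent hd hfin).continuousOn.mono hs)
    fun μ hμ => (isResolventAt_opResolvent (hs μ hμ)).commute_semigroup hT ht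

/-- The same argument for `T ξ₀ 1 * (1 - P ξ₀)`, where the projection removes the eigenvalue `0` of
the generator; `P ξ` is norm continuous near `ξ₀`. -/
theorem exists_decay_complement_nhds (hd : ∀ ξ i, (d ξ i).re ≤ 0)
    (hfin : ∀ ξ, ∀ κ : ℝ, {i | -κ < (d ξ i).re}.Finite)
    (hG : Continuous fun ξ => diagResolvent b (d ξ))
    (hT : ∀ ξ, IsDuhamel b (d ξ) B (T ξ)) (hTc : ∀ t, 0 ≤ t → Continuous fun ξ => T ξ t)
    {ξ₀ r : ℝ} (hr : 0 < r)
    (hs : ∀ μ ∈ Metric.sphere (0 : ℂ) r, μ ∉ opSpectrum (perturbedDiag b (d ξ₀) B))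
    (hσ : ∀ μ ∈ opSpectrum (perturbedDiag b (d ξ₀) B), μ ≠ 0 → μ.re < 0) :
    ∃ C θ : ℝ, 0 < C ∧ 0 < θ ∧ ∀ᶠ ξ in 𝓝 ξ₀, ∀ t, 0 ≤ t →
      ‖T ξ t * (1 - totalEigenprojection (perturbedDiag b (d ξ) B) r)‖ ≤
        C * Real.exp (-θ * t) := by
  have hsg := fun ξ => (hT ξ).isSemigroupGeneratedBy (hd ξ)
  set P := fun ξ => totalEigenprojection (perturbedDiag b (d ξ) B) r with hP
  have hev := eventually_sphere_notMem_opSpectrum hd hfin hG hs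
  have hPc : ContinuousAt P ξ₀ :=
    (continuousOn_totalEigenprojection (s := {ξ | ∀ μ ∈ Metric.sphere (0 : ℂ) r,
      μ ∉ opSpectrum (perturbedDiag b (d ξ) B)}) hd hfin hG hr.le fun ξ hξ => hξ).continuousAt hev
  have hPP : ∀ ξ, (∀ μ ∈ Metric.sphere (0 : ℂ) r, μ ∉ opSpectrum (perturbedDiag b (d ξ) B)) →
      IsIdempotentElem (1 - P ξ) := fun ξ hξ =>
    IsIdempotentElem.one_sub (totalEigenprojection_mul_self (hd ξ) (hfin ξ) hr hξ)
  have hcomm : ∀ ξ, (∀ μ ∈ Metric.sphere (0 : ℂ) r, μ ∉ opSpectrum (perturbedDiag b (d ξ) B)) →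
      ∀ t, 0 ≤ t → Commute (P ξ) (T ξ t) := fun ξ hξ t ht =>
    commute_totalEigenprojection_semigroup (hd ξ) (hfin ξ) (hsg ξ) hr.le hξ ht
  have hcomm' : ∀ ξ, (∀ μ ∈ Metric.sphere (0 : ℂ) r, μ ∉ opSpectrum (perturbedDiag b (d ξ) B)) →
      ∀ t, 0 ≤ t → Commute (1 - P ξ) (T ξ t) := fun ξ hξ t ht =>
    (Commute.one_left _).sub_left (hcomm ξ hξ t ht)
  have hcompact : IsCompactOperator (T ξ₀ 1 * (1 - P ξ₀) : H →L[ℂ] H) := by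
    rw [ContinuousLinearMap.mul_def, ContinuousLinearMap.coe_comp]
    exact ((hT ξ₀).isCompactOperator (hd ξ₀) (hfin ξ₀) one_pos).comp_clm (1 - P ξ₀)
  obtain ⟨N, hN, hN2⟩ := exists_norm_pow_lt_half hcompact fun lam v hv0 hv => by
      rcases eq_or_ne lam 0 with rfl | hlam
      · simp
      -- An eigenvector with nonzero eigenvalue lies in the range of `1 - P ξ₀`, hence is an
      -- eigenvector of the semigroup itself; the property `P v = 0` passes to the eigenvector `w`
      -- of the generator.
      have hPv : P ξ₀ v = 0 := by
        have h1 : P ξ₀ ((T ξ₀ 1 * (1 - P ξ₀)) v) = 0 := by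
          rw [← mul_apply_eq_comp, ← mul_assoc, (hcomm ξ₀ hs 1 zero_le_one).eq, mul_assoc,
            mul_sub, mul_one, totalEigenprojection_mul_self (hd ξ₀) (hfin ξ₀) hr hs, sub_self,
            mul_zero, zero_apply]
        rw [hv, map_smul] at h1
        exact (smul_eq_zero.1 h1).resolve_left hlam
      have hv' : T ξ₀ 1 v = lam • v := by
        rw [← hv, mul_apply_eq_comp, sub_apply, hPv, sub_zero, one_apply_eq_self]
      obtain ⟨μ, w, hw0, rfl, hw, hPw⟩ :=
        (hsg ξ₀).exists_eigenvector (hT ξ₀).continuous hlam hv0 hv'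
      rw [Complex.norm_exp, Real.exp_lt_one_iff]
      refine hσ μ (mem_opSpectrum_of_eigenvector hw0 hw) ?_
      -- An eigenvector `w` for the eigenvalue `0` would be fixed by `P ξ₀`, contradicting `P ξ₀ w =
      -- 0`.
      rintro rfl
      rw [zero_smul] at hw
      have h2 : P ξ₀ w = w := totalEigenprojection_apply_of_mem_ker hr
        ((differentiableOn_opResolvent (hd ξ₀) (hfin ξ₀)).continuousOn.mono hs) hs hw
      rw [hPw (P ξ₀) (hcomm ξ₀ hs) hPv] at h2
      exact hw0 h2.symm
  have hpow : (T ξ₀ 1 * (1 - P ξ₀)) ^ N = T ξ₀ N * (1 - P ξ₀) := by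
    rw [(hcomm' ξ₀ hs 1 zero_le_one).symm.mul_pow, (hsg ξ₀).pow,
      ← Nat.succ_pred_eq_of_ne_zero (by omega : N ≠ 0), (hPP ξ₀ hs).pow_succ_eq]
  rw [hpow] at hN2
  have hN0 : (0 : ℝ) < N := by exact_mod_cast hN
  have hQc : ContinuousAt (fun ξ => 1 - P ξ) ξ₀ := continuousAt_const.sub hPc
  refine ⟨2 * (Real.exp (‖B‖ * N) * (‖1 - P ξ₀‖ + 1)), Real.log 2 / N, by positivity,
    div_pos (Real.log_pos one_lt_two) hN0, ?_⟩
  filter_upwards [hev, (((hTc N N.cast_nonneg).continuousAt).mul hQc).norm.eventually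
    (gt_mem_nhds hN2), hQc.norm.eventually (gt_mem_nhds (lt_add_one _))] with ξ hξ h1 h2 t ht
  exact norm_semigroup_mul_le (hsg ξ) (hcomm' ξ hξ) (hPP ξ hξ)
    (norm_nonneg B) (fun t ht => (hT ξ).norm_le (hd ξ) ht) h2.le hN h1.le ht

end UniformDecay

/-! ### Estimates for the Fourier symbol -/

section Symbol

/-- The Fourier symbol `-m² + i c m` of `∂ₓ² + c ∂ₓ` on the real line. -/
def lineSymbol (c m : ℝ) : ℂ := -(m : ℂ) ^ 2 + Complex.I * c * m

/-- The symbol of the constant-coefficient part of the Bloch operator with Floquet exponent `ξ`,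
indexed by wave number and component. -/
def blochSymbol {n : ℕ} (c ξ : ℝ) (i : ℤ × Fin n) : ℂ := lineSymbol c (2 * Real.pi * i.1 + ξ)

theorem re_lineSymbol (c m : ℝ) : (lineSymbol c m).re = -m ^ 2 := by
  simp [lineSymbol, ← Complex.ofReal_pow]

theorem re_lineSymbol_nonpos (c m : ℝ) : (lineSymbol c m).re ≤ 0 := by
  rw [re_lineSymbol]; nlinarith [sq_nonneg m]

theorem norm_exp_lineSymbol (c t m : ℝ) :
    ‖Complex.exp (t * lineSymbol c m)‖ = Real.exp (-(t * m ^ 2)) := by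
  rw [Complex.norm_exp, Complex.re_ofReal_mul, re_lineSymbol, mul_neg]

theorem abs_mul_exp_neg_sq_le_one (x : ℝ) : |x| * Real.exp (-x ^ 2) ≤ 1 := by
  have h := Real.add_one_le_exp (x ^ 2)
  rw [Real.exp_neg, ← div_eq_mul_inv, div_le_one (Real.exp_pos _)]
  nlinarith [sq_abs x, sq_nonneg (|x| - 1)]

/-- The derivative in `m` carries the unbounded factor `2tm`, but `√t |m| e^{-tm²} ≤ 1`. The bound
is uniform over the modes, which makes the free semigroups Lipschitz in `ξ` in operator norm. -/
theorem norm_exp_lineSymbol_sub_le (c : ℝ) {t : ℝ} (ht : 0 ≤ t) (m m' : ℝ) :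
    ‖Complex.exp (t * lineSymbol c m) - Complex.exp (t * lineSymbol c m')‖ ≤
      (2 * √t + t * |c|) * |m - m'| := by
  have hderiv : ∀ x : ℝ, HasDerivAt (fun x : ℝ => Complex.exp (t * lineSymbol c x))
      (Complex.exp (t * lineSymbol c x) * (t * (-(2 * x) + Complex.I * c))) x := fun x => by
    refine HasDerivAt.cexp (HasDerivAt.const_mul (t : ℂ) ?_)
    have h1 : HasDerivAt (fun z : ℂ => -z ^ 2 + Complex.I * c * z) (-(2 * x) + Complex.I * c) x := by
      have := ((hasDerivAt_id (x : ℂ)).pow 2).neg.add ((hasDerivAt_id (x : ℂ)).const_mul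
        (Complex.I * c))
      simpa using! this
    exact h1.comp_ofReal
  refine (convex_univ.norm_image_sub_le_of_norm_hasDerivWithin_le
    (fun x _ => (hderiv x).hasDerivWithinAt) (fun x _ => ?_) (mem_univ m') (mem_univ m)).trans_eq
    (by rw [Real.norm_eq_abs])
  rw [norm_mul, norm_exp_lineSymbol, norm_mul, Complex.norm_of_nonneg ht]
  have h1 : ‖-(2 * x : ℂ) + Complex.I * c‖ ≤ 2 * |x| + |c| := by
    refine (norm_add_le _ _).trans_eq ?_
    simp
  have h2 := abs_mul_exp_neg_sq_le_one (√t * x)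
  rw [mul_pow, Real.sq_sqrt ht, abs_mul, abs_of_nonneg (Real.sqrt_nonneg t)] at h2
  have h3 : Real.exp (-(t * x ^ 2)) ≤ 1 := Real.exp_le_one_iff.2 (by nlinarith [sq_nonneg x])
  have hst := Real.mul_self_sqrt ht
  calc Real.exp (-(t * x ^ 2)) * (t * ‖-(2 * x : ℂ) + Complex.I * c‖)
      ≤ Real.exp (-(t * x ^ 2)) * (t * (2 * |x| + |c|)) := by gcongr
    _ = 2 * √t * (√t * |x| * Real.exp (-(t * x ^ 2))) + t * |c| * Real.exp (-(t * x ^ 2)) := by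
      linear_combination (-2 * |x| * Real.exp (-(t * x ^ 2))) * hst
    _ ≤ 2 * √t * 1 + t * |c| * 1 := by gcongr
    _ = _ := by ring

theorem one_add_sq_le_norm_one_sub_lineSymbol (c m : ℝ) : 1 + m ^ 2 ≤ ‖1 - lineSymbol c m‖ := by
  refine le_trans (le_of_eq ?_) (Complex.re_le_norm _)
  rw [Complex.sub_re, re_lineSymbol, Complex.one_re]; ring

theorem norm_inv_one_sub_lineSymbol_sub_le (c m m' : ℝ) :
    ‖(1 - lineSymbol c m)⁻¹ - (1 - lineSymbol c m')⁻¹‖ ≤ (1 + |c|) * |m - m'| := by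
  have h := one_add_sq_le_norm_one_sub_lineSymbol c m
  have h' := one_add_sq_le_norm_one_sub_lineSymbol c m'
  have hp : 0 < ‖1 - lineSymbol c m‖ := by nlinarith [sq_nonneg m]
  have hp' : 0 < ‖1 - lineSymbol c m'‖ := by nlinarith [sq_nonneg m']
  rw [inv_sub_inv (norm_pos_iff.1 hp) (norm_pos_iff.1 hp'), norm_div, norm_mul,
    div_le_iff₀ (by positivity)]
  have h1 : 1 - lineSymbol c m' - (1 - lineSymbol c m) =
      ((m - m' : ℝ) : ℂ) * (-(m + m') + Complex.I * c) := by
    simp only [lineSymbol]; push_cast; ring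
  have h2 : ‖-(m + m' : ℂ) + Complex.I * c‖ ≤ |m| + |m'| + |c| := by
    refine (norm_add_le _ _).trans ?_
    simp only [norm_neg, norm_mul, Complex.norm_I, one_mul, Complex.norm_real, Real.norm_eq_abs]
    gcongr
    refine (norm_add_le _ _).trans_eq ?_
    simp
  have h3 : |m| + |m'| + |c| ≤ (1 + |c|) * (‖1 - lineSymbol c m‖ * ‖1 - lineSymbol c m'‖) := by
    have h4 : (1 + m ^ 2) * (1 + m' ^ 2) ≤ ‖1 - lineSymbol c m‖ * ‖1 - lineSymbol c m'‖ := by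
      gcongr
    refine le_trans ?_ (mul_le_mul_of_nonneg_left h4 (by positivity))
    nlinarith [sq_nonneg (|m| - 1), sq_nonneg (|m'| - 1), sq_abs m, sq_abs m', abs_nonneg c,
      mul_nonneg (sq_nonneg m) (sq_nonneg m'), mul_nonneg (abs_nonneg c) (sq_nonneg m),
      mul_nonneg (abs_nonneg c) (sq_nonneg m'),
      mul_nonneg (abs_nonneg c) (mul_nonneg (sq_nonneg m) (sq_nonneg m'))]
  rw [h1, norm_mul, Complex.norm_real, Real.norm_eq_abs]
  calc |m - m'| * ‖-(m + m' : ℂ) + Complex.I * c‖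
      ≤ |m - m'| * ((1 + |c|) * (‖1 - lineSymbol c m‖ * ‖1 - lineSymbol c m'‖)) := by
        gcongr; exact h2.trans h3
    _ = _ := by ring

variable {n : ℕ}

theorem re_blochSymbol_nonpos (c ξ : ℝ) (i : ℤ × Fin n) : (blochSymbol c ξ i).re ≤ 0 :=
  re_lineSymbol_nonpos _ _

theorem finite_lt_re_blochSymbol (c ξ κ : ℝ) :
    {i : ℤ × Fin n | -κ < (blochSymbol c ξ i).re}.Finite := by
  refine ((finite_Icc (-⌈|ξ| + |κ| + 1⌉) ⌈|ξ| + |κ| + 1⌉).prod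
    (finite_univ (α := Fin n))).subset fun i hi => ⟨?_, mem_univ _⟩
  have h1 : (2 * Real.pi * i.1 + ξ) ^ 2 < κ := by
    have : -κ < (blochSymbol c ξ i).re := hi
    rw [blochSymbol, re_lineSymbol] at this; linarith
  have h2 : |2 * Real.pi * i.1 + ξ| ≤ |κ| + 1 := by
    refine abs_le_of_sq_le_sq ?_ (by positivity)
    nlinarith [le_abs_self κ, abs_nonneg κ]
  have h3 : |(i.1 : ℝ)| ≤ |ξ| + |κ| + 1 := by
    have h4 : |2 * Real.pi * i.1| ≤ |κ| + 1 + |ξ| := by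
      calc |2 * Real.pi * i.1| = |(2 * Real.pi * i.1 + ξ) - ξ| := by ring_nf
        _ ≤ _ := (abs_sub _ _).trans (by gcongr)
    rw [abs_mul, abs_of_pos (by positivity)] at h4
    nlinarith [Real.pi_gt_three, abs_nonneg (i.1 : ℝ)]
  have h5 := h3.trans (Int.le_ceil _)
  rw [← Int.cast_abs, Int.cast_le, abs_le] at h5
  exact h5

/-- Each square in a denominator is bounded below by the product of two consecutive factors, and the
resulting sum telescopes. -/
theorem tsum_inv_sq_telescoping {a : ℝ} (ha : 0 < a) (N : ℕ) :
    ∑ k ∈ Finset.range N, 1 / (1 + a * ((k : ℝ) + 1)) ^ 2 ≤ (1 - 1 / (1 + a * N)) / a := by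
  induction N with
  | zero => simp
  | succ N ih =>
    rw [Finset.sum_range_succ]
    refine (add_le_add_left ih _).trans ?_
    have h1 : 0 < 1 + a * N := by positivity
    have h2 : 1 / (1 + a * ((N : ℝ) + 1)) ^ 2 ≤
        (1 / (1 + a * N) - 1 / (1 + a * ((N : ℝ) + 1))) / a := by
      have h3 : (1 / (1 + a * N) - 1 / (1 + a * ((N : ℝ) + 1))) / a =
          1 / ((1 + a * N) * (1 + a * (N + 1))) := by field_simp; ring
      rw [h3, sq]
      gcongr
      linarith
    have h4 : (1 - 1 / (1 + a * ((N + 1 : ℕ) : ℝ))) / a = (1 - 1 / (1 + a * N)) / a +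
        (1 / (1 + a * N) - 1 / (1 + a * ((N : ℝ) + 1))) / a := by push_cast; ring
    rw [h4]
    linarith

theorem exists_hasSum_inv_sq {a : ℝ} (ha : 0 < a) :
    ∃ S ≤ 1 + 2 / a, HasSum (fun k : ℤ => 1 / (1 + a * |(k : ℝ)|) ^ 2) S := by
  have hle : ∀ N, ∑ k ∈ Finset.range N, 1 / (1 + a * ((k : ℝ) + 1)) ^ 2 ≤ 1 / a := fun N =>
    (tsum_inv_sq_telescoping ha N).trans (by
      gcongr
      have : 0 ≤ 1 / (1 + a * (N : ℝ)) := by positivity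
      linarith)
  have hs := summable_of_sum_range_le (f := fun k : ℕ => 1 / (1 + a * ((k : ℝ) + 1)) ^ 2)
    (fun k => by positivity) hle
  have hb := Real.tsum_le_of_sum_range_le (f := fun k : ℕ => 1 / (1 + a * ((k : ℝ) + 1)) ^ 2)
    (fun k => by positivity) hle
  have h1 : HasSum (fun k : ℕ => 1 / (1 + a * |((k : ℤ) : ℝ)|) ^ 2)
      (1 + ∑' k : ℕ, 1 / (1 + a * ((k : ℝ) + 1)) ^ 2) := by
    rw [← hasSum_nat_add_iff' 1]
    simpa [abs_of_nonneg (add_nonneg (Nat.cast_nonneg _) zero_le_one : (0 : ℝ) ≤ _)] using! hs.hasSum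
  have h2 : HasSum (fun k : ℕ => 1 / (1 + a * |((-(k + 1 : ℤ) : ℤ) : ℝ)|) ^ 2)
      (∑' k : ℕ, 1 / (1 + a * ((k : ℝ) + 1)) ^ 2) := by
    convert! hs.hasSum using 4 with k
    push_cast
    rw [abs_neg, abs_of_nonneg (by positivity)]
  refine ⟨_, ?_, HasSum.of_nat_of_neg_add_one h1 h2⟩
  have : 2 / a = 1 / a + 1 / a := by ring
  linarith

/-- The Gaussian sum is compared with `∑ 1/(1 + √t |k|)²`, of order `t^{-1/2}`; its square root is
the smoothing rate `t^{-1/4}`. The constant `6n` collects the `n` components, a factor `2` from the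
comparison and a factor `3` from `1 + 2/√t ≤ 3/√t`. -/
theorem sum_exp_re_blochSymbol_le (c : ℝ) {ξ : ℝ} (hξ : ξ ∈ Icc (-Real.pi) Real.pi) {t : ℝ}
    (ht : t ∈ Ioc (0 : ℝ) 1) (s : Finset (ℤ × Fin n)) :
    ∑ i ∈ s, Real.exp (2 * t * (blochSymbol c ξ i).re) ≤ (√(6 * n) * t ^ (-(1 / 4 : ℝ))) ^ 2 := by
  classical
  obtain ⟨ht0, ht1⟩ := ht
  have ha : 0 < √t := Real.sqrt_pos.2 ht0
  have ha1 : √t ≤ 1 := Real.sqrt_le_one.2 ht1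
  -- From `|ξ| ≤ π` follows `|2πk + ξ| ≥ |k|`, and with `y = √t |k|` one has `(1 + y)² ≤ 2(1 + 2y²)
  -- ≤ 2 e^{2y²}`.
  have hterm : ∀ i : ℤ × Fin n, Real.exp (2 * t * (blochSymbol c ξ i).re) ≤
      2 * (1 / (1 + √t * |(i.1 : ℝ)|) ^ 2) := fun i => by
    have h1 : |(i.1 : ℝ)| ≤ |2 * Real.pi * i.1 + ξ| := by
      have h2 : |2 * Real.pi * i.1| ≤ |2 * Real.pi * i.1 + ξ| + |ξ| := by
        calc |2 * Real.pi * i.1| = |(2 * Real.pi * i.1 + ξ) - ξ| := by ring_nf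
          _ ≤ _ := abs_sub _ _
      have h3 : |ξ| ≤ Real.pi := abs_le.2 hξ
      rw [abs_mul, abs_of_pos (by positivity)] at h2
      rcases eq_or_ne i.1 0 with h0 | h0
      · simp [h0]
      have h4 : (1 : ℝ) ≤ |(i.1 : ℝ)| := by exact_mod_cast Int.one_le_abs h0
      nlinarith [Real.pi_gt_three]
    have h2 : (i.1 : ℝ) ^ 2 ≤ (2 * Real.pi * i.1 + ξ) ^ 2 := sq_le_sq.2 h1
    rw [blochSymbol, re_lineSymbol, mul_neg, Real.exp_neg, ← one_div, mul_one_div,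
      div_le_div_iff₀ (Real.exp_pos _) (by positivity), one_mul]
    have h3 := Real.add_one_le_exp (2 * t * (2 * Real.pi * i.1 + ξ) ^ 2)
    have h4 : 2 * t * (i.1 : ℝ) ^ 2 ≤ 2 * t * (2 * Real.pi * i.1 + ξ) ^ 2 := by gcongr
    have h5 : (√t * |(i.1 : ℝ)|) ^ 2 = t * (i.1 : ℝ) ^ 2 := by
      rw [mul_pow, Real.sq_sqrt ht0.le, sq_abs]
    nlinarith [sq_nonneg (√t * |(i.1 : ℝ)| - 1)]
  obtain ⟨S, hS, hsum⟩ := exists_hasSum_inv_sq ha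
  calc ∑ i ∈ s, Real.exp (2 * t * (blochSymbol c ξ i).re)
      ≤ ∑ i ∈ s, 2 * (1 / (1 + √t * |(i.1 : ℝ)|) ^ 2) := Finset.sum_le_sum fun i _ => hterm i
    _ ≤ ∑ i ∈ s.image Prod.fst ×ˢ Finset.univ, 2 * (1 / (1 + √t * |(i.1 : ℝ)|) ^ 2) :=
      Finset.sum_le_sum_of_subset_of_nonneg (fun i hi => Finset.mem_product.2
        ⟨Finset.mem_image_of_mem _ hi, Finset.mem_univ _⟩) fun i _ _ => by positivity
    _ = (2 * n) * ∑ k ∈ s.image Prod.fst, 1 / (1 + √t * |(k : ℝ)|) ^ 2 := by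
      rw [Finset.sum_product, Finset.mul_sum]
      refine Finset.sum_congr rfl fun k _ => ?_
      simp only [Finset.sum_const, Finset.card_univ, Fintype.card_fin, nsmul_eq_mul]; ring
    _ ≤ (2 * n) * (1 + 2 / √t) := by
      gcongr
      exact (sum_le_hasSum _ (fun k _ => by positivity) hsum).trans hS
    _ ≤ (2 * n) * (3 / √t) := by
      gcongr
      have : 1 ≤ 1 / √t := by rw [le_div_iff₀ ha]; linarith
      have h3 : 3 / √t = 1 / √t + 2 / √t := by ring
      linarith
    _ = (√(6 * n) * t ^ (-(1 / 4 : ℝ))) ^ 2 := by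
      rw [mul_pow, Real.sq_sqrt (by positivity), ← Real.rpow_natCast (t ^ _), ← Real.rpow_mul ht0.le,
        Real.sqrt_eq_rpow]
      norm_num
      rw [Real.rpow_neg ht0.le]
      field_simp; ring

section Continuity

variable {H : Type*} [NormedAddCommGroup H] [InnerProductSpace ℂ H]
  {b : HilbertBasis (ℤ × Fin n) ℂ H} {B : H →L[ℂ] H} {T : ℝ → ℝ → H →L[ℂ] H}

theorem continuous_diagResolvent_blochSymbol (b : HilbertBasis (ℤ × Fin n) ℂ H) (c : ℝ) :
    Continuous fun ξ => diagResolvent b (blochSymbol c ξ) := by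
  refine (LipschitzWith.of_dist_le_mul (K := Real.toNNReal (1 + |c|)) fun ξ ξ' => ?_).continuous
  rw [dist_eq_norm, Real.coe_toNNReal _ (by positivity), Real.dist_eq]
  refine ContinuousLinearMap.opNorm_le_bound _ (by positivity) fun v => ?_
  rw [sub_apply]
  refine norm_diagOp_sub_apply_le b (by positivity)
    (fun i => norm_inv_one_sub_le (re_blochSymbol_nonpos c ξ i))
    (fun i => norm_inv_one_sub_le (re_blochSymbol_nonpos c ξ' i)) (fun i => ?_) v
  refine (norm_inv_one_sub_lineSymbol_sub_le _ _ _).trans_eq ?_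
  rw [add_sub_add_left_eq_sub]

theorem continuous_isDuhamel_blochSymbol [CompleteSpace H] {c : ℝ}
    (hT : ∀ ξ, IsDuhamel b (blochSymbol c ξ) B (T ξ)) {t : ℝ} (ht : 0 ≤ t) :
    Continuous fun ξ => T ξ t := by
  set M : ℝ := (1 + t * (‖B‖ * Real.exp (‖B‖ * t))) * Real.exp (‖B‖ * t) with hM
  refine (LipschitzWith.of_dist_le_mul (K := Real.toNNReal ((2 * √t + t * |c|) * M))
    fun ξ ξ' => ?_).continuous
  rw [dist_eq_norm, Real.coe_toNNReal _ (by positivity), Real.dist_eq, mul_right_comm]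
  refine IsDuhamel.norm_sub_le (re_blochSymbol_nonpos c ξ) (re_blochSymbol_nonpos c ξ') (hT ξ)
    (hT ξ') (by positivity) ht fun s hs i => ?_
  refine (norm_exp_lineSymbol_sub_le c hs.1 _ _).trans ?_
  rw [add_sub_add_left_eq_sub]
  gcongr <;> exact hs.2

end Continuity

end Symbol

/-! ### The Fourier basis of vector-valued periodic functions -/

section PeriodicBasis

theorem volume_unitAddCircle :
    (volume : Measure UnitAddCircle) = AddCircle.haarAddCircle := by
  rw [AddCircle.volume_eq_smul_haarAddCircle, ENNReal.ofReal_one, one_smul]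

theorem measurePreserving_coe_unitAddCircle (a : ℝ) :
    MeasurePreserving (fun x : ℝ => (x : UnitAddCircle)) (volume.restrict (Ioc a (a + 1)))
      AddCircle.haarAddCircle :=
  volume_unitAddCircle ▸ UnitAddCircle.measurePreserving_mk a

theorem quasiMeasurePreserving_coe_unitAddCircle :
    Measure.QuasiMeasurePreserving (fun x : ℝ => (x : UnitAddCircle)) volume
      AddCircle.haarAddCircle := by
  refine ⟨AddCircle.measurable_mk', Measure.AbsolutelyContinuous.mk fun s hs h0 => ?_⟩
  rw [Measure.map_apply AddCircle.measurable_mk' hs]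
  have h1 : ∀ m : ℤ, volume ((fun x : ℝ => (x : UnitAddCircle)) ⁻¹' s ∩ Ioc (m : ℝ) (m + 1)) = 0 := by
    intro m
    rw [← Measure.restrict_apply (AddCircle.measurable_mk' hs),
      (measurePreserving_coe_unitAddCircle m).measure_preimage hs.nullMeasurableSet, h0]
  rw [← inter_univ (_ ⁻¹' s), ← iUnion_Ioc_intCast ℝ, inter_iUnion]
  exact measure_iUnion_null h1

theorem ae_eq_of_ae_eq_comp_coe {E : Type*} [TopologicalSpace E] [TopologicalSpace.MetrizableSpace E]
    {f g : UnitAddCircle → E}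
    (hf : AEStronglyMeasurable f AddCircle.haarAddCircle)
    (hg : AEStronglyMeasurable g AddCircle.haarAddCircle)
    (h : ∀ᵐ x : ℝ, f (x : UnitAddCircle) = g (x : UnitAddCircle)) :
    f =ᵐ[AddCircle.haarAddCircle] g := by
  have h1 := (measurePreserving_coe_unitAddCircle 0).measure_preimage
    (s := {x | f x = g x}ᶜ) (hf.nullMeasurableSet_eq_fun hg).compl
  rw [EventuallyEq, ae_iff]
  refine h1.symm.trans ?_
  exact measure_mono_null (fun x hx => hx) (ae_restrict_of_ae h)

variable {n : ℕ}

theorem integrable_coeFn (v : L2Per n) : Integrable v AddCircle.haarAddCircle :=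
  (Lp.memLp v).integrable one_le_two

theorem fourierCoeff_apply (v : L2Per n) (k : ℤ) (j : Fin n) :
    fourierCoeff (v : UnitAddCircle → CVec n) k j =
      fourierCoeff (fun x => (v : UnitAddCircle → CVec n) x j) k := by
  have h : Integrable (fun x : UnitAddCircle => fourier (-k) x • v x) AddCircle.haarAddCircle :=
    (integrable_coeFn v).bdd_smul (φ := fun x => fourier (-k) x) 1
      (fourier (-k)).continuous.aestronglyMeasurable
      (Eventually.of_forall fun x => (Circle.norm_coe _).le)
  exact ((EuclideanSpace.proj j : CVec n →L[ℂ] ℂ).integral_comp_comm h).symm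

theorem coeFn_mode (k : ℤ) (a : CVec n) :
    mode k a =ᵐ[AddCircle.haarAddCircle] fun x => fourier k x • a :=
  ContinuousMap.coeFn_toLp _ _

/-- The function `x ↦ e^{2πikx}` times the `j`-th unit vector. -/
def modeVec (i : ℤ × Fin n) : L2Per n := mode i.1 (EuclideanSpace.single i.2 1)

theorem inner_modeVec (i : ℤ × Fin n) (v : L2Per n) :
    inner ℂ (modeVec i) v = fourierCoeff (v : UnitAddCircle → CVec n) i.1 i.2 := by
  rw [fourierCoeff_apply, L2.inner_def]
  refine integral_congr_ae ?_
  filter_upwards [coeFn_mode i.1 (EuclideanSpace.single i.2 (1 : ℂ))] with x hx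
  rw [modeVec, hx, inner_smul_left, EuclideanSpace.inner_single_left, map_one, one_mul,
    fourier_neg, smul_eq_mul]

theorem fourierCoeff_mode (k k' : ℤ) (a : CVec n) :
    fourierCoeff (mode k a : UnitAddCircle → CVec n) k' = (Pi.single k (1 : ℂ) : ℤ → ℂ) k' • a := by
  rw [fourierCoeff_congr_ae (coeFn_mode k a), ← fourierCoeff_fourier (T := 1)]
  simp only [fourierCoeff, ← smul_assoc]
  rw [integral_smul_const]

theorem orthonormal_modeVec : Orthonormal ℂ (modeVec (n := n)) := by
  classical
  rw [orthonormal_iff_ite]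
  rintro ⟨k, j⟩ ⟨k', j'⟩
  rw [inner_modeVec, modeVec, fourierCoeff_mode]
  simp only [Pi.single_apply, PiLp.smul_apply, PiLp.single_apply, smul_eq_mul,
    Prod.mk.injEq, ite_and, ite_mul, one_mul, zero_mul]

theorem eq_zero_of_fourierCoeff_eq_zero {v : L2Per n}
    (h : ∀ k j, fourierCoeff (v : UnitAddCircle → CVec n) k j = 0) : v = 0 := by
  have key : ∀ j : Fin n, ∀ᵐ x ∂AddCircle.haarAddCircle,
      (v : UnitAddCircle → CVec n) x j = 0 := fun j => by
    have h1 : ((EuclideanSpace.proj j : CVec n →L[ℂ] ℂ).compLp v :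
        Lp ℂ 2 (AddCircle.haarAddCircle : Measure UnitAddCircle)) = 0 := by
      apply ext_repr fourierBasis
      intro k
      rw [fourierBasis_repr, fourierCoeff_congr_ae (ContinuousLinearMap.coeFn_compLp _ v), map_zero,
        lp.coeFn_zero, Pi.zero_apply, ← h k j, fourierCoeff_apply]
      rfl
    have h2 := ContinuousLinearMap.coeFn_compLp
      (EuclideanSpace.proj j : CVec n →L[ℂ] ℂ) v
    rw [h1] at h2
    filter_upwards [h2, Lp.coeFn_zero ℂ 2 (AddCircle.haarAddCircle : Measure UnitAddCircle)]
      with x h3 h4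
    rw [h4] at h3
    exact h3.symm
  refine Lp.eq_zero_iff_ae_eq_zero.2 ?_
  filter_upwards [ae_all_iff.2 key] with x hx
  ext j
  exact hx j

/-- The Hilbert basis of `L²_per` formed by the vector-valued exponentials. -/
def periodicBasis (n : ℕ) : HilbertBasis (ℤ × Fin n) ℂ (L2Per n) :=
  HilbertBasis.mkOfOrthogonalEqBot orthonormal_modeVec (by
    rw [Submodule.eq_bot_iff]
    intro v hv
    rw [Submodule.mem_orthogonal] at hv
    refine eq_zero_of_fourierCoeff_eq_zero fun k j => ?_
    rw [← inner_modeVec (k, j)]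
    exact hv _ (Submodule.subset_span (mem_range_self _)))

theorem coe_periodicBasis : ⇑(periodicBasis n) = modeVec :=
  HilbertBasis.coe_mkOfOrthogonalEqBot _ _

theorem repr_periodicBasis (v : L2Per n) (i : ℤ × Fin n) :
    (periodicBasis n).repr v i = fourierCoeff (v : UnitAddCircle → CVec n) i.1 i.2 := by
  rw [HilbertBasis.repr_apply_apply, coe_periodicBasis, inner_modeVec]

theorem isBlochDeriv_iff {ξ : ℝ} {v w : L2Per n} :
    IsBlochDeriv ξ v w ↔ ∀ i, (periodicBasis n).repr w i =
      (Complex.I * ((2 * Real.pi * i.1 + ξ : ℝ) : ℂ)) * (periodicBasis n).repr v i := by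
  simp only [repr_periodicBasis, Prod.forall]
  refine forall_congr' fun k => ?_
  rw [PiLp.ext_iff]
  push_cast
  rfl

end PeriodicBasis

/-! ### Bloch operators as perturbed diagonal operators -/

section Linearization

variable {n : ℕ}

/-- The complexification of a real-linear map as a continuous complex-linear map. -/
def complexifyCLM (M : RVec n →L[ℝ] RVec n) : CVec n →L[ℂ] CVec n :=
  Matrix.toEuclideanCLM (n := Fin n) (𝕜 := ℂ)
    (Matrix.of fun i j => ((M (EuclideanSpace.single j (1 : ℝ)) i : ℝ) : ℂ))

theorem complexifyCLM_apply (M : RVec n →L[ℝ] RVec n) (v : CVec n) :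
    complexifyCLM M v = complexify M v := rfl

theorem continuous_complexifyCLM : Continuous (complexifyCLM (n := n)) := by
  have h : Continuous (Matrix.toEuclideanCLM (n := Fin n) (𝕜 := ℂ)) :=
    LinearMap.continuous_of_finiteDimensional
      ((Matrix.toEuclideanCLM (n := Fin n) (𝕜 := ℂ)).toAlgEquiv.toLinearMap)
  refine h.comp (continuous_matrix fun i j => ?_)
  simp only [Matrix.of_apply]
  fun_prop

/-- The linearized reaction term `df(ū)` along a periodic profile, as a function on the circle. -/
theorem exists_potential {c : ℝ} {f : RVec n → RVec n} {u : ℝ → RVec n} {K : ℕ} (hK : 1 ≤ K)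
    (hf : ContDiff ℝ K f) (hu : IsPeriodicStandingWave c f u) :
    ∃ A : C(UnitAddCircle, CVec n →L[ℂ] CVec n),
      ∀ x : ℝ, A x = complexifyCLM (fderiv ℝ f (u x)) := by
  have hper : Function.Periodic (fun x => complexifyCLM (fderiv ℝ f (u x))) 1 := fun x => by
    simp only [hu.2.1 x]
  have hcont : Continuous fun x => complexifyCLM (fderiv ℝ f (u x)) :=
    continuous_complexifyCLM.comp ((hf.continuous_fderiv (by
      exact_mod_cast (by omega : K ≠ 0))).comp hu.1.continuous)
  exact ⟨⟨hper.lift, continuous_coinduced_dom.2 hcont⟩, fun x => rfl⟩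

/-- The multiplication operator on `L²_per` with a continuous operator-valued coefficient. -/
def multiplication (A : C(UnitAddCircle, CVec n →L[ℂ] CVec n)) : L2Per n →L[ℂ] L2Per n :=
  (ContinuousLinearMap.id ℂ (CVec n →L[ℂ] CVec n)).holderL AddCircle.haarAddCircle ∞ 2 2
    (ContinuousMap.toLp ∞ AddCircle.haarAddCircle ℂ A)

theorem coeFn_multiplication (A : C(UnitAddCircle, CVec n →L[ℂ] CVec n)) (v : L2Per n) :
    multiplication A v =ᵐ[AddCircle.haarAddCircle] fun x => A x (v x) := by
  have h := (ContinuousLinearMap.id ℂ (CVec n →L[ℂ] CVec n)).coeFn_holder (r := 2)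
    (ContinuousMap.toLp ∞ (AddCircle.haarAddCircle : Measure UnitAddCircle) ℂ A) v
  filter_upwards [h, ContinuousMap.coeFn_toLp (p := ∞) (𝕜 := ℂ)
    (AddCircle.haarAddCircle : Measure UnitAddCircle) A] with x hx hA
  refine Eq.trans hx ?_
  rw [hA]
  rfl

/-- A weak derivative multiplies coefficients by `i(2πk + ξ)`, so second and first order terms
combine into the symbol. The content is the domain: if only the combination `D v` is in `L²_per`,
both derivatives must be recovered separately. -/
theorem blochOp_eq_perturbedDiag {c : ℝ} {f : RVec n → RVec n} {u : ℝ → RVec n}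
    {A : C(UnitAddCircle, CVec n →L[ℂ] CVec n)}
    (hA : ∀ x : ℝ, A x = complexifyCLM (fderiv ℝ f (u x))) (ξ : ℝ) :
    BlochOp c f u ξ = perturbedDiag (periodicBasis n) (blochSymbol c ξ) (multiplication A) := by
  set b := periodicBasis n with hb
  have hae : ∀ v w v₁ v₂ : L2Per n, (∀ᵐ x : ℝ, w (x : UnitAddCircle) =
      v₂ (x : UnitAddCircle) + (c : ℂ) • v₁ (x : UnitAddCircle) +
        complexify (fderiv ℝ f (u x)) (v (x : UnitAddCircle))) ↔
      w = v₂ + (c : ℂ) • v₁ + multiplication A v := by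
    intro v w v₁ v₂
    have h1 : (v₂ + (c : ℂ) • v₁ + multiplication A v : L2Per n) =ᵐ[AddCircle.haarAddCircle]
        fun x => v₂ x + (c : ℂ) • v₁ x + A x (v x) := by
      filter_upwards [Lp.coeFn_add (v₂ + (c : ℂ) • v₁) (multiplication A v),
        Lp.coeFn_add v₂ ((c : ℂ) • v₁), Lp.coeFn_smul (c : ℂ) v₁, coeFn_multiplication A v]
        with x h1 h2 h3 h4
      rw [h1, Pi.add_apply, h2, Pi.add_apply, h3, Pi.smul_apply, h4]
    have h2 := quasiMeasurePreserving_coe_unitAddCircle.ae h1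
    constructor
    · intro h
      refine Lp.ext (ae_eq_of_ae_eq_comp_coe (Lp.aestronglyMeasurable _)
        (Lp.aestronglyMeasurable _) ?_)
      filter_upwards [h, h2] with x h3 h4
      rw [h3, h4, hA, complexifyCLM_apply]
    · rintro rfl
      filter_upwards [h2] with x h4
      rw [h4, hA, complexifyCLM_apply]
  have hsym : ∀ i : ℤ × Fin n, (Complex.I * ((2 * Real.pi * i.1 + ξ : ℝ) : ℂ)) *
      (Complex.I * ((2 * Real.pi * i.1 + ξ : ℝ) : ℂ)) +
      c * (Complex.I * ((2 * Real.pi * i.1 + ξ : ℝ) : ℂ)) = blochSymbol c ξ i := fun i => by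
    rw [blochSymbol, lineSymbol]
    linear_combination ((2 * Real.pi * i.1 + ξ : ℝ) : ℂ) ^ 2 * Complex.I_mul_I
  funext v w
  simp only [BlochOp, isBlochDeriv_iff, hae, eq_iff_iff, ← hb]
  constructor
  · rintro ⟨v₁, v₂, h₁, h₂, rfl⟩ i
    simp only [map_add, map_smul, lp.coeFn_add, lp.coeFn_smul, Pi.add_apply, Pi.smul_apply,
      smul_eq_mul, h₂ i, h₁ i, ← hsym i]
    ring
  · intro h
    have hdv : Summable fun i => ‖blochSymbol c ξ i * b.repr v i‖ ^ 2 := by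
      have h1 : ∀ i, blochSymbol c ξ i * b.repr v i = b.repr (w - multiplication A v) i := fun i => by
        rw [map_sub, lp.coeFn_sub, Pi.sub_apply, h i, add_sub_cancel_right]
      simp only [h1]
      exact (hasSum_norm_sq_repr b _).summable
    -- The real part of the symbol is `-(2πk + ξ)²`, so the symbol dominates the second derivative,
    -- and the first one through `m² ≤ 1 + ‖d‖²`.
    have hnd : ∀ i : ℤ × Fin n, (2 * Real.pi * i.1 + ξ) ^ 2 ≤ ‖blochSymbol c ξ i‖ := fun i => by
      have h1 := Complex.abs_re_le_norm (blochSymbol c ξ i)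
      rwa [blochSymbol, re_lineSymbol, abs_neg, abs_of_nonneg (sq_nonneg _)] at h1
    obtain ⟨v₁, h₁⟩ := exists_repr_eq b
      (a := fun i => (Complex.I * ((2 * Real.pi * i.1 + ξ : ℝ) : ℂ)) * b.repr v i)
      (Summable.of_nonneg_of_le (fun i => sq_nonneg _) (fun i => by
        simp only [norm_mul (Complex.I * _), norm_mul Complex.I, mul_pow, Complex.norm_I, one_mul,
          Complex.norm_real, Real.norm_eq_abs, sq_abs]
        have h2 : (2 * Real.pi * i.1 + ξ) ^ 2 ≤ 1 + ‖blochSymbol c ξ i‖ ^ 2 := by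
          nlinarith [hnd i, sq_nonneg (‖blochSymbol c ξ i‖ - 1)]
        calc (2 * Real.pi * i.1 + ξ) ^ 2 * ‖b.repr v i‖ ^ 2
            ≤ (1 + ‖blochSymbol c ξ i‖ ^ 2) * ‖b.repr v i‖ ^ 2 := by gcongr
          _ = ‖b.repr v i‖ ^ 2 + ‖blochSymbol c ξ i * b.repr v i‖ ^ 2 := by
            rw [norm_mul]; ring) ((hasSum_norm_sq_repr b v).summable.add hdv))
    obtain ⟨v₂, h₂⟩ := exists_repr_eq b
      (a := fun i => (Complex.I * ((2 * Real.pi * i.1 + ξ : ℝ) : ℂ)) * b.repr v₁ i)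
      (Summable.of_nonneg_of_le (fun i => sq_nonneg _) (fun i => by
        rw [h₁]
        simp only [norm_mul, Complex.norm_I, one_mul, Complex.norm_real, Real.norm_eq_abs]
        rw [← mul_assoc, abs_mul_abs_self, ← sq]
        gcongr
        exact hnd i) hdv)
    refine ⟨v₁, v₂, h₁, h₂, ext_repr b fun i => ?_⟩
    simp only [map_add, map_smul, lp.coeFn_add, lp.coeFn_smul, Pi.add_apply, Pi.smul_apply,
      smul_eq_mul, h i, h₂ i, h₁ i, ← hsym i]
    ring

end Linearization

/-! ### Plancherel for the Bloch transform -/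

section BlochTransform

theorem lintegral_enorm_sq {α E : Type*} [NormedAddCommGroup E] {m : MeasurableSpace α}
    {μ : Measure α} (f : Lp E 2 μ) : ∫⁻ x, ‖f x‖ₑ ^ 2 ∂μ = ‖f‖ₑ ^ 2 := by
  have h := eLpNorm_nnreal_pow_eq_lintegral (f := f) (μ := μ) (p := 2) two_ne_zero
  rw [Lp.enorm_def]
  simpa using! h.symm

/-- An integral over the line as an integral over a period cell. -/
theorem lintegral_eq_lintegral_tsum_translates {F : ℝ → ℝ≥0∞} (hF : AEMeasurable F) (a : ℝ)
    {T : ℝ} (hT : 0 < T) : ∫⁻ x, F x = ∫⁻ x in Ioc a (a + T), ∑' k : ℤ, F (x + k * T) := by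
  rw [lintegral_tsum (f := fun (k : ℤ) x => F (x + k * T)) fun k => (hF.comp_quasiMeasurePreserving
      (measurePreserving_add_right volume _).quasiMeasurePreserving).restrict,
    ← setLIntegral_univ, ← iUnion_Ioc_add_zsmul hT a,
    lintegral_iUnion (fun _ => measurableSet_Ioc) (pairwise_disjoint_Ioc_add_zsmul a T)]
  refine tsum_congr fun k => ?_
  rw [← (measurePreserving_add_right volume (k * T)).setLIntegral_comp_preimage_emb
    (measurableEmbedding_addRight _)]
  congr 3
  ext x
  simp only [mem_preimage, mem_Ioc, zsmul_eq_mul, Int.cast_add, Int.cast_one]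
  constructor <;> rintro ⟨h1, h2⟩ <;> constructor <;> linarith

variable {n : ℕ}

theorem stronglyMeasurable_fourierHat (g : L2Line n) : StronglyMeasurable (fourierHat g) :=
  (Lp.stronglyMeasurable _).comp_measurable (measurable_id.div_const _)

theorem lintegral_enorm_sq_fourierHat (g : L2Line n) :
    ∫⁻ η, ‖fourierHat g η‖ₑ ^ 2 = ENNReal.ofReal (2 * Real.pi) * ‖g‖ₑ ^ 2 := by
  have h2 : (2 * Real.pi : ℝ) ≠ 0 := by positivity
  have hm : Measurable fun η => ‖fourierHat g η‖ₑ ^ 2 :=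
    (stronglyMeasurable_fourierHat g).enorm.pow_const 2
  have h1 := congrArg (fun μ => ∫⁻ η, ‖fourierHat g η‖ₑ ^ 2 ∂μ) (Real.smul_map_volume_mul_left h2)
  rw [lintegral_smul_measure, lintegral_map hm (measurable_const_mul _), abs_of_pos (by positivity),
    smul_eq_mul] at h1
  rw [← h1]
  congr 1
  simp only [fourierHat, mul_div_cancel_left₀ _ h2]
  rw [lintegral_enorm_sq, ← ofReal_norm, Lp.norm_fourier_eq, ofReal_norm]

/-- The measure of the Brillouin zone `[-π, π]`. -/
abbrev brillouin : Measure ℝ := volume.restrict (Icc (-Real.pi) Real.pi)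

theorem lintegral_tsum_fourierHat (g : L2Line n) :
    ∫⁻ ξ, ∑' k : ℤ, ‖fourierHat g (ξ + 2 * Real.pi * k)‖ₑ ^ 2 ∂brillouin =
      ENNReal.ofReal (2 * Real.pi) * ‖g‖ₑ ^ 2 := by
  rw [← lintegral_enorm_sq_fourierHat, lintegral_eq_lintegral_tsum_translates
    ((stronglyMeasurable_fourierHat g).enorm.pow_const 2).aemeasurable (-Real.pi) Real.two_pi_pos,
    brillouin, Measure.restrict_congr_set Ioc_ae_eq_Icc.symm]
  simp only [mul_comm]
  rw [show -Real.pi + Real.pi * 2 = Real.pi by ring]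


theorem enorm_sq_eq_tsum {ι H : Type*} [NormedAddCommGroup H] [InnerProductSpace ℂ H]
    (b : HilbertBasis ι ℂ H) (v : H) : ‖v‖ₑ ^ 2 = ∑' i, ‖b.repr v i‖ₑ ^ 2 := by
  have h := hasSum_norm_sq_repr b v
  rw [← ofReal_norm, ← ENNReal.ofReal_pow (norm_nonneg _), ← h.tsum_eq,
    ENNReal.ofReal_tsum_of_nonneg (fun i => sq_nonneg _) h.summable]
  simp only [ENNReal.ofReal_pow (norm_nonneg _), ofReal_norm]

theorem enorm_sq_eq_sum (a : CVec n) : ‖a‖ₑ ^ 2 = ∑ j, ‖a j‖ₑ ^ 2 := by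
  rw [← ofReal_norm, ← ENNReal.ofReal_pow (norm_nonneg _), EuclideanSpace.norm_sq_eq,
    ENNReal.ofReal_sum_of_nonneg fun i _ => sq_nonneg _]
  simp only [ENNReal.ofReal_pow (norm_nonneg _), ofReal_norm]

theorem sum_smul_modeVec (k : ℤ) (a : CVec n) : ∑ j, a j • modeVec (k, j) = mode k a := by
  have h : ∀ j : Fin n, a j • modeVec (k, j) = mode k (a j • EuclideanSpace.single j (1 : ℂ)) := by
    intro j
    rw [modeVec, mode, mode, ← map_smul]
    congr 1
    ext x : 1
    exact smul_comm (a j) (fourier k x) (EuclideanSpace.single j (1 : ℂ))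
  have h' : ∀ s : Finset (Fin n), ∑ j ∈ s, mode k (a j • EuclideanSpace.single j (1 : ℂ)) =
      mode k (∑ j ∈ s, a j • EuclideanSpace.single j (1 : ℂ)) := by
    intro s
    simp only [mode, ← map_sum]
    congr 1
    ext x : 1
    simp [Finset.smul_sum]
  simp only [h, h']
  congr 1
  ext i
  simp [Finset.sum_apply, Pi.single_apply]

/-- Square summability makes the unordered series converge, so that `blochTransform` is its true sum
and not the default value of `tsum`. The expansion over pairs of wave number and component is
grouped by wave number. -/
theorem hasSum_mode {g : L2Line n} {ξ : ℝ}
    (h : ∑' k : ℤ, ‖fourierHat g (ξ + 2 * Real.pi * k)‖ₑ ^ 2 ≠ ⊤) :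
    HasSum (fun k : ℤ => mode k (fourierHat g (ξ + 2 * Real.pi * k))) (blochTransform g ξ) ∧
      ‖blochTransform g ξ‖ₑ ^ 2 = ∑' k : ℤ, ‖fourierHat g (ξ + 2 * Real.pi * k)‖ₑ ^ 2 := by
  set a : ℤ × Fin n → ℂ := fun i => fourierHat g (ξ + 2 * Real.pi * i.1) i.2 with ha
  have hsum : ∑' i, ‖a i‖ₑ ^ 2 = ∑' k : ℤ, ‖fourierHat g (ξ + 2 * Real.pi * k)‖ₑ ^ 2 := by
    rw [ENNReal.tsum_prod']
    refine tsum_congr fun k => ?_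
    rw [tsum_fintype, enorm_sq_eq_sum]
  have hs : Summable fun i => ‖a i‖ ^ 2 := by
    rw [← hsum] at h
    refine (ENNReal.summable_toReal h).congr fun i => ?_
    simp
  obtain ⟨v, hv⟩ := exists_repr_eq (periodicBasis n) hs
  have h1 := (periodicBasis n).hasSum_repr v
  have h2 := h1.prod_fiberwise fun k => hasSum_fintype _
  have h3 : HasSum (fun k : ℤ => mode k (fourierHat g (ξ + 2 * Real.pi * k))) v := by
    convert! h2 using 2 with k
    simp only [hv, coe_periodicBasis]
    exact (sum_smul_modeVec _ _).symm
  have h4 : blochTransform g ξ = v := h3.tsum_eq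
  rw [h4]
  refine ⟨h3, ?_⟩
  rw [enorm_sq_eq_tsum (periodicBasis n), ← hsum]
  simp only [hv]

theorem ae_tsum_fourierHat_ne_top (g : L2Line n) :
    ∀ᵐ ξ ∂brillouin, ∑' k : ℤ, ‖fourierHat g (ξ + 2 * Real.pi * k)‖ₑ ^ 2 ≠ ⊤ := by
  refine (ae_lt_top' ?_ ?_).mono fun ξ h => h.ne
  · refine AEMeasurable.tsum fun k => Measurable.aemeasurable ?_
    exact ((stronglyMeasurable_fourierHat g).enorm.pow_const 2).comp (measurable_add_const _)
  · rw [lintegral_tsum_fourierHat]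
    exact ENNReal.mul_ne_top ENNReal.ofReal_ne_top (ENNReal.pow_ne_top enorm_ne_top)

theorem lintegral_enorm_sq_blochTransform (g : L2Line n) :
    ∫⁻ ξ, ‖blochTransform g ξ‖ₑ ^ 2 ∂brillouin = ENNReal.ofReal (2 * Real.pi) * ‖g‖ₑ ^ 2 := by
  rw [← lintegral_tsum_fourierHat]
  refine lintegral_congr_ae ?_
  filter_upwards [ae_tsum_fourierHat_ne_top g] with ξ h
  exact (hasSum_mode h).2

theorem continuous_mode (k : ℤ) : Continuous (mode (n := n) k) := by
  refine (ContinuousLinearMap.continuous _).comp ?_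
  refine ContinuousMap.continuous_of_continuous_uncurry _ ?_
  exact (((fourier k).continuous.comp continuous_snd).smul continuous_fst)

theorem aestronglyMeasurable_blochTransform (g : L2Line n) :
    AEStronglyMeasurable (blochTransform g) brillouin := by
  refine aestronglyMeasurable_of_tendsto_ae (atTop : Filter (Finset ℤ))
    (f := fun s ξ => ∑ k ∈ s, mode k (fourierHat g (ξ + 2 * Real.pi * k))) (fun s => ?_) ?_
  · refine StronglyMeasurable.aestronglyMeasurable ?_
    refine Finset.stronglyMeasurable_fun_sum s fun k _ => ?_
    exact (continuous_mode k).comp_stronglyMeasurable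
      ((stronglyMeasurable_fourierHat g).comp_measurable (measurable_add_const _))
  · filter_upwards [ae_tsum_fourierHat_ne_top g] with ξ h
    exact (hasSum_mode h).1

end BlochTransform

/-! ### The inverse Bloch transform and interpolation -/

section Reconstruction

variable {n : ℕ}

theorem memLp_two_of_lintegral_ne_top {α E : Type*} [NormedAddCommGroup E] {m : MeasurableSpace α}
    {μ : Measure α} {F : α → E} (hF : AEStronglyMeasurable F μ) (h : ∫⁻ x, ‖F x‖ₑ ^ 2 ∂μ ≠ ⊤) :
    MemLp F 2 μ := by
  refine ⟨hF, ?_⟩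
  have h1 := eLpNorm_nnreal_pow_eq_lintegral (f := F) (μ := μ) (p := 2) two_ne_zero
  have h2 : eLpNorm F 2 μ ^ 2 = ∫⁻ x, ‖F x‖ₑ ^ 2 ∂μ := by simpa using! h1
  rw [← h2] at h
  exact (ENNReal.pow_lt_top_iff.1 h.lt_top).resolve_right two_ne_zero

/-- Parseval's identity on the Brillouin zone, for scalar functions. -/
theorem tsum_enorm_sq_integral_exp_mul {F : ℝ → ℂ} (hF : MemLp F 2 brillouin) :
    ∑' m : ℤ, ‖((2 * Real.pi : ℝ) : ℂ)⁻¹ * ∫ ξ in (-Real.pi)..Real.pi,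
      Complex.exp (Complex.I * ξ * m) * F ξ‖ₑ ^ 2 =
        ENNReal.ofReal (2 * Real.pi)⁻¹ * ∫⁻ ξ, ‖F ξ‖ₑ ^ 2 ∂brillouin := by
  have hab : -Real.pi < Real.pi := by linarith [Real.pi_pos]
  have hr : brillouin = volume.restrict (Ioc (-Real.pi) Real.pi) :=
    Measure.restrict_congr_set Ioc_ae_eq_Icc.symm
  rw [hr] at hF ⊢
  have h := hasSum_sq_fourierCoeffOn hab hF
  -- The integrals are Fourier coefficients on an interval of length `2π`, with reversed index.
  have hc : ∀ m : ℤ, fourierCoeffOn hab F (-m) = ((2 * Real.pi : ℝ) : ℂ)⁻¹ *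
      ∫ ξ in (-Real.pi)..Real.pi, Complex.exp (Complex.I * ξ * m) * F ξ := by
    intro m
    rw [fourierCoeffOn_eq_integral, neg_neg, Complex.real_smul, show Real.pi - -Real.pi = 2 * Real.pi
      by ring, one_div, Complex.ofReal_inv]
    congr 1
    refine intervalIntegral.integral_congr fun ξ _ => ?_
    simp only [fourier_coe_apply, smul_eq_mul]
    congr 2
    push_cast
    field_simp
  have h2 : ∫⁻ ξ in Ioc (-Real.pi) Real.pi, ‖F ξ‖ₑ ^ 2 =
      ENNReal.ofReal (∫ ξ in (-Real.pi)..Real.pi, ‖F ξ‖ ^ 2) := by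
    rw [intervalIntegral.integral_of_le hab.le, ofReal_integral_eq_lintegral_ofReal
      ((memLp_two_iff_integrable_sq_norm hF.1).1 hF) (Eventually.of_forall fun ξ => sq_nonneg _)]
    simp only [ENNReal.ofReal_pow (norm_nonneg _), ofReal_norm]
  rw [h2, ← ENNReal.ofReal_mul (by positivity), ← smul_eq_mul (2 * Real.pi)⁻¹,
    show 2 * Real.pi = Real.pi - -Real.pi by ring, ← h.tsum_eq,
    ENNReal.ofReal_tsum_of_nonneg (fun i => sq_nonneg _) h.summable,
    ← (Equiv.neg ℤ).tsum_eq (fun m => ENNReal.ofReal _)]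
  refine tsum_congr fun m => ?_
  rw [show Real.pi - -Real.pi = 2 * Real.pi by ring, ← hc m, Equiv.neg_apply,
    ENNReal.ofReal_pow (norm_nonneg _), ofReal_norm]

theorem tsum_enorm_sq_integral_exp_smul {F : ℝ → CVec n} (hF : MemLp F 2 brillouin) :
    ∑' m : ℤ, ‖((2 * Real.pi : ℝ) : ℂ)⁻¹ • ∫ ξ in (-Real.pi)..Real.pi,
      Complex.exp (Complex.I * ξ * m) • F ξ‖ₑ ^ 2 =
        ENNReal.ofReal (2 * Real.pi)⁻¹ * ∫⁻ ξ, ‖F ξ‖ₑ ^ 2 ∂brillouin := by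
  have hFj : ∀ j, MemLp (fun ξ => F ξ j) 2 brillouin := fun j =>
    (EuclideanSpace.proj j : CVec n →L[ℂ] ℂ).comp_memLp' hF
  have hint : ∀ m : ℤ, IntervalIntegrable (fun ξ : ℝ => Complex.exp (Complex.I * ξ * m) • F ξ) volume
      (-Real.pi) Real.pi := fun m => by
    rw [intervalIntegrable_iff_integrableOn_Icc_of_le (by linarith [Real.pi_pos])]
    refine (hF.integrable one_le_two).bdd_smul (φ := fun ξ : ℝ => Complex.exp (Complex.I * ξ * m)) 1
      (by fun_prop) (Eventually.of_forall fun ξ => ?_)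
    rw [Complex.norm_exp]
    simp
  have hj : ∀ (m : ℤ) (j : Fin n), (((2 * Real.pi : ℝ) : ℂ)⁻¹ • ∫ ξ in (-Real.pi)..Real.pi,
      Complex.exp (Complex.I * ξ * m) • F ξ) j = ((2 * Real.pi : ℝ) : ℂ)⁻¹ *
        ∫ ξ in (-Real.pi)..Real.pi, Complex.exp (Complex.I * ξ * m) * F ξ j := fun m j => by
    have := (EuclideanSpace.proj j : CVec n →L[ℂ] ℂ).intervalIntegral_comp_comm (hint m)
    rw [PiLp.smul_apply, smul_eq_mul]
    congr 1
    exact this.symm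
  simp only [enorm_sq_eq_sum, hj]
  rw [Summable.tsum_finsetSum fun _ _ => ENNReal.summable, lintegral_finsetSum' _ fun j _ =>
    ((hFj j).1.enorm.pow_const 2), Finset.mul_sum]
  exact Finset.sum_congr rfl fun j _ => tsum_enorm_sq_integral_exp_mul (hFj j)

/-- `(2π)⁻¹ ∫_{-π}^{π} e^{iξx} V(ξ, x) dξ`, for a function on the Brillouin zone times the circle. -/
def inverseBloch (V : ℝ → UnitAddCircle → CVec n) (x : ℝ) : CVec n :=
  ((2 * Real.pi : ℝ) : ℂ)⁻¹ • ∫ ξ in (-Real.pi)..Real.pi,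
    Complex.exp (Complex.I * ξ * x) • V ξ (x : UnitAddCircle)

variable {V : ℝ → UnitAddCircle → CVec n}

theorem quasiMeasurePreserving_swap_coe :
    Measure.QuasiMeasurePreserving (fun p : ℝ × ℝ => (p.2, (p.1 : UnitAddCircle)))
      (volume.prod brillouin) (brillouin.prod AddCircle.haarAddCircle) :=
  (QuasiMeasurePreserving.prodMap (Measure.QuasiMeasurePreserving.id brillouin)
    quasiMeasurePreserving_coe_unitAddCircle).comp
      Measure.measurePreserving_swap.quasiMeasurePreserving

theorem aestronglyMeasurable_inverseBloch
    (hV : AEStronglyMeasurable (Function.uncurry V) (brillouin.prod AddCircle.haarAddCircle)) :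
    AEStronglyMeasurable (inverseBloch V) volume := by
  have h1 : AEStronglyMeasurable (fun p : ℝ × ℝ => Complex.exp (Complex.I * p.2 * p.1) •
      V p.2 (p.1 : UnitAddCircle)) (volume.prod brillouin) :=
    AEStronglyMeasurable.smul (by fun_prop : Continuous fun p : ℝ × ℝ =>
      Complex.exp (Complex.I * p.2 * p.1)).aestronglyMeasurable (hV.comp_quasiMeasurePreserving quasiMeasurePreserving_swap_coe)
  have h2 := h1.integral_prod_right'.const_smul (((2 * Real.pi : ℝ) : ℂ)⁻¹)
  refine h2.congr (Eventually.of_forall fun x => ?_)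
  simp only [inverseBloch, Pi.smul_apply]
  rw [intervalIntegral.integral_of_le (by linarith [Real.pi_pos]), integral_Icc_eq_integral_Ioc]

/-- Almost every fibre of a function on the Brillouin zone times the circle. -/
theorem ae_ae_coe_of_ae_ae {p : ℝ → UnitAddCircle → Prop}
    (h : ∀ᵐ z ∂(brillouin.prod AddCircle.haarAddCircle), p z.1 z.2) :
    ∀ᵐ x : ℝ, ∀ᵐ ξ ∂brillouin, p ξ (x : UnitAddCircle) :=
  Measure.ae_ae_of_ae_prod (quasiMeasurePreserving_swap_coe.ae h)

theorem ae_aestronglyMeasurable_coe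
    (hV : AEStronglyMeasurable (Function.uncurry V) (brillouin.prod AddCircle.haarAddCircle)) :
    ∀ᵐ x : ℝ, AEStronglyMeasurable (fun ξ => V ξ (x : UnitAddCircle)) brillouin :=
  (hV.comp_quasiMeasurePreserving quasiMeasurePreserving_swap_coe).prodMk_left

/-- Parseval's identity for the inverse Bloch transform. -/
theorem lintegral_enorm_sq_inverseBloch
    (hV : AEStronglyMeasurable (Function.uncurry V) (brillouin.prod AddCircle.haarAddCircle))
    (hV2 : ∫⁻ ξ, ∫⁻ y, ‖V ξ y‖ₑ ^ 2 ∂AddCircle.haarAddCircle ∂brillouin ≠ ⊤) :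
    ∫⁻ x, ‖inverseBloch V x‖ₑ ^ 2 = ENNReal.ofReal (2 * Real.pi)⁻¹ *
      ∫⁻ ξ, ∫⁻ y, ‖V ξ y‖ₑ ^ 2 ∂AddCircle.haarAddCircle ∂brillouin := by
  set G : UnitAddCircle → ℝ≥0∞ := fun y => ∫⁻ ξ, ‖V ξ y‖ₑ ^ 2 ∂brillouin with hG
  have hVm : AEMeasurable (Function.uncurry fun ξ y => ‖V ξ y‖ₑ ^ 2)
      (brillouin.prod AddCircle.haarAddCircle) := hV.enorm.pow_const 2
  have hswap : ∫⁻ y, G y ∂AddCircle.haarAddCircle =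
      ∫⁻ ξ, ∫⁻ y, ‖V ξ y‖ₑ ^ 2 ∂AddCircle.haarAddCircle ∂brillouin :=
    (lintegral_lintegral_swap hVm).symm
  have hGm : AEMeasurable G AddCircle.haarAddCircle :=
    AEMeasurable.lintegral_prod_left' hVm
  have hGfin : ∀ᵐ x : ℝ, G (x : UnitAddCircle) ≠ ⊤ := by
    refine quasiMeasurePreserving_coe_unitAddCircle.ae (p := fun y => G y ≠ ⊤) ?_
    exact (ae_lt_top' hGm (hswap ▸ hV2)).mono fun y h => h.ne
  -- As `V` is periodic in `x`, the values at the translates `x + k` are the Fourier coefficients in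
  -- `ξ` of the single function `e^{iξx} V ξ x`.
  have hfib : ∀ᵐ x : ℝ, ∑' k : ℤ, ‖inverseBloch V (x + k * 1)‖ₑ ^ 2 =
      ENNReal.ofReal (2 * Real.pi)⁻¹ * G (x : UnitAddCircle) := by
    filter_upwards [hGfin, ae_aestronglyMeasurable_coe hV] with x hx hxm
    have hnorm : ∀ ξ : ℝ, ‖Complex.exp (Complex.I * ξ * x) • V ξ (x : UnitAddCircle)‖ₑ =
        ‖V ξ (x : UnitAddCircle)‖ₑ := fun ξ => by
      rw [← ofReal_norm, norm_smul, Complex.norm_exp]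
      simp
    have hF : MemLp (fun ξ : ℝ => Complex.exp (Complex.I * ξ * x) • V ξ (x : UnitAddCircle)) 2
        brillouin := by
      refine memLp_two_of_lintegral_ne_top (AEStronglyMeasurable.smul (by fun_prop : Continuous
        fun ξ : ℝ => Complex.exp (Complex.I * ξ * x)).aestronglyMeasurable hxm) ?_
      simpa only [hnorm] using hx
    have h := tsum_enorm_sq_integral_exp_smul hF
    simp only [hnorm] at h
    rw [← h]
    refine tsum_congr fun k => ?_
    rw [inverseBloch]
    congr 4
    funext ξ
    rw [smul_smul, ← Complex.exp_add, AddCircle.coe_add, mul_one]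
    have hk : ((k : ℝ) : UnitAddCircle) = 0 := by
      rw [AddCircle.coe_eq_zero_iff]; exact ⟨k, by simp⟩
    rw [hk, add_zero]
    congr 2
    push_cast
    ring
  rw [lintegral_eq_lintegral_tsum_translates ((aestronglyMeasurable_inverseBloch hV).enorm.pow_const
    2) 0 one_pos, lintegral_congr_ae (ae_restrict_of_ae hfib),
    lintegral_const_mul' _ _ ENNReal.ofReal_ne_top, ← hswap]
  have hmp := measurePreserving_coe_unitAddCircle 0
  rw [← hmp.map_eq, lintegral_map' (hmp.map_eq ▸ hGm) hmp.aemeasurable]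

theorem norm_inverseBloch_le {β : ℝ → ℝ} {M : ℝ} (hβ : Integrable β brillouin) {x : ℝ}
    (h : ∀ᵐ ξ ∂brillouin, ‖V ξ (x : UnitAddCircle)‖ ≤ M * β ξ) :
    ‖inverseBloch V x‖ ≤ (2 * Real.pi)⁻¹ * (M * ∫ ξ, β ξ ∂brillouin) := by
  rw [inverseBloch, norm_smul, norm_inv, Complex.norm_of_nonneg (by positivity),
    intervalIntegral.integral_of_le (by linarith [Real.pi_pos]), ← integral_Icc_eq_integral_Ioc,
    ← integral_const_mul]
  gcongr
  refine norm_integral_le_of_norm_le (hβ.const_mul M) ?_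
  filter_upwards [h] with ξ hξ
  rw [norm_smul, Complex.norm_exp]
  simpa using hξ

/-- Interpolation between the `L²` and the `L^∞` bound. -/
theorem eLpNorm_le_of_enorm_le_of_eLpNorm_two_le {α E : Type*} [NormedAddCommGroup E]
    {m : MeasurableSpace α} {μ : Measure α} {h : α → E} {A B : ℝ} (hA : 0 ≤ A) (hB : 0 ≤ B)
    (h1 : ∀ᵐ x ∂μ, ‖h x‖ ≤ A) (h2 : ∫⁻ x, ‖h x‖ₑ ^ 2 ∂μ ≤ ENNReal.ofReal (B ^ 2)) {p : ℝ≥0∞}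
    (hp : 2 ≤ p) :
    eLpNorm h p μ ≤ ENNReal.ofReal (A ^ (1 - 2 * (p⁻¹).toReal) * B ^ (2 * (p⁻¹).toReal)) := by
  rcases eq_or_ne p ⊤ with rfl | hpt
  · simpa using! eLpNormEssSup_le_of_ae_bound h1
  have hp0 : p ≠ 0 := (two_pos.trans_le hp).ne'
  have hq : 2 ≤ p.toReal := by
    rw [← ENNReal.toReal_ofNat 2]
    exact ENNReal.toReal_mono hpt hp
  rw [eLpNorm_eq_lintegral_rpow_enorm_toReal hp0 hpt, ENNReal.toReal_inv]
  set q := p.toReal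
  have hle : ∫⁻ x, ‖h x‖ₑ ^ q ∂μ ≤ ENNReal.ofReal (A ^ (q - 2) * B ^ 2) := by
    calc ∫⁻ x, ‖h x‖ₑ ^ q ∂μ ≤ ∫⁻ x, ENNReal.ofReal (A ^ (q - 2)) * ‖h x‖ₑ ^ 2 ∂μ := by
          refine lintegral_mono_ae ?_
          filter_upwards [h1] with x hx
          have : ‖h x‖ₑ ^ q = ‖h x‖ₑ ^ (q - 2) * ‖h x‖ₑ ^ 2 := by
            rw [← ENNReal.rpow_natCast, ← ENNReal.rpow_add_of_nonneg _ _ (by linarith) (by simp)]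
            norm_num
          rw [this, ← ENNReal.ofReal_rpow_of_nonneg hA (by linarith)]
          gcongr
          rw [← ofReal_norm]
          exact ENNReal.ofReal_le_ofReal hx
      _ = ENNReal.ofReal (A ^ (q - 2)) * ∫⁻ x, ‖h x‖ₑ ^ 2 ∂μ :=
          lintegral_const_mul' _ _ ENNReal.ofReal_ne_top
      _ ≤ ENNReal.ofReal (A ^ (q - 2)) * ENNReal.ofReal (B ^ 2) := by gcongr
      _ = _ := (ENNReal.ofReal_mul (by positivity)).symm
  refine (ENNReal.rpow_le_rpow hle (by positivity)).trans_eq ?_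
  rw [ENNReal.ofReal_rpow_of_nonneg (by positivity) (by positivity),
    Real.mul_rpow (by positivity) (by positivity), ← Real.rpow_mul hA, ← Real.rpow_natCast,
    ← Real.rpow_mul hB]
  congr 3
  · field_simp
  · push_cast; ring

end Reconstruction

/-! ### Representatives and the two endpoint bounds -/

section Representative

variable {n : ℕ}

/-- The function `x ↦ e^{2πikx}` times the `j`-th unit vector, as a continuous function. -/
def expVec (i : ℤ × Fin n) : C(UnitAddCircle, CVec n) :=
  ⟨fun x => fourier i.1 x • EuclideanSpace.single i.2 1, by fun_prop⟩

theorem toLp_expVec (i : ℤ × Fin n) :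
    ContinuousMap.toLp 2 (AddCircle.haarAddCircle : Measure UnitAddCircle) ℂ (expVec i) =
      periodicBasis n i := by
  rw [coe_periodicBasis]
  rfl

theorem norm_expVec_le (i : ℤ × Fin n) : ‖expVec i‖ ≤ 1 := by
  refine (ContinuousMap.norm_le _ zero_le_one).2 fun x => ?_
  simp only [expVec, ContinuousMap.coe_mk, norm_smul, PiLp.norm_single, norm_one, mul_one]
  exact (Circle.norm_coe _).le

/-- A function with absolutely summable Fourier coefficients has a continuous representative. -/
theorem exists_continuous_representative {v : L2Per n} {M : ℝ}
    (h : ∀ s : Finset (ℤ × Fin n), ∑ i ∈ s, ‖(periodicBasis n).repr v i‖ ≤ M) :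
    ∃ F : C(UnitAddCircle, CVec n), F =ᵐ[AddCircle.haarAddCircle] v ∧
      (∀ x, HasSum (fun i => (periodicBasis n).repr v i • expVec i x) (F x)) ∧ ∀ x, ‖F x‖ ≤ M := by
  set a : ℤ × Fin n → ℂ := fun i => (periodicBasis n).repr v i with ha
  have hs : Summable fun i => ‖a i‖ := summable_of_sum_le (fun i => norm_nonneg _) h
  have hle : ∀ i, ‖a i • expVec (n := n) i‖ ≤ ‖a i‖ := fun i => by
    rw [norm_smul]
    exact mul_le_of_le_one_right (norm_nonneg _) (norm_expVec_le i)
  have hF : Summable fun i => a i • expVec (n := n) i := Summable.of_norm_bounded hs hle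
  have hsumF := hF.hasSum
  set F := ∑' i, a i • expVec (n := n) i with hFdef
  have hv : ContinuousMap.toLp 2 (AddCircle.haarAddCircle : Measure UnitAddCircle) ℂ F = v := by
    have h1 := hsumF.mapL
      (ContinuousMap.toLp (E := CVec n) 2 (AddCircle.haarAddCircle : Measure UnitAddCircle) ℂ)
    simp only [map_smul, toLp_expVec] at h1
    exact h1.unique ((periodicBasis n).hasSum_repr v)
  refine ⟨F, ?_, fun x => ?_, fun x => ?_⟩
  · rw [← hv]
    exact (ContinuousMap.coeFn_toLp _ F).symm
  · exact hsumF.mapL (ContinuousMap.evalCLM ℂ x)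
  · refine (F.norm_coe_le_norm x).trans ((tsum_of_norm_bounded hs.hasSum hle).trans ?_)
    exact hs.tsum_le_of_sum_le h

/-- The pointwise sum of the Fourier series is a limit of finite sums of products of functions of
`ξ` and of `y`, hence jointly measurable; absolute convergence identifies it with `W ξ` on almost
every fibre. -/
theorem exists_jointly_measurable_representative {W : ℝ → L2Per n}
    (hW : AEStronglyMeasurable W brillouin)
    (h : ∀ᵐ ξ ∂brillouin, ∃ M : ℝ, ∀ s : Finset (ℤ × Fin n),
      ∑ i ∈ s, ‖(periodicBasis n).repr (W ξ) i‖ ≤ M) :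
    ∃ V : ℝ → UnitAddCircle → CVec n,
      AEStronglyMeasurable (Function.uncurry V) (brillouin.prod AddCircle.haarAddCircle) ∧
      ∀ᵐ ξ ∂brillouin, V ξ =ᵐ[AddCircle.haarAddCircle] W ξ := by
  refine ⟨fun ξ y => ∑' i, (periodicBasis n).repr (W ξ) i • expVec i y, ?_, ?_⟩
  · refine aestronglyMeasurable_of_tendsto_ae (atTop : Filter (Finset (ℤ × Fin n)))
      (f := fun s z => ∑ i ∈ s, (periodicBasis n).repr (W z.1) i • expVec i z.2) (fun s => ?_) ?_
    · refine Finset.aestronglyMeasurable_fun_sum s fun i _ => AEStronglyMeasurable.fun_smul ?_ ?_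
      · refine AEStronglyMeasurable.comp_fst (f := fun ξ => (periodicBasis n).repr (W ξ) i) ?_
        simp only [HilbertBasis.repr_apply_apply]
        exact (innerSL ℂ (periodicBasis n i)).continuous.comp_aestronglyMeasurable hW
      · exact (map_continuous (expVec i)).aestronglyMeasurable.comp_snd
    · filter_upwards [Measure.quasiMeasurePreserving_fst.ae h] with z ⟨M, hz⟩
      obtain ⟨F, -, hF, -⟩ := exists_continuous_representative hz
      exact (hF z.2).summable.hasSum
  · filter_upwards [h] with ξ ⟨M, hξ⟩
    obtain ⟨F, hF, hs, -⟩ := exists_continuous_representative hξ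
    filter_upwards [hF] with y hy
    rw [(hs y).tsum_eq, hy]

variable {V : ℝ → UnitAddCircle → CVec n} {W : ℝ → L2Per n}

/-- By Tonelli the truncated excess of `‖V‖` over `β` has integral zero on the product. -/
theorem ae_prod_norm_le
    (hV : AEStronglyMeasurable (Function.uncurry V) (brillouin.prod AddCircle.haarAddCircle))
    {β : ℝ → ℝ} (hβ : AEMeasurable β brillouin)
    (h : ∀ᵐ ξ ∂brillouin, ∀ᵐ y ∂AddCircle.haarAddCircle, ‖V ξ y‖ ≤ β ξ) :
    ∀ᵐ z ∂brillouin.prod AddCircle.haarAddCircle, ‖V z.1 z.2‖ ≤ β z.1 := by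
  have hm : AEMeasurable (fun z : ℝ × UnitAddCircle => ‖V z.1 z.2‖ₑ - ENNReal.ofReal (β z.1))
      (brillouin.prod AddCircle.haarAddCircle) :=
    hV.enorm.sub (hβ.comp_quasiMeasurePreserving Measure.quasiMeasurePreserving_fst).ennreal_ofReal
  have h0 : ∫⁻ z, ‖V z.1 z.2‖ₑ - ENNReal.ofReal (β z.1)
      ∂brillouin.prod AddCircle.haarAddCircle = 0 := by
    rw [lintegral_prod _ hm, ← lintegral_zero (μ := brillouin)]
    refine lintegral_congr_ae ?_
    filter_upwards [h] with ξ hξ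
    rw [← lintegral_zero (μ := (AddCircle.haarAddCircle : Measure UnitAddCircle))]
    refine lintegral_congr_ae ?_
    filter_upwards [hξ] with y hy
    rw [tsub_eq_zero_iff_le, ← ofReal_norm]
    exact ENNReal.ofReal_le_ofReal hy
  have hpos : ∀ᵐ z : ℝ × UnitAddCircle ∂brillouin.prod AddCircle.haarAddCircle, 0 ≤ β z.1 :=
    Measure.quasiMeasurePreserving_fst.ae (p := fun ξ => 0 ≤ β ξ) (by
      filter_upwards [h] with ξ hξ
      obtain ⟨y, hy⟩ := hξ.exists
      exact (norm_nonneg _).trans hy)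
  filter_upwards [(lintegral_eq_zero_iff' hm).1 h0, hpos] with z hz hz0
  rw [Pi.zero_apply, tsub_eq_zero_iff_le, ← ofReal_norm] at hz
  exact (ENNReal.ofReal_le_ofReal_iff hz0).1 hz

theorem memLp_norm_blochTransform (g : L2Line n) :
    MemLp (fun ξ => ‖blochTransform g ξ‖) 2 brillouin := by
  refine (memLp_two_of_lintegral_ne_top (aestronglyMeasurable_blochTransform g) ?_).norm
  rw [lintegral_enorm_sq_blochTransform]
  exact ENNReal.mul_ne_top ENNReal.ofReal_ne_top (ENNReal.pow_ne_top enorm_ne_top)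

theorem integral_norm_sq_blochTransform (g : L2Line n) :
    ∫ ξ, ‖blochTransform g ξ‖ ^ 2 ∂brillouin = 2 * Real.pi * ‖g‖ ^ 2 := by
  rw [integral_eq_lintegral_of_nonneg_ae (Eventually.of_forall fun ξ => sq_nonneg _)
    ((memLp_norm_blochTransform g).1.pow 2)]
  simp only [ENNReal.ofReal_pow (norm_nonneg _), ofReal_norm]
  rw [lintegral_enorm_sq_blochTransform]
  simp [Real.pi_pos.le]

theorem integral_norm_blochTransform_le (g : L2Line n) :
    (2 * Real.pi)⁻¹ * ∫ ξ, ‖blochTransform g ξ‖ ∂brillouin ≤ ‖g‖ := by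
  have hβ := memLp_norm_blochTransform g
  have hi := hβ.integrable one_le_two
  have hi2 : Integrable (fun ξ => ‖blochTransform g ξ‖ ^ 2) brillouin := hβ.integrable_sq
  set S := ∫ ξ, ‖blochTransform g ξ‖ ∂brillouin with hS
  -- Here `a` is the mean of the norm over the zone; nonnegativity of the variance is the
  -- Cauchy–Schwarz inequality needed.
  set a := (2 * Real.pi)⁻¹ * S with ha
  have h0 : 0 ≤ ∫ ξ, (‖blochTransform g ξ‖ - a) ^ 2 ∂brillouin := by positivity
  have h1 : ∫ ξ, (‖blochTransform g ξ‖ - a) ^ 2 ∂brillouin =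
      2 * Real.pi * ‖g‖ ^ 2 - 2 * a * S + 2 * Real.pi * a ^ 2 := by
    have h2 : ∀ ξ, (‖blochTransform g ξ‖ - a) ^ 2 =
        ‖blochTransform g ξ‖ ^ 2 - 2 * a * ‖blochTransform g ξ‖ + a ^ 2 := fun ξ => by ring
    simp only [h2]
    have hi3 : Integrable (fun ξ => ‖blochTransform g ξ‖ ^ 2 - 2 * a * ‖blochTransform g ξ‖)
      brillouin := hi2.sub (hi.const_mul _)
    rw [integral_add hi3 (integrable_const _), integral_sub hi2 (hi.const_mul _), integral_const_mul, integral_norm_sq_blochTransform]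
    simp [Measure.real]
    rw [ENNReal.toReal_ofReal (by linarith [Real.pi_pos])]
    ring
  have hSa : S = 2 * Real.pi * a := by rw [ha]; field_simp
  rw [h1, hSa] at h0
  refine abs_le_of_sq_le_sq' ?_ (norm_nonneg _) |>.2
  have := Real.two_pi_pos
  nlinarith

/-- The `ℓ¹` bound on coefficients controls `V ξ` uniformly in `x`, and integration in `ξ` gives the
sup bound and integrability. The `ℓ²` bound passes through Parseval on both sides, where the factors
`2π` cancel. -/
theorem inverseBloch_bounds
    (hV : AEStronglyMeasurable (Function.uncurry V) (brillouin.prod AddCircle.haarAddCircle))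
    (hVW : ∀ᵐ ξ ∂brillouin, V ξ =ᵐ[AddCircle.haarAddCircle] W ξ) {g : L2Line n} {A₁ A₂ : ℝ}
    (hA₁ : 0 ≤ A₁) (hA₂ : 0 ≤ A₂)
    (h₁ : ∀ᵐ ξ ∂brillouin, ∀ s : Finset (ℤ × Fin n),
      ∑ i ∈ s, ‖(periodicBasis n).repr (W ξ) i‖ ≤ A₁ * ‖blochTransform g ξ‖)
    (h₂ : ∀ᵐ ξ ∂brillouin, ‖W ξ‖ ≤ A₂ * ‖blochTransform g ξ‖) :
    (∀ᵐ x : ℝ, Integrable (fun ξ => V ξ (x : UnitAddCircle)) brillouin) ∧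
    (∀ᵐ x : ℝ, ‖inverseBloch V x‖ ≤ A₁ * ‖g‖) ∧
    ∫⁻ x, ‖inverseBloch V x‖ₑ ^ 2 ≤ ENNReal.ofReal ((A₂ * ‖g‖) ^ 2) := by
  have hi := (memLp_norm_blochTransform g).integrable one_le_two
  have hb : ∀ᵐ x : ℝ, ∀ᵐ ξ ∂brillouin, ‖V ξ (x : UnitAddCircle)‖ ≤ A₁ * ‖blochTransform g ξ‖ := by
    refine ae_ae_coe_of_ae_ae (p := fun ξ y => ‖V ξ y‖ ≤ A₁ * ‖blochTransform g ξ‖)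
      (ae_prod_norm_le hV (hi.1.aemeasurable.const_mul A₁) ?_)
    filter_upwards [hVW, h₁] with ξ hξ hξ1
    obtain ⟨F, hF, -, hFM⟩ := exists_continuous_representative hξ1
    filter_upwards [hξ, hF] with y hy hFy
    rw [hy, ← hFy]
    exact hFM y
  have hL2 : ∫⁻ ξ, ∫⁻ y, ‖V ξ y‖ₑ ^ 2 ∂AddCircle.haarAddCircle ∂brillouin ≤
      ENNReal.ofReal (A₂ ^ 2) * (ENNReal.ofReal (2 * Real.pi) * ‖g‖ₑ ^ 2) := by
    rw [← lintegral_enorm_sq_blochTransform, ← lintegral_const_mul' _ _ ENNReal.ofReal_ne_top]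
    refine lintegral_mono_ae ?_
    filter_upwards [hVW, h₂] with ξ hξ hξ2
    rw [lintegral_congr_ae (g := fun y => ‖W ξ y‖ₑ ^ 2) (by filter_upwards [hξ] with y hy; rw [hy]),
      lintegral_enorm_sq, ← ofReal_norm, ← ofReal_norm, ENNReal.ofReal_pow hA₂, ← mul_pow,
      ← ENNReal.ofReal_mul hA₂]
    gcongr
  refine ⟨?_, ?_, ?_⟩
  · filter_upwards [hb, ae_aestronglyMeasurable_coe hV] with x hx hxm
    exact (hi.const_mul A₁).mono' hxm hx
  · filter_upwards [hb] with x hx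
    refine (norm_inverseBloch_le hi hx).trans ?_
    rw [mul_left_comm]
    exact mul_le_mul_of_nonneg_left (integral_norm_blochTransform_le g) hA₁
  · rw [lintegral_enorm_sq_inverseBloch hV (ne_top_of_le_ne_top (ENNReal.mul_ne_top
      ENNReal.ofReal_ne_top (ENNReal.mul_ne_top ENNReal.ofReal_ne_top
        (ENNReal.pow_ne_top enorm_ne_top))) hL2)]
    refine (mul_le_mul_right hL2 _).trans_eq ?_
    rw [← ofReal_norm, ← ENNReal.ofReal_pow (norm_nonneg _), ← ENNReal.ofReal_mul (by positivity),
      ← ENNReal.ofReal_mul (by positivity), ← ENNReal.ofReal_mul (by positivity)]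
    congr 1
    field_simp

end Representative

/-! ### Decay and smoothing of the high-frequency part -/

section HighFrequency

/-- For `t ≥ 1` half of the decay rate pays for the factor `t^{1/4}`; for `t ≤ 1` the exponentials
are comparable to one. -/
theorem min_rpow_mul_exp_le {θ t : ℝ} (hθ : 0 < θ) (ht : 0 < t) :
    (min t 1) ^ (-(1 / 4 : ℝ)) * Real.exp (-θ * (t - min t 1)) ≤
      Real.exp θ * (1 + 2 / θ) * (t ^ (-(1 / 4 : ℝ)) * Real.exp (-(θ / 2) * t)) := by
  rcases le_total t 1 with h | h
  · rw [min_eq_left h, sub_self, mul_zero, Real.exp_zero, mul_one]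
    have h1 : 1 ≤ Real.exp θ * Real.exp (-(θ / 2) * t) := by
      rw [← Real.exp_add]
      exact Real.one_le_exp (by nlinarith)
    have h2 : 1 ≤ 1 + 2 / θ := le_add_of_nonneg_right (by positivity)
    calc t ^ (-(1 / 4 : ℝ)) = t ^ (-(1 / 4 : ℝ)) * (1 * 1) := by ring
      _ ≤ t ^ (-(1 / 4 : ℝ)) * ((Real.exp θ * Real.exp (-(θ / 2) * t)) * (1 + 2 / θ)) := by gcongr
      _ = _ := by ring
  · have h1 : t ^ (1 / 4 : ℝ) ≤ (1 + 2 / θ) * Real.exp (θ / 2 * t) := by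
      have h2 : t ^ (1 / 4 : ℝ) ≤ t := by
        simpa using Real.rpow_le_rpow_of_exponent_le h (by norm_num : (1 / 4 : ℝ) ≤ 1)
      have h3 : t ≤ 2 / θ * Real.exp (θ / 2 * t) := by
        have := Real.add_one_le_exp (θ / 2 * t)
        calc t = 2 / θ * (θ / 2 * t) := by field_simp
          _ ≤ _ := by gcongr; linarith
      have h4 := Real.exp_pos (θ / 2 * t)
      linarith
    rw [min_eq_right h, Real.one_rpow, one_mul, Real.rpow_neg ht.le]
    have h5 : Real.exp (-θ * (t - 1)) =
        Real.exp θ * (Real.exp (-(θ / 2) * t) * Real.exp (-(θ / 2) * t)) := by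
      rw [← Real.exp_add, ← Real.exp_add]; ring_nf
    have h6 : Real.exp (-(θ / 2) * t) ≤ (1 + 2 / θ) * (t ^ (1 / 4 : ℝ))⁻¹ := by
      rw [← div_eq_mul_inv, le_div_iff₀ (by positivity), neg_mul, Real.exp_neg,
        inv_mul_le_iff₀ (Real.exp_pos _)]
      linarith
    rw [h5]
    calc _ ≤ Real.exp θ * (((1 + 2 / θ) * (t ^ (1 / 4 : ℝ))⁻¹) * Real.exp (-(θ / 2) * t)) := by gcongr
      _ = _ := by ring

/-- Decay acts first, on a time interval of length `t - min t 1`, and smoothing acts last, on one of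
length `min t 1`. -/
theorem sum_norm_repr_le_of_decay {ι H : Type*} [NormedAddCommGroup H] [InnerProductSpace ℂ H]
    {b : HilbertBasis ι ℂ H} {A : H → H → Prop} {T : ℝ → H →L[ℂ] H} {Q : H →L[ℂ] H}
    (hT : IsSemigroupGeneratedBy A T) {C₀ C₁ θ : ℝ} (hC₁ : 0 ≤ C₁) (hθ : 0 < θ)
    (hQ : ∀ t, 0 ≤ t → ‖T t * Q‖ ≤ C₀ * Real.exp (-θ * t))
    (hs : ∀ t ∈ Ioc (0 : ℝ) 1, ∀ (s : Finset ι) (v : H),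
      ∑ i ∈ s, ‖b.repr (T t v) i‖ ≤ C₁ * t ^ (-(1 / 4 : ℝ)) * ‖v‖)
    {t : ℝ} (ht : 0 < t) (s : Finset ι) (v : H) :
    ∑ i ∈ s, ‖b.repr (T t (Q v)) i‖ ≤ C₁ * C₀ * (Real.exp θ * (1 + 2 / θ)) *
      (t ^ (-(1 / 4 : ℝ)) * Real.exp (-(θ / 2) * t)) * ‖v‖ := by
  have hτ : min t 1 ∈ Ioc (0 : ℝ) 1 := ⟨lt_min ht one_pos, min_le_right _ _⟩
  have hτt : 0 ≤ t - min t 1 := sub_nonneg.2 (min_le_left _ _)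
  have hC₀ : 0 ≤ C₀ := by simpa using (norm_nonneg _).trans (hQ 0 le_rfl)
  have h1 : T t (Q v) = T (min t 1) ((T (t - min t 1) * Q) v) := by
    conv_lhs => rw [← add_sub_cancel (min t 1) t, hT.add _ _ hτ.1.le hτt]
    rfl
  rw [h1]
  have := hτ.1
  calc _ ≤ C₁ * (min t 1) ^ (-(1 / 4 : ℝ)) * ‖(T (t - min t 1) * Q) v‖ := hs _ hτ s _
    _ ≤ C₁ * (min t 1) ^ (-(1 / 4 : ℝ)) * (C₀ * Real.exp (-θ * (t - min t 1)) * ‖v‖) := by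
      gcongr
      exact ContinuousLinearMap.le_of_opNorm_le _ (hQ _ hτt) v
    _ = C₁ * C₀ * ((min t 1) ^ (-(1 / 4 : ℝ)) * Real.exp (-θ * (t - min t 1))) * ‖v‖ := by ring
    _ ≤ C₁ * C₀ * (Real.exp θ * (1 + 2 / θ) *
        (t ^ (-(1 / 4 : ℝ)) * Real.exp (-(θ / 2) * t))) * ‖v‖ := by
      have := min_rpow_mul_exp_le hθ ht
      exact mul_le_mul_of_nonneg_right (mul_le_mul_of_nonneg_left this (by positivity))
        (norm_nonneg v)
    _ = _ := by ring

variable {ι H : Type*} [NormedAddCommGroup H] [InnerProductSpace ℂ H] [CompleteSpace H]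
  {b : HilbertBasis ι ℂ H} {d : ℝ → ι → ℂ} {B : H →L[ℂ] H} {T : ℝ → ℝ → H →L[ℂ] H}

/-- Exponential decay of the semigroups away from the critical eigenvalue near `ξ = 0`. -/
theorem exists_decay_highFrequency (hd : ∀ ξ i, (d ξ i).re ≤ 0)
    (hfin : ∀ ξ, ∀ κ : ℝ, {i | -κ < (d ξ i).re}.Finite)
    (hG : Continuous fun ξ => diagResolvent b (d ξ))
    (hT : ∀ ξ, IsDuhamel b (d ξ) B (T ξ)) (hTc : ∀ t, 0 ≤ t → Continuous fun ξ => T ξ t)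
    {r : ℝ} (hr : IsolatesZero (perturbedDiag b (d 0) B) r)
    (hσ0 : ∀ μ ∈ opSpectrum (perturbedDiag b (d 0) B), μ ≠ 0 → μ.re < 0)
    (hσ : ∀ ξ ∈ Icc (-Real.pi) Real.pi, ξ ≠ 0 → ∀ μ ∈ opSpectrum (perturbedDiag b (d ξ) B),
      μ.re < 0) :
    ∃ ε₀ : ℝ, 0 < ε₀ ∧
      (∀ ξ : ℝ, |ξ| ≤ 2 * ε₀ → ∀ μ : ℂ, ‖μ‖ = r → μ ∉ opSpectrum (perturbedDiag b (d ξ) B)) ∧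
      ∀ ε : ℝ, 0 < ε → ε ≤ ε₀ → ∀ φ : ℝ → ℝ, IsCutoff ε φ →
        (∀ ξ t, 0 ≤ t → Commute ((φ ξ : ℂ) • totalEigenprojection (perturbedDiag b (d ξ) B) r)
          (T ξ t)) ∧
        (Continuous fun ξ => (φ ξ : ℂ) • totalEigenprojection (perturbedDiag b (d ξ) B) r) ∧
        ∃ C θ : ℝ, 0 < C ∧ 0 < θ ∧ ∀ ξ ∈ Icc (-Real.pi) Real.pi, ∀ t, 0 ≤ t →
          ‖T ξ t * (1 - (φ ξ : ℂ) • totalEigenprojection (perturbedDiag b (d ξ) B) r)‖ ≤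
            C * Real.exp (-θ * t) := by
  have hsg := fun ξ => (hT ξ).isSemigroupGeneratedBy (hd ξ)
  set P := fun ξ => totalEigenprojection (perturbedDiag b (d ξ) B) r with hP
  have hs0 : ∀ μ ∈ Metric.sphere (0 : ℂ) r, μ ∉ opSpectrum (perturbedDiag b (d 0) B) := by
    intro μ hμ hμσ
    rw [mem_sphere_zero_iff_norm] at hμ
    have h0 := hr.2 μ hμσ hμ.le
    rw [h0, norm_zero] at hμ
    exact hr.1.ne hμ
  obtain ⟨C₁, θ₁, hC₁, hθ₁, hdec⟩ :=
    exists_decay_complement_nhds hd hfin hG hT hTc hr.1 hs0 hσ0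
  obtain ⟨δ, hδ, hball⟩ := Metric.eventually_nhds_iff.1
    ((eventually_sphere_notMem_opSpectrum hd hfin hG hs0).and hdec)
  simp only [Real.dist_0_eq_abs] at hball
  have hsph : ∀ ξ : ℝ, |ξ| < δ → ∀ μ ∈ Metric.sphere (0 : ℂ) r,
      μ ∉ opSpectrum (perturbedDiag b (d ξ) B) := fun ξ hξ => (hball hξ).1
  -- With this choice the cutoff vanishes for `|ξ| ≥ δ/2`, well inside the interval `|ξ| < δ` where
  -- the circle avoids the spectrum and the local decay holds.
  refine ⟨δ / 4, by positivity, fun ξ hξ μ hμ => hsph ξ (by linarith) μ (by simpa using hμ), ?_⟩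
  intro ε hε hεδ φ hφ
  have hφ0 : ∀ ξ, δ ≤ |ξ| → φ ξ = 0 := fun ξ hξ => hφ.2.2 ξ (by linarith)
  have hcont : Continuous fun ξ => (φ ξ : ℂ) • P ξ := by
    refine continuous_iff_continuousAt.2 fun ξ => ?_
    rcases lt_or_ge |ξ| δ with h | h
    · have hopen : IsOpen {ξ : ℝ | |ξ| < δ} := isOpen_lt continuous_abs continuous_const
      have hPc : ContinuousAt P ξ :=
        (continuousOn_totalEigenprojection hd hfin hG hr.1.le hsph).continuousAt (hopen.mem_nhds h)
      exact (Complex.continuous_ofReal.comp hφ.1.continuous).continuousAt.smul hPc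
    -- Away from `0` the map `P` need not be continuous, but the cutoff vanishes in a neighbourhood.
    · have hev : (fun ξ => (φ ξ : ℂ) • P ξ) =ᶠ[𝓝 ξ] fun _ => 0 := by
        have hopen : IsOpen {ξ : ℝ | 2 * ε < |ξ|} := isOpen_lt continuous_const continuous_abs
        filter_upwards [hopen.mem_nhds (by show 2 * ε < |ξ|; linarith)] with ξ' hξ'
        rw [hφ.2.2 ξ' (le_of_lt hξ'), Complex.ofReal_zero, zero_smul]
      exact continuousAt_const.congr hev.symm
  refine ⟨fun ξ t ht => ?_, hcont, ?_⟩
  · rcases lt_or_ge |ξ| δ with h | h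
    · exact (commute_totalEigenprojection_semigroup (hd ξ) (hfin ξ) (hsg ξ) hr.1.le (hsph ξ h)
        ht).smul_left _
    · rw [hφ0 ξ h, Complex.ofReal_zero, zero_smul]
      exact Commute.zero_left _
  have hcpt : IsCompact (Icc (-Real.pi) Real.pi ∩ {ξ : ℝ | ε ≤ |ξ|}) :=
    isCompact_Icc.inter_right (isClosed_le continuous_const continuous_abs)
  obtain ⟨C₂, θ₂, hC₂, hθ₂, hdec₂⟩ := exists_decay_of_isCompact hd hfin hT hTc hcpt
    fun ξ hξ => hσ ξ hξ.1 (by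
      rintro rfl
      have h0 : ε ≤ |(0 : ℝ)| := hξ.2
      rw [abs_zero] at h0
      linarith)
  obtain ⟨M, hM⟩ := isCompact_Icc.exists_bound_of_continuousOn (s := Icc (-Real.pi) Real.pi)
    (f := fun ξ => 1 - (φ ξ : ℂ) • P ξ) (continuous_const.sub hcont).continuousOn
  have hM0 : 0 ≤ M := (norm_nonneg _).trans (hM 0 ⟨by linarith [Real.pi_pos], Real.pi_pos.le⟩)
  refine ⟨C₁ + C₂ * M, min θ₁ θ₂, by positivity, lt_min hθ₁ hθ₂, fun ξ hξ t ht => ?_⟩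
  -- For `|ξ| ≤ ε` the cutoff equals one and the full complement of the projection appears. For `|ξ|
  -- ≥ ε`, including the transition region, the whole semigroup decays and `1 - φP` needs only to be
  -- bounded.
  rcases le_total |ξ| ε with h | h
  · rw [hφ.2.1 ξ h, Complex.ofReal_one, one_smul]
    refine ((hball (by linarith : |ξ| < δ)).2 t ht).trans ?_
    gcongr
    · exact le_add_of_nonneg_right (by positivity)
    · exact min_le_left _ _
  · refine (norm_mul_le _ _).trans ((mul_le_mul (hdec₂ ξ ⟨hξ, h⟩ t ht) (hM ξ hξ) (norm_nonneg _)
      (by positivity)).trans ?_)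
    rw [mul_right_comm]
    gcongr
    · exact le_add_of_nonneg_left hC₁.le
    · exact min_le_right _ _

end HighFrequency

end ReactionDiffusion

end

/-! ### Assembly of the proposition -/

open ReactionDiffusion in
theorem proposition3p1 (n : ℕ) (c : ℝ) (f : RVec n → RVec n) (u : ℝ → RVec n)
    (K : ℕ) (hK : 2 ≤ K) (hf : ContDiff ℝ K f)
    (hu : IsPeriodicStandingWave c f u)
    (hD1 : IsSimpleEigenvalue (BlochOp c f u 0) 0)
    (hD1' : ∀ μ ∈ opSpectrum (BlochOp c f u 0), μ ≠ 0 → μ.re ≠ 0)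
    (hD2 : ∃ θ₀ : ℝ, 0 < θ₀ ∧ ∀ ξ ∈ Set.Icc (-Real.pi) Real.pi,
      ∀ μ ∈ opSpectrum (BlochOp c f u ξ), μ.re ≤ -θ₀ * |ξ| ^ 2) :
    (∃ r, IsolatesZero (BlochOp c f u 0) r) ∧
    ∀ r, IsolatesZero (BlochOp c f u 0) r →
      ∃ ε₀ : ℝ, 0 < ε₀ ∧
        (∀ ξ : ℝ, |ξ| ≤ 2 * ε₀ → ∀ μ : ℂ, ‖μ‖ = r → μ ∉ opSpectrum (BlochOp c f u ξ)) ∧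
        ∀ ε : ℝ, 0 < ε → ε ≤ ε₀ → ∀ φ : ℝ → ℝ, IsCutoff ε φ →
          ∃ θ C : ℝ, 0 < θ ∧ 0 < C ∧ ∀ (g : L2Line n) (t : ℝ), 0 < t →
            (∃ h, IsHighFrequencyPart c f u r φ t g h) ∧
            ∀ h, IsHighFrequencyPart c f u r φ t g h → ∀ p : ENNReal, 2 ≤ p →
              MeasureTheory.eLpNorm h p MeasureTheory.volume ≤
                ENNReal.ofReal (C * t ^ (-(1 / 2 : ℝ) * (1 / 2 - (p⁻¹).toReal)) *
                  Real.exp (-θ * t) * ‖g‖) := by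
  obtain ⟨A, hA⟩ := exists_potential (by omega : 1 ≤ K) hf hu
  have hL := blochOp_eq_perturbedDiag hA (c := c)
  obtain ⟨θ₀, hθ₀, hD2⟩ := hD2
  simp only [hL] at hD1 hD1' hD2 ⊢
  have hd := fun ξ => re_blochSymbol_nonpos (n := n) c ξ
  have hfin := fun ξ => finite_lt_re_blochSymbol (n := n) c ξ
  refine ⟨exists_isolatesZero (hd 0) (hfin 0) hD1, fun r hr => ?_⟩
  choose T hT using fun ξ => exists_isDuhamel (b := periodicBasis n) (hd ξ) (multiplication A)
  have hTc := fun t (ht : (0 : ℝ) ≤ t) => continuous_isDuhamel_blochSymbol hT ht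
  have hsg := fun ξ => (hT ξ).isSemigroupGeneratedBy (hd ξ)
  have h0 : (0 : ℝ) ∈ Icc (-Real.pi) Real.pi := ⟨by linarith [Real.pi_pos], Real.pi_pos.le⟩
  obtain ⟨ε₀, hε₀, hsph, H⟩ := exists_decay_highFrequency hd hfin
    (continuous_diagResolvent_blochSymbol _ c) hT hTc hr
    -- At `ξ = 0` the bound (D2) gives only `Re μ ≤ 0`; the second part of (D1) excludes the rest of
    -- the imaginary axis.
    (fun μ hμ hμ0 => lt_of_le_of_ne (by simpa using hD2 0 h0 μ hμ) (hD1' μ hμ hμ0))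
    (fun ξ hξ hξ0 μ hμ => (hD2 ξ hξ μ hμ).trans_lt (by
      have := abs_pos.2 hξ0
      rw [neg_mul, neg_lt_zero]
      positivity))
  refine ⟨ε₀, hε₀, hsph, fun ε hε hε' φ hφ => ?_⟩
  obtain ⟨hcomm, hcont, C₀, θ, hC₀, hθ, hdec⟩ := H ε hε hε' φ hφ
  set Φ : ℝ → L2Per n →L[ℂ] L2Per n := fun ξ => (φ ξ : ℂ) • totalEigenprojection
    (perturbedDiag (periodicBasis n) (blochSymbol c ξ) (multiplication A)) r with hΦ
  set C₁ : ℝ := √(6 * n) * (1 + 2 * (‖multiplication A‖ * Real.exp ‖multiplication A‖)) with hC₁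
  set C : ℝ := max C₀ (C₁ * C₀ * (Real.exp θ * (1 + 2 / θ))) with hC
  have hC0 : 0 < C := lt_max_of_lt_left hC₀
  refine ⟨θ / 2, C, half_pos hθ, hC0, fun g t ht => ?_⟩
  -- Since `φP` commutes with the semigroup, `1 - φP` may be applied before the evolution, in the
  -- order required by the smoothing estimate.
  set W : ℝ → L2Per n := fun ξ => T ξ t ((1 - Φ ξ) (blochTransform g ξ)) with hW
  have hWeq : ∀ ξ, T ξ t (blochTransform g ξ) - (φ ξ : ℂ) • totalEigenprojection
      (perturbedDiag (periodicBasis n) (blochSymbol c ξ) (multiplication A)) r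
        (T ξ t (blochTransform g ξ)) = W ξ := fun ξ => by
    have h1 : Φ ξ (T ξ t (blochTransform g ξ)) = T ξ t (Φ ξ (blochTransform g ξ)) :=
      congrArg (fun S : L2Per n →L[ℂ] L2Per n => S (blochTransform g ξ)) (hcomm ξ t ht.le).eq
    simp only [hW, sub_apply, one_apply_eq_self, map_sub, ← h1]
    rfl
  have hWm : AEStronglyMeasurable W brillouin := by
    have h1 : Continuous fun ξ => T ξ t * (1 - Φ ξ) :=
      (hTc t ht.le).mul (continuous_const.sub hcont)
    have h2 := (ContinuousLinearMap.id ℂ (L2Per n →L[ℂ] L2Per n)).aestronglyMeasurable_comp₂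
      h1.aestronglyMeasurable (aestronglyMeasurable_blochTransform g)
    exact h2
  set E : ℝ := Real.exp (-(θ / 2) * t) with hE
  have h₁ : ∀ᵐ ξ ∂brillouin, ∀ s : Finset (ℤ × Fin n),
      ∑ i ∈ s, ‖(periodicBasis n).repr (W ξ) i‖ ≤
        C * (t ^ (-(1 / 4 : ℝ)) * E) * ‖blochTransform g ξ‖ := by
    filter_upwards [ae_restrict_mem measurableSet_Icc] with ξ hξ s
    refine (sum_norm_repr_le_of_decay (hsg ξ) (C₁ := C₁) (by positivity) hθ (hdec ξ hξ)
      (fun τ hτ s v => (hT ξ).sum_norm_repr_le (hd ξ) (Real.sqrt_nonneg _)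
        (fun t ht s => sum_exp_re_blochSymbol_le c hξ ht s) hτ s v) ht s _).trans ?_
    gcongr
    exact le_max_right _ _
  have h₂ : ∀ᵐ ξ ∂brillouin, ‖W ξ‖ ≤ C * E * ‖blochTransform g ξ‖ := by
    filter_upwards [ae_restrict_mem measurableSet_Icc] with ξ hξ
    refine (ContinuousLinearMap.le_of_opNorm_le _ (hdec ξ hξ t ht.le) _).trans ?_
    gcongr
    · exact le_max_left _ _
    · exact Real.exp_le_exp.2 (by nlinarith)
  refine ⟨?_, ?_⟩
  · obtain ⟨V, hV, hVW⟩ := exists_jointly_measurable_representative hWm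
      (h₁.mono fun ξ hξ => ⟨_, hξ⟩)
    refine ⟨inverseBloch V, T, V, fun ξ _ => hL ξ ▸ hsg ξ, hV, ?_, ?_, Eventually.of_forall
      fun x => rfl⟩
    · filter_upwards [hVW] with ξ hξ
      simp only [hL, hWeq]
      exact hξ
    · exact (inverseBloch_bounds hV hVW (by positivity) (by positivity) h₁ h₂).1
  · rintro h ⟨T', V, hT', hV, hVW', -, hh⟩ p hp
    have hVW : ∀ᵐ ξ ∂brillouin, V ξ =ᵐ[AddCircle.haarAddCircle] W ξ := by
      filter_upwards [hVW', ae_restrict_mem measurableSet_Icc] with ξ hξ hξI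
      -- The semigroup is determined by its generator, so the estimate holds for every admissible
      -- choice in the definition of the high-frequency part.
      have h1 : T' ξ t = T ξ t :=
        (hL ξ ▸ hT' ξ hξI).eq_of_perturbedDiag (hd ξ) (hsg ξ) ht.le
      rw [h1, hL, hWeq] at hξ
      exact hξ
    obtain ⟨-, hsup, hL2⟩ := inverseBloch_bounds hV hVW (by positivity) (by positivity) h₁ h₂
    have hh' : h =ᵐ[volume] inverseBloch V := hh
    rw [eLpNorm_congr_ae hh']
    refine (eLpNorm_le_of_enorm_le_of_eLpNorm_two_le (by positivity) (by positivity) hsup hL2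
      hp).trans_eq ?_
    have hp2 : (p⁻¹).toReal ≤ 1 / 2 := by
      have h1 := ENNReal.toReal_mono (by simp) (ENNReal.inv_le_inv.2 hp)
      simpa using h1
    set x := (p⁻¹).toReal with hx
    have hx0 : 0 ≤ x := ENNReal.toReal_nonneg
    -- The two endpoint bounds differ only by `t^{-1/4}`, and `(t^{-1/4})^{1-2/p}` is the claimed
    -- power of `t`.
    have h1 : C * (t ^ (-(1 / 4 : ℝ)) * E) * ‖g‖ = t ^ (-(1 / 4 : ℝ)) * (C * E * ‖g‖) := by ring
    congr 1
    rw [h1, Real.mul_rpow (by positivity) (by positivity), mul_assoc,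
      ← Real.rpow_add_of_nonneg (by positivity) (by linarith) (by linarith), sub_add_cancel,
      Real.rpow_one, ← Real.rpow_mul ht.le]
    ring_nf
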